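/- Let $\tau\ge 0$, $s=(0,0)$, $t=(0,\tau)$, and let $\sigma=st$ be the closed vertical segment joining them. The model of computation is the real RAM: unit-cost exact arithmetic ($+,-,\times,/$) and comparisons on real numbers, and unit-cost arithmetic on integer words of $O(\log n)$ bits, which serve as addresses. Let $B$ be a set of $n$ points in the plane with positive $x$-coordinates. Then $B$ (together with $\tau$) can be preprocessed in $O(n\log^3 n)$ time into a data structure such that, for any query point $a$ with negative $x$-coordinate, one can decide in $O(\log^3 n)$ time whether the set $$\{\,b\in B \mid ab \text{ intersects } \sigma \text{ and } |ab|\le 1\,\}$$ is empty. The same data structure can also be used to decide in $O(\log^3 n)$ time, for any query point $a$ with negative $x$-coordinate, whether the set $$\{\,b\in B \mid ab \text{ does not intersect } \sigma \text{ and } |ab|\le 1\,\}$$ is empty. Here $ab$ is the closed segment with endpoints $a$ and $b$, $|ab|$ is its Euclidean length, the constants hidden in the $O$-notation are absolute (independent of $\tau$, $B$ and $a$), and any number of queries of both kinds may be asked in any order. -/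

import Mathlib

open Filter Asymptotics

noncomputable section

/-! ## A real RAM with logarithmic word size

The machine has finitely many integer arrays and finitely many real arrays (a program mentions
only finitely many array names); a register is an array cell with a constant index.  Integer cells
hold machine words, i.e. numbers below a word bound `W`, and integer arithmetic is performed
modulo `W`.  Real cells hold exact real numbers, on which the four field operations and
comparisons are available (no rounding, no roots, no conversion between reals and integers).
Only integers can be used as addresses.  Programs are finite structured programs whose only
literals are integers.  Every operation, memory access, test and assignment costs one
time unit. -/

namespace RealRAM

/-- Memory contents: `nat A i` (resp. `real A i`) is cell `i` of the integer (resp. real) array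
with name `A`. -/
structure State where
  nat : ℕ → ℕ → ℕ
  real : ℕ → ℕ → ℝ

namespace State

def setNat (s : State) (A i v : ℕ) : State :=
  { s with nat := Function.update s.nat A (Function.update (s.nat A) i v) }

def setReal (s : State) (A i : ℕ) (v : ℝ) : State :=
  { s with real := Function.update s.real A (Function.update (s.real A) i v) }

end State

/-- Integer expressions. -/
inductive NExpr : Type
  | lit (c : ℕ)
  | get (A : ℕ) (i : NExpr)
  | add (e f : NExpr)
  | sub (e f : NExpr)
  | mul (e f : NExpr)
  | div (e f : NExpr)
  | mod (e f : NExpr)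

namespace NExpr

/-- Value of an integer expression on a machine with word bound `W`: arithmetic is reduced
modulo `W`; subtraction is truncated at `0`. -/
def eval (W : ℕ) (s : State) : NExpr → ℕ
  | lit c => c % W
  | get A i => s.nat A (i.eval W s)
  | add e f => (e.eval W s + f.eval W s) % W
  | sub e f => (e.eval W s - f.eval W s) % W
  | mul e f => (e.eval W s * f.eval W s) % W
  | div e f => (e.eval W s / f.eval W s) % W
  | mod e f => (e.eval W s % f.eval W s) % W

/-- Time needed to evaluate an integer expression: the number of its operations. -/
def cost : NExpr → ℕ
  | lit _ => 1
  | get _ i => i.cost + 1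
  | add e f => e.cost + f.cost + 1
  | sub e f => e.cost + f.cost + 1
  | mul e f => e.cost + f.cost + 1
  | div e f => e.cost + f.cost + 1
  | mod e f => e.cost + f.cost + 1

end NExpr

/-- Real expressions. -/
inductive RExpr : Type
  | lit (c : ℤ)
  | get (A : ℕ) (i : NExpr)
  | add (e f : RExpr)
  | sub (e f : RExpr)
  | mul (e f : RExpr)
  | div (e f : RExpr)

namespace RExpr

/-- Value of a real expression; arithmetic is exact (a division by zero returns `0`). -/
def eval (W : ℕ) (s : State) : RExpr → ℝ
  | lit c => (c : ℝ)
  | get A i => s.real A (i.eval W s)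
  | add e f => e.eval W s + f.eval W s
  | sub e f => e.eval W s - f.eval W s
  | mul e f => e.eval W s * f.eval W s
  | div e f => e.eval W s / f.eval W s

/-- Time needed to evaluate a real expression. -/
def cost : RExpr → ℕ
  | lit _ => 1
  | get _ i => i.cost + 1
  | add e f => e.cost + f.cost + 1
  | sub e f => e.cost + f.cost + 1
  | mul e f => e.cost + f.cost + 1
  | div e f => e.cost + f.cost + 1

end RExpr

/-- Tests. -/
inductive Test : Type
  | natLt (e f : NExpr)
  | natEq (e f : NExpr)
  | realLt (e f : RExpr)
  | realEq (e f : RExpr)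
  | neg (b : Test)
  | conj (b c : Test)
  | disj (b c : Test)

namespace Test

def holds (W : ℕ) (s : State) : Test → Prop
  | natLt e f => e.eval W s < f.eval W s
  | natEq e f => e.eval W s = f.eval W s
  | realLt e f => e.eval W s < f.eval W s
  | realEq e f => e.eval W s = f.eval W s
  | neg b => ¬ b.holds W s
  | conj b c => b.holds W s ∧ c.holds W s
  | disj b c => b.holds W s ∨ c.holds W s

/-- Time needed to evaluate a test. -/
def cost : Test → ℕ
  | natLt e f => e.cost + f.cost + 1
  | natEq e f => e.cost + f.cost + 1
  | realLt e f => e.cost + f.cost + 1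
  | realEq e f => e.cost + f.cost + 1
  | neg b => b.cost + 1
  | conj b c => b.cost + c.cost + 1
  | disj b c => b.cost + c.cost + 1

end Test

/-- Programs: assignment to cell `i` of an integer or real array `A`, sequential composition,
case distinction and `while` loops. -/
inductive Program : Type
  | skip
  | setNat (A : ℕ) (i e : NExpr)
  | setReal (A : ℕ) (i : NExpr) (e : RExpr)
  | seq (c d : Program)
  | ite (b : Test) (c d : Program)
  | loop (b : Test) (c : Program)

/-- `Exec W c s k s'`: on a machine with word bound `W`, the program `c`, started in the state `s`,
halts in the state `s'` after exactly `k` time units. -/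
inductive Exec (W : ℕ) : Program → State → ℕ → State → Prop
  | skip (s : State) : Exec W .skip s 1 s
  | setNat (A : ℕ) (i e : NExpr) (s : State) :
      Exec W (.setNat A i e) s (i.cost + e.cost + 1) (s.setNat A (i.eval W s) (e.eval W s))
  | setReal (A : ℕ) (i : NExpr) (e : RExpr) (s : State) :
      Exec W (.setReal A i e) s (i.cost + e.cost + 1) (s.setReal A (i.eval W s) (e.eval W s))
  | seq {c d : Program} {s s' s'' : State} {k l : ℕ} :
      Exec W c s k s' → Exec W d s' l s'' → Exec W (.seq c d) s (k + l) s''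
  | iteTrue {b : Test} {c d : Program} {s s' : State} {k : ℕ} :
      b.holds W s → Exec W c s k s' → Exec W (.ite b c d) s (b.cost + 1 + k) s'
  | iteFalse {b : Test} {c d : Program} {s s' : State} {k : ℕ} :
      ¬ b.holds W s → Exec W d s k s' → Exec W (.ite b c d) s (b.cost + 1 + k) s'
  | loopDone {b : Test} {c : Program} {s : State} :
      ¬ b.holds W s → Exec W (.loop b c) s (b.cost + 1) s
  | loopStep {b : Test} {c : Program} {s s' s'' : State} {k l : ℕ} :
      b.holds W s → Exec W c s k s' → Exec W (.loop b c) s' l s'' →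
        Exec W (.loop b c) s (b.cost + 1 + k + l) s''

/-- Words of `w * log₂ (n + 2)` bits, for inputs of size `n`. -/
def wordBound (w n : ℕ) : ℕ := (n + 2) ^ w

end RealRAM

/-! ## The data structure problem -/

namespace SegmentQuery

open RealRAM

abbrev Plane : Type := EuclideanSpace ℝ (Fin 2)

/-- The segment `σ = st` with `s = (0, 0)` and `t = (0, τ)`. -/
def sigma (τ : ℝ) : Set Plane := segment ℝ !₂[(0 : ℝ), 0] !₂[(0 : ℝ), τ]

/-- The two kinds of queries: segments `ab` that intersect `σ`, and segments that do not. -/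
inductive Kind : Type
  | crossing
  | avoiding

/-- The points `b ∈ B` with `|ab| ≤ 1` such that `ab` intersects (resp. does not intersect) `σ`. -/
def answerSet (τ : ℝ) (B : Set Plane) (a : Plane) : Kind → Set Plane
  | .crossing => {b | b ∈ B ∧ (segment ℝ a b ∩ sigma τ).Nonempty ∧ dist a b ≤ 1}
  | .avoiding => {b | b ∈ B ∧ ¬ (segment ℝ a b ∩ sigma τ).Nonempty ∧ dist a b ≤ 1}

/-- Initial memory: `n` is in cell `0` of integer array `0`, `τ` is in cell `0` of real array `0`,
and the coordinates of the `i`-th point are in cell `i` of the real arrays `1` and `2`.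
All other cells contain `0`. -/
def inputState (τ : ℝ) {n : ℕ} (p : Fin n → Plane) : State where
  nat := fun A i => if A = 0 ∧ i = 0 then n else 0
  real := fun A i =>
    if A = 0 ∧ i = 0 then τ
    else if h : i < n then
      if A = 1 then p ⟨i, h⟩ 0 else if A = 2 then p ⟨i, h⟩ 1 else 0
    else 0

/-- Memory when the query point `a` is presented: its coordinates are written to cells `0` and `1`
of real array `3`; everything else is as left behind by the previous computation. -/
def withQuery (s : State) (a : Plane) : State := (s.setReal 3 0 (a 0)).setReal 3 1 (a 1)

/-- The output of a query: cell `0` of integer array `1`. -/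
def output (s : State) : ℕ := s.nat 1 0

/-- From the state `s`, the query programs answer the given finite sequence of queries one after
the other, each of them correctly and within `T` time units: the output is `1` if the answer set
is empty and `0` if it is not. -/
def Serves (W T : ℕ) (query : Kind → Program) (τ : ℝ) (B : Set Plane) :
    List (Kind × Plane) → State → Prop
  | [], _ => True
  | (κ, a) :: qs, s => ∃ (k : ℕ) (s' : State),
      Exec W (query κ) (withQuery s a) k s' ∧ k ≤ T ∧
      ((answerSet τ B a κ = ∅ ∧ output s' = 1) ∨
        ((answerSet τ B a κ).Nonempty ∧ output s' = 0)) ∧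
      Serves W T query τ B qs s'

end SegmentQuery

end

/-! A segment from the left to the right half-plane meets `σ` iff two slope comparisons hold, one at
each endpoint of `σ` (`segment_inter_sigma`). So the relevant points form a suffix of the order by
slope from `s` intersected with a prefix of the order by slope from `t`, and the other points split
into two regions of the same kind. A two-level range tree writes such a region as a union of O(log²
n) canonical subsets: dyadic blocks of positions in the first order, cut into dyadic blocks of
positions in the second order. For each canonical subset it remains to decide whether the query
point lies in the union of the unit discs around its points.

All centres lie to the right of the y-axis and the query point to the left. There a disc is the
region at or beyond its `front`, a function of the height; where the horizontal line does not enter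
the disc before the axis, the front is continued by the nonnegative power of the point on the axis.
Two fronts with centres at different heights cross at most once, and the higher centre wins above
the crossing (`front_lt_front_of_lt`). The reason is that equal powers occur only on the bisector of
the centres, and along the bisector the power is strictly monotone to the left of the axis. Fronts
therefore behave like pseudolines: the lower envelope of points sorted by height is built with a
stack, as in a convex hull scan (`envInv_push`). At each height, the fronts along the envelope
strictly decrease and from some index on no longer decrease, so a binary search finds the minimum
(`envInv.exists_le_iff`).

The machine has no square roots. The difference of two powers is affine on a line, its zero is
rational, and the sign of the power at this zero tells on which side the irrational boundary point
lies (`exitTest_iff`); every comparison of fronts reduces to this.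

Every point belongs to O(log² n) subsets. It is sorted by height only once, and each pair of levels
is filled by one distribution of the sorted points to stacks in amortised linear time
(`distribute_spec`), so preprocessing takes O(n log² n). A query visits O(log n) blocks, O(log n)
subblocks in each, and does one binary search per subblock. -/

namespace RealRAM

/-! ## Programming notation -/

instance : Add NExpr := ⟨NExpr.add⟩
instance : Sub NExpr := ⟨NExpr.sub⟩
instance : Mul NExpr := ⟨NExpr.mul⟩
instance : Div NExpr := ⟨NExpr.div⟩
instance : Mod NExpr := ⟨NExpr.mod⟩
instance : OfNat NExpr 0 := ⟨NExpr.lit 0⟩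
instance : OfNat NExpr 1 := ⟨NExpr.lit 1⟩
instance : OfNat NExpr 2 := ⟨NExpr.lit 2⟩
instance : Add RExpr := ⟨RExpr.add⟩
instance : Sub RExpr := ⟨RExpr.sub⟩
instance : Mul RExpr := ⟨RExpr.mul⟩
instance : Div RExpr := ⟨RExpr.div⟩
instance : OfNat RExpr 0 := ⟨RExpr.lit 0⟩
instance : OfNat RExpr 1 := ⟨RExpr.lit 1⟩
instance : OfNat RExpr 2 := ⟨RExpr.lit 2⟩

/-- The integer variable `v`, i.e. cell `0` of the integer array `v`. -/
def var (v : ℕ) : NExpr := .get v 0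

/-- Assignment to an integer variable. -/
def assign (v : ℕ) (e : NExpr) : Program := .setNat v 0 e

infixr:35 " ;; " => Program.seq
infix:50 " ←ₙ " => assign

section eval

variable (W : ℕ) (s : State)

@[simp] theorem NExpr.eval_add (e f : NExpr) :
    (e + f).eval W s = (e.eval W s + f.eval W s) % W := rfl
@[simp] theorem NExpr.eval_sub (e f : NExpr) :
    (e - f).eval W s = (e.eval W s - f.eval W s) % W := rfl
@[simp] theorem NExpr.eval_mul (e f : NExpr) :
    (e * f).eval W s = (e.eval W s * f.eval W s) % W := rfl
@[simp] theorem NExpr.eval_div (e f : NExpr) :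
    (e / f).eval W s = (e.eval W s / f.eval W s) % W := rfl
@[simp] theorem NExpr.eval_mod (e f : NExpr) :
    (e % f).eval W s = (e.eval W s % f.eval W s) % W := rfl
@[simp] theorem NExpr.eval_zero : (0 : NExpr).eval W s = 0 := Nat.zero_mod W
@[simp] theorem NExpr.eval_one : (1 : NExpr).eval W s = 1 % W := rfl
@[simp] theorem NExpr.eval_two : (2 : NExpr).eval W s = 2 % W := rfl
@[simp] theorem NExpr.eval_get (A : ℕ) (i : NExpr) :
    (NExpr.get A i).eval W s = s.nat A (i.eval W s) := rfl
@[simp] theorem eval_var (v : ℕ) : (var v).eval W s = s.nat v 0 := by simp [var]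

@[simp] theorem RExpr.eval_add (e f : RExpr) :
    (e + f).eval W s = e.eval W s + f.eval W s := rfl
@[simp] theorem RExpr.eval_sub (e f : RExpr) :
    (e - f).eval W s = e.eval W s - f.eval W s := rfl
@[simp] theorem RExpr.eval_mul (e f : RExpr) :
    (e * f).eval W s = e.eval W s * f.eval W s := rfl
@[simp] theorem RExpr.eval_div (e f : RExpr) :
    (e / f).eval W s = e.eval W s / f.eval W s := rfl
@[simp] theorem RExpr.eval_zero : (0 : RExpr).eval W s = 0 := Int.cast_zero
@[simp] theorem RExpr.eval_one : (1 : RExpr).eval W s = 1 := Int.cast_one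
@[simp] theorem RExpr.eval_two : (2 : RExpr).eval W s = 2 := Int.cast_ofNat 2
@[simp] theorem RExpr.eval_get (A : ℕ) (i : NExpr) :
    (RExpr.get A i).eval W s = s.real A (i.eval W s) := rfl

end eval

/-! ## Memory updates -/

@[simp] theorem State.real_setNat (s : State) (A i v : ℕ) : (s.setNat A i v).real = s.real := rfl

theorem State.nat_setNat (s : State) (A i v B j : ℕ) :
    (s.setNat A i v).nat B j = if B = A ∧ j = i then v else s.nat B j := by
  unfold State.setNat
  by_cases h : B = A
  · subst h; simp [Function.update_apply]
  · simp [h]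

theorem State.nat_setNat_of_ne (s : State) {A B : ℕ} (i v : ℕ) (h : B ≠ A) :
    (s.setNat A i v).nat B = s.nat B := by
  simp [State.setNat, h]

/-! ## Loop-free programs -/

namespace Program

/-- Programs without loops. -/
def LoopFree : Program → Prop
  | skip => True
  | setNat _ _ _ => True
  | setReal _ _ _ => True
  | seq c d => c.LoopFree ∧ d.LoopFree
  | ite _ c d => c.LoopFree ∧ d.LoopFree
  | loop _ _ => False

open Classical in
/-- Case distinction on a proposition. -/
noncomputable def select {α : Type*} (p : Prop) (x y : α) : α := if p then x else y

@[simp] theorem select_true {α : Type*} (x y : α) : select True x y = x := if_pos trivial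
@[simp] theorem select_false {α : Type*} (x y : α) : select False x y = y := if_neg not_false
theorem select_pos {α : Type*} {p : Prop} (h : p) (x y : α) : select p x y = x := if_pos h
theorem select_neg {α : Type*} {p : Prop} (h : ¬ p) (x y : α) : select p x y = y := if_neg h

/-- The final state of a loop-free program. -/
noncomputable def run (W : ℕ) : Program → State → State
  | skip, s => s
  | setNat A i e, s => s.setNat A (i.eval W s) (e.eval W s)
  | setReal A i e, s => s.setReal A (i.eval W s) (e.eval W s)
  | seq c d, s => d.run W (c.run W s)
  | ite b c d, s => select (b.holds W s) (c.run W s) (d.run W s)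
  | loop _ _, s => s

/-- A bound on the running time of a loop-free program. -/
def bound : Program → ℕ
  | skip => 1
  | setNat _ i e => i.cost + e.cost + 1
  | setReal _ i e => i.cost + e.cost + 1
  | seq c d => c.bound + d.bound
  | ite b c d => b.cost + 1 + (c.bound + d.bound)
  | loop _ _ => 0

/-- The integer arrays to which a program may write. -/
def mods : Program → List ℕ
  | skip => []
  | setNat A _ _ => [A]
  | setReal _ _ _ => []
  | seq c d => c.mods ++ d.mods
  | ite _ c d => c.mods ++ d.mods
  | loop _ c => c.mods

/-- Programs that do not write to real arrays. -/
def RealFree : Program → Prop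
  | skip => True
  | setNat _ _ _ => True
  | setReal _ _ _ => False
  | seq c d => c.RealFree ∧ d.RealFree
  | ite _ c d => c.RealFree ∧ d.RealFree
  | loop _ c => c.RealFree

@[simp] theorem run_assign (W v : ℕ) (e : NExpr) (s : State) :
    (v ←ₙ e).run W s = s.setNat v 0 (e.eval W s) := by
  simp [assign, run]

@[simp] theorem mods_assign (v : ℕ) (e : NExpr) : (v ←ₙ e).mods = [v] := rfl
@[simp] theorem realFree_assign (v : ℕ) (e : NExpr) : (v ←ₙ e).RealFree := trivial
@[simp] theorem loopFree_assign (v : ℕ) (e : NExpr) : (v ←ₙ e).LoopFree := trivial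

/-- Loop-free code always halts, so its final state is a function that `simp` can compute. The time
bound adds both branches of a case distinction, which is wasteful but only by a constant. -/
theorem exists_exec_run (W : ℕ) :
    ∀ (c : Program) (s : State), c.LoopFree → ∃ k ≤ c.bound, Exec W c s k (c.run W s)
  | skip, s, _ => ⟨1, le_rfl, .skip s⟩
  | setNat A i e, s, _ => ⟨_, le_rfl, .setNat A i e s⟩
  | setReal A i e, s, _ => ⟨_, le_rfl, .setReal A i e s⟩
  | seq c d, s, h => by
    obtain ⟨k, hk, h1⟩ := exists_exec_run W c s h.1
    obtain ⟨l, hl, h2⟩ := exists_exec_run W d (c.run W s) h.2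
    exact ⟨k + l, add_le_add hk hl, .seq h1 h2⟩
  | ite b c d, s, h => by
    by_cases hb : b.holds W s
    · obtain ⟨k, hk, h1⟩ := exists_exec_run W c s h.1
      refine ⟨b.cost + 1 + k, by simp only [bound]; omega, ?_⟩
      simpa [run, hb] using Exec.iteTrue hb h1
    · obtain ⟨k, hk, h1⟩ := exists_exec_run W d s h.2
      refine ⟨b.cost + 1 + k, by simp only [bound]; omega, ?_⟩
      simpa [run, hb] using Exec.iteFalse hb h1

end Program

/-- Specifications below mention only what a program computes; everything else is carried past a
call by the syntactic list of written arrays. -/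
theorem Exec.frame {W : ℕ} {c : Program} {s s' : State} {k : ℕ} (h : Exec W c s k s') :
    ∀ A ∉ c.mods, s'.nat A = s.nat A := by
  induction h with
  | skip | loopDone => simp
  | setNat A i e s =>
    intro B hB
    exact State.nat_setNat_of_ne _ _ _ (by simpa [Program.mods] using hB)
  | setReal => intro A _; rfl
  | seq _ _ ih1 ih2 =>
    intro A hA
    simp only [Program.mods, List.mem_append, not_or] at hA
    rw [ih2 A hA.2, ih1 A hA.1]
  | iteTrue _ _ ih =>
    intro A hA
    simp only [Program.mods, List.mem_append, not_or] at hA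
    exact ih A hA.1
  | iteFalse _ _ ih =>
    intro A hA
    simp only [Program.mods, List.mem_append, not_or] at hA
    exact ih A hA.2
  | loopStep _ _ _ ih1 ih2 =>
    intro A hA
    rw [ih2 A hA, ih1 A hA]

theorem Exec.real_eq {W : ℕ} {c : Program} {s s' : State} {k : ℕ} (h : Exec W c s k s')
    (hc : c.RealFree) : s'.real = s.real := by
  induction h with
  | skip | loopDone => rfl
  | setNat => rfl
  | setReal => exact hc.elim
  | seq _ _ ih1 ih2 => rw [ih2 hc.2, ih1 hc.1]
  | iteTrue _ _ ih => exact ih hc.1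
  | iteFalse _ _ ih => exact ih hc.2
  | loopStep _ _ _ ih1 ih2 => rw [ih2 hc, ih1 hc]

theorem Program.run_frame {W : ℕ} {c : Program} (hc : c.LoopFree) (s : State) {A : ℕ}
    (hA : A ∉ c.mods) : (c.run W s).nat A = s.nat A :=
  let ⟨_, _, h⟩ := c.exists_exec_run W s hc
  h.frame A hA

theorem Program.run_real {W : ℕ} {c : Program} (hc : c.LoopFree) (hc' : c.RealFree) (s : State) :
    (c.run W s).real = s.real :=
  let ⟨_, _, h⟩ := c.exists_exec_run W s hc
  h.real_eq hc'

/-! ## Timed total correctness -/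

/-- From `s`, the program `c` halts within `T` time units in a state with property `Q`. -/
def Runs (W : ℕ) (c : Program) (s : State) (T : ℕ) (Q : State → Prop) : Prop :=
  ∃ k s', Exec W c s k s' ∧ k ≤ T ∧ Q s'

namespace Runs

variable {W : ℕ} {c d : Program} {s : State} {T T₁ T₂ : ℕ} {Q R : State → Prop}

theorem mono (h : Runs W c s T₁ R) (hT : T₁ ≤ T) (hQ : ∀ s', R s' → Q s') : Runs W c s T Q :=
  let ⟨k, s', he, hk, hR⟩ := h
  ⟨k, s', he, hk.trans hT, hQ s' hR⟩

theorem frame (h : Runs W c s T Q) (hc : c.RealFree) :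
    Runs W c s T fun s' => Q s' ∧ (∀ A ∉ c.mods, s'.nat A = s.nat A) ∧ s'.real = s.real :=
  let ⟨k, s', he, hk, hQ⟩ := h
  ⟨k, s', he, hk, hQ, he.frame, he.real_eq hc⟩

theorem straight (hc : c.LoopFree) (h : Q (c.run W s)) : Runs W c s c.bound Q :=
  let ⟨k, hk, he⟩ := c.exists_exec_run W s hc
  ⟨k, _, he, hk, h⟩

theorem seq (h : Runs W c s T₁ fun s' => Runs W d s' T₂ Q) : Runs W (c ;; d) s (T₁ + T₂) Q :=
  let ⟨k, _, he, hk, l, s'', he', hl, hQ⟩ := h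
  ⟨k + l, s'', .seq he he', add_le_add hk hl, hQ⟩

theorem seq_of (h : Runs W c s T₁ R) (h' : ∀ s', R s' → Runs W d s' T₂ Q) :
    Runs W (c ;; d) s (T₁ + T₂) Q :=
  seq (h.mono le_rfl h')

theorem straight_seq (hc : c.LoopFree) (h : Runs W d (c.run W s) T Q) :
    Runs W (c ;; d) s (c.bound + T) Q :=
  seq (straight hc h)

theorem ite {b : Test} (ht : b.holds W s → Runs W c s T Q)
    (hf : ¬ b.holds W s → Runs W d s T Q) : Runs W (.ite b c d) s (b.cost + 1 + T) Q := by
  by_cases hb : b.holds W s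
  · obtain ⟨k, s', he, hk, hQ⟩ := ht hb
    exact ⟨_, s', .iteTrue hb he, by omega, hQ⟩
  · obtain ⟨k, s', he, hk, hQ⟩ := hf hb
    exact ⟨_, s', .iteFalse hb he, by omega, hQ⟩

/-- Loops are verified with an invariant that depends on a ghost parameter `i`, and with a bound
`Φ i` on the remaining time. -/
theorem loop {ι : Type*} (Inv : ι → State → Prop) (Φ : ι → ℕ) {b : Test}
    (hstep : ∀ i s, Inv i s → b.holds W s →
      ∃ T, Runs W c s T fun s' => ∃ i', Inv i' s' ∧ b.cost + 1 + T + Φ i' ≤ Φ i)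
    (hdone : ∀ i s, Inv i s → ¬ b.holds W s → Q s) {i : ι} (hi : Inv i s) :
    Runs W (.loop b c) s (Φ i + b.cost + 1) Q := by
  -- Strong induction on the remaining time: a round costs at least one unit, so `Φ` strictly
  -- decreases, which proves termination as well.
  induction hm : Φ i using Nat.strong_induction_on generalizing i s with
  | _ m ih =>
    by_cases hb : b.holds W s
    · obtain ⟨T, k, s', he, hk, i', hi', hle⟩ := hstep i s hi hb
      obtain ⟨l, s'', he', hl, hQ⟩ := ih (Φ i') (by omega) hi' rfl
      exact ⟨_, s'', .loopStep hb he he', by omega, hQ⟩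
    · exact ⟨_, s, .loopDone hb, by omega, hdone i s hi hb⟩

end Runs

end RealRAM

namespace SegmentQuery

/-! ## Unit circles seen from the left half-plane -/

/-- The power of the point `(t, y)` with respect to the unit circle with centre `(u, v)`. -/
def power (u v t y : ℝ) : ℝ := (t - u) ^ 2 + (y - v) ^ 2 - 1

/-- The power of `(t, y)` for `t ≤ 0`, continued to positive `t` by a decreasing function. -/
def clip (u v t y : ℝ) : ℝ := power u v (min t 0) y - max t 0

/-- The abscissa at which the horizontal line at height `y`, traversed from the left, enters the
unit disc with centre `(u, v)`, if it does so to the left of the `y`-axis; otherwise the power of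
`(0, y)`, which is nonnegative. -/
noncomputable def front (u v y : ℝ) : ℝ :=
  if 1 ≤ u ^ 2 + (y - v) ^ 2 then u ^ 2 + (y - v) ^ 2 - 1 else u - √(1 - (y - v) ^ 2)

section front

variable {u v y t : ℝ}

/-- Up to abscissa `0` the point approaches the centre, since `0 < u`; afterwards the linear term
takes over. The identity `min t 0 + max t 0 = t` covers intervals that straddle `0`. -/
theorem clip_strictAnti (hu : 0 < u) : StrictAnti fun t => clip u v t y := by
  intro a b hab
  simp only [clip, power]
  have hm : min a 0 ≤ min b 0 := min_le_min_right 0 hab.le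
  have hM : max a 0 ≤ max b 0 := max_le_max_right 0 hab.le
  have hb : min b 0 ≤ 0 := min_le_right _ _
  have hsum : min a 0 + max a 0 < min b 0 + max b 0 := by simpa only [min_add_max, add_zero]
  rcases hm.eq_or_lt with h | h
  · rw [h] at hsum ⊢; linarith
  · have : 0 < (min b 0 - min a 0) * (2 * u - min a 0 - min b 0) :=
      mul_pos (by linarith) (by linarith)
    linarith

theorem clip_front : clip u v (front u v y) y = 0 := by
  unfold front
  split_ifs with h
  · rw [clip, min_eq_right (by linarith), max_eq_left (by linarith), power]; ring
  · have h1 : 0 ≤ 1 - (y - v) ^ 2 := by nlinarith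
    have h2 : u ≤ √(1 - (y - v) ^ 2) := Real.le_sqrt_of_sq_le (by linarith)
    rw [clip, min_eq_left (by linarith), max_eq_right (by linarith), power]
    have := Real.sq_sqrt h1
    nlinarith

/-- Together with `clip_front` this characterises the front as the unique zero of `clip`, so the
square root in its definition plays no further role. -/
theorem front_eq_of_clip (hu : 0 < u) (h : clip u v t y = 0) : front u v y = t :=
  (clip_strictAnti (v := v) (y := y) hu).injective (clip_front.trans h.symm)

theorem front_le_iff (hu : 0 < u) : front u v y ≤ t ↔ clip u v t y ≤ 0 := by
  rw [← (clip_strictAnti (v := v) (y := y) hu).le_iff_ge]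
  simp only [clip_front]

theorem front_le_iff_power (hu : 0 < u) (ht : t ≤ 0) : front u v y ≤ t ↔ power u v t y ≤ 0 := by
  rw [front_le_iff hu, clip, min_eq_left ht, max_eq_right ht, sub_zero]

theorem power_front : power u v (min (front u v y) 0) y = max (front u v y) 0 :=
  sub_eq_zero.mp clip_front

end front

/-! ### Two fronts and their single crossing -/

section two

variable {u₁ v₁ u₂ v₂ y y' : ℝ}

/-- Evaluate the second `clip` at the first front. By `power_front` the positive part of that front
is the first power there, so both cases of the definition reduce to a comparison of powers, whose
difference is affine. -/
theorem front_le_front_iff (h₂ : 0 < u₂) :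
    front u₁ v₁ y ≤ front u₂ v₂ y ↔
      power u₁ v₁ (min (front u₁ v₁ y) 0) y ≤ power u₂ v₂ (min (front u₁ v₁ y) 0) y := by
  rw [power_front, ← (clip_strictAnti (v := v₂) (y := y) h₂).le_iff_ge]
  simp only [clip_front]
  rw [clip, sub_nonneg]

theorem front_mono (h₁ : 0 < u₁) (h : u₁ ≤ u₂) : front u₁ v₁ y ≤ front u₂ v₁ y := by
  rw [front_le_front_iff (h₁.trans_le h), power, power]
  have := min_le_right (front u₁ v₁ y) 0
  nlinarith

/-- The hypotheses force `u₂ < u₁`, so the bisector of the centres rises to the right. Its points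
`(x, y)` and `(x', y')` satisfy `a ≤ x < x' ≤ a' ≤ 0`. Moving right towards a centre lowers its
power, so the common power is at most `0` at the lower point and at least `0` at the upper one. But
it strictly falls along the bisector to the left of both centres. -/
theorem no_double_crossing {a a' : ℝ} (h₂ : 0 < u₂) (hv : v₁ < v₂)
    (ha : a < a') (ha' : a' ≤ 0) (hy : y < y')
    (hp : power u₂ v₂ a y ≤ power u₁ v₁ a y) (hp₂ : power u₂ v₂ a y ≤ 0)
    (hp' : power u₁ v₁ a' y' ≤ power u₂ v₂ a' y') (hp₁ : 0 ≤ power u₁ v₁ a' y') : False := by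
  unfold power at *
  have hg : 0 < v₂ - v₁ := by linarith
  have he : 0 < u₁ - u₂ := by
    have : (y' - y) * (v₂ - v₁) ≤ (a' - a) * (u₁ - u₂) := by nlinarith
    have h0 : 0 < (y' - y) * (v₂ - v₁) := mul_pos (by linarith) hg
    by_contra hcon
    have : (a' - a) * (u₁ - u₂) ≤ 0 :=
      mul_nonpos_of_nonneg_of_nonpos (by linarith) (by linarith)
    linarith
  obtain ⟨x, hx⟩ : ∃ x, 2 * x * (u₁ - u₂) =
      u₁ ^ 2 + v₁ ^ 2 - u₂ ^ 2 - v₂ ^ 2 + 2 * y * (v₂ - v₁) :=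
    ⟨(u₁ ^ 2 + v₁ ^ 2 - u₂ ^ 2 - v₂ ^ 2 + 2 * y * (v₂ - v₁)) / (2 * (u₁ - u₂)), by field_simp⟩
  obtain ⟨x', hx'⟩ : ∃ x, 2 * x * (u₁ - u₂) =
      u₁ ^ 2 + v₁ ^ 2 - u₂ ^ 2 - v₂ ^ 2 + 2 * y' * (v₂ - v₁) :=
    ⟨(u₁ ^ 2 + v₁ ^ 2 - u₂ ^ 2 - v₂ ^ 2 + 2 * y' * (v₂ - v₁)) / (2 * (u₁ - u₂)), by field_simp⟩
  have hax : a ≤ x := by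
    have : 0 ≤ (x - a) * (u₁ - u₂) := by nlinarith
    linarith [nonneg_of_mul_nonneg_left this he]
  have hxa' : x' ≤ a' := by
    have : 0 ≤ (a' - x') * (u₁ - u₂) := by nlinarith
    linarith [nonneg_of_mul_nonneg_left this he]
  have hxx : x < x' := by
    have h0 : 0 < (y' - y) * (v₂ - v₁) := mul_pos (by linarith) hg
    have : 0 < (x' - x) * (u₁ - u₂) := by nlinarith
    linarith [pos_of_mul_pos_left this he.le]
  have hS : x' + x - u₁ - u₂ < 0 := by linarith
  have hT : y' + y - v₁ - v₂ < 0 := by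
    -- The sum of two points of the bisector minus the sum of the centres is orthogonal to the
    -- difference of the centres.
    have h1 : (y' + y - v₁ - v₂) * (v₂ - v₁) = (x' + x - u₁ - u₂) * (u₁ - u₂) := by nlinarith
    have h2 : (x' + x - u₁ - u₂) * (u₁ - u₂) < 0 := mul_neg_of_neg_of_pos hS he
    by_contra hcon
    have := mul_nonneg (not_lt.mp hcon) hg.le
    linarith
  have hq : (x - u₂) ^ 2 ≤ (a - u₂) ^ 2 := by nlinarith
  have hq' : (a' - u₁) ^ 2 ≤ (x' - u₁) ^ 2 := by nlinarith
  have h3 := mul_neg_of_pos_of_neg (sub_pos.mpr hxx) hS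
  have h4 := mul_neg_of_pos_of_neg (sub_pos.mpr hy) hT
  nlinarith

/-- Two fronts cross at most once. -/
theorem front_lt_front_of_lt (h₁ : 0 < u₁) (h₂ : 0 < u₂) (hv : v₁ < v₂) (hy : y < y')
    (h : front u₂ v₂ y ≤ front u₁ v₁ y) : front u₂ v₂ y' < front u₁ v₁ y' := by
  by_contra hcon
  rw [not_lt] at hcon
  have hp := (front_le_front_iff h₁).mp h
  have hp' := (front_le_front_iff h₂).mp hcon
  have e := power_front (u := u₂) (v := v₂) (y := y)
  have e' := power_front (u := u₁) (v := v₁) (y := y')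
  have ha := min_le_right (front u₂ v₂ y) 0
  have ha' := min_le_right (front u₁ v₁ y') 0
  -- At equal abscissas the difference of the powers is strictly monotone in the height. The third
  -- case is the first one reflected in the x-axis, with the discs exchanged.
  rcases lt_trichotomy (min (front u₂ v₂ y) 0) (min (front u₁ v₁ y') 0) with hlt | heq | hlt
  · have : front u₂ v₂ y < 0 := by
      by_contra h0
      rw [min_eq_right (not_lt.mp h0)] at hlt
      linarith
    refine no_double_crossing h₂ hv hlt ha' hy hp ?_ hp' (e' ▸ le_max_right _ _)
    rw [e, max_eq_right this.le]
  · rw [heq] at hp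
    unfold power at hp hp'
    nlinarith
  · have : front u₁ v₁ y' < 0 := by
      by_contra h0
      rw [min_eq_right (not_lt.mp h0)] at hlt
      linarith
    refine no_double_crossing (u₁ := u₂) (u₂ := u₁) (v₁ := -v₂) (v₂ := -v₁) (y := -y')
      (y' := -y) h₁ (neg_lt_neg hv) hlt ha (neg_lt_neg hy) ?_ ?_ ?_ ?_
    · unfold power at hp' ⊢; linarith
    · have : power u₁ v₁ (min (front u₁ v₁ y') 0) y' ≤ 0 := by rw [e', max_eq_right this.le]
      unfold power at this ⊢; linarith
    · unfold power at hp ⊢; linarith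
    · have : 0 ≤ power u₂ v₂ (min (front u₂ v₂ y) 0) y := e ▸ le_max_right _ _
      unfold power at this ⊢; linarith

end two

/-! ## Rational tests -/

/-- Decides the sign of `e₀ + e₁ * t` at the point `t ≤ 0` where a decreasing function changes
sign, given its value `q` at the zero of `e₀ + e₁ * t`. -/
def exitTest (e₀ e₁ q : ℝ) : Prop :=
  ((e₁ = 0 ∨ 0 < 0 - e₀ / e₁ ∨ 0 < q) ∧ ¬ e₀ < 0) ∨
    (¬ (e₁ = 0 ∨ 0 < 0 - e₀ / e₁ ∨ 0 < q) ∧ (q = 0 ∨ ¬ 0 < e₁))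

/-- The zero `t` of the affine function is rational, unlike `r`. If `q t > 0`, then `r` is not left
of `t` and the value at `r` has the sign of the value `e₀` at `0`; the same holds if there is no
zero to the left of `0`. If `q t = 0`, then `r = t`. If `q t < 0`, then `r < t` and the sign is
opposite to that of `e₁`. -/
theorem exitTest_iff {q : ℝ → ℝ} (hq : ∀ t t', t < t' → t' ≤ 0 → q t' < q t) {r : ℝ}
    (hr : r ≤ 0) (hqr : q r = 0 ∨ r = 0 ∧ 0 ≤ q 0) (e₀ e₁ : ℝ) :
    exitTest e₀ e₁ (q (0 - e₀ / e₁)) ↔ 0 ≤ e₀ + e₁ * r := by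
  unfold exitTest
  set t := 0 - e₀ / e₁ with ht
  by_cases h1 : e₁ = 0
  · simp [h1]
  have he : e₀ = - e₁ * t := by rw [ht]; field_simp; ring
  have hqr0 : 0 ≤ q r := by rcases hqr with h | ⟨rfl, h⟩ <;> linarith
  by_cases h2 : 0 < t
  · have : e₀ + e₁ * r = e₁ * (r - t) := by rw [he]; ring
    rw [this]
    simp only [h1, h2, true_or, or_true, true_and, not_true, false_and, or_false, not_lt]
    rw [he]
    have hrt : r - t < 0 := by linarith
    constructor
    · intro h
      have : e₁ ≤ 0 := by nlinarith
      exact mul_nonneg_of_nonpos_of_nonpos this hrt.le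
    · intro h
      have : e₁ ≤ 0 := by
        by_contra h0
        nlinarith [mul_neg_of_pos_of_neg (not_le.mp h0) hrt]
      nlinarith
  have h2' := not_lt.mp h2
  have hlin : e₀ + e₁ * r = e₁ * (r - t) := by rw [he]; ring
  rw [hlin]
  by_cases h3 : 0 < q t
  · simp only [h1, h2, h3, or_true, true_and, not_true, false_and, or_false, not_lt]
    rcases lt_trichotomy t r with h | h | h
    · have h0 : 0 < r - t := by linarith
      have h00 : t < 0 := by linarith
      rw [he]
      constructor
      · intro h'
        have : 0 ≤ e₁ := by
          by_contra hneg
          nlinarith [mul_pos_of_neg_of_neg (not_le.mp hneg) h00]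
        positivity
      · intro h'
        have : 0 ≤ e₁ := nonneg_of_mul_nonneg_left h' h0
        nlinarith
    · rcases hqr with h' | ⟨h', -⟩
      · rw [h] at h3; linarith
      · rw [he, h, h']; simp
    · have := hq r t h h2'
      rcases hqr with h' | ⟨h', -⟩ <;> linarith
  by_cases h4 : q t = 0
  · simp only [h1, h2, h4, or_self, lt_irrefl, false_and, not_false_iff, true_or, and_self,
      or_true, true_iff]
    rcases lt_trichotomy t r with h | h | h
    · have := hq t r h hr; linarith
    · simp [h]
    · have := hq r t h h2'
      rcases hqr with h' | ⟨h', -⟩ <;> linarith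
  · simp only [h1, h2, h3, h4, false_or, false_and, not_false_iff, true_and, not_lt]
    have hneg : q t < 0 := lt_of_le_of_ne (not_lt.mp h3) h4
    have hrt : r - t < 0 := by
      rcases lt_trichotomy t r with h | h | h
      · have := hq t r h hr; linarith
      · rw [h] at hneg; linarith
      · linarith
    constructor
    · intro h; exact mul_nonneg_of_nonpos_of_nonpos h hrt.le
    · intro h
      by_contra h0
      nlinarith [mul_neg_of_pos_of_neg (not_le.mp h0) hrt]

/-- Decides which of two unit discs is left first by a point moving to the left along the ray
`y = z + c * t`, `t ≤ 0`. -/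
def rayTest (u₁ v₁ u₂ v₂ c z : ℝ) : Prop :=
  let e₀ := u₂ * u₂ + v₂ * v₂ - (u₁ * u₁ + v₁ * v₁) - 2 * z * (v₂ - v₁)
  let e₁ := 2 * (u₁ - u₂) + 2 * c * (v₁ - v₂)
  let t := 0 - e₀ / e₁
  exitTest e₀ e₁ ((t - u₁) * (t - u₁) + (z + c * t - v₁) * (z + c * t - v₁) - 1)

/-- On a line the quadratic terms of the two powers cancel, and `e₀ + e₁ * t` is the second power
minus the first. The decreasing function of `exitTest_iff` is the first power. -/
theorem rayTest_iff {u₁ v₁ u₂ v₂ c z : ℝ}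
    (hq : ∀ t t', t < t' → t' ≤ 0 → power u₁ v₁ t' (z + c * t') < power u₁ v₁ t (z + c * t))
    {r : ℝ} (hr : r ≤ 0)
    (hqr : power u₁ v₁ r (z + c * r) = 0 ∨ r = 0 ∧ 0 ≤ power u₁ v₁ 0 z) :
    rayTest u₁ v₁ u₂ v₂ c z ↔ power u₁ v₁ r (z + c * r) ≤ power u₂ v₂ r (z + c * r) := by
  have := exitTest_iff hq hr (by simpa using hqr)
    (u₂ * u₂ + v₂ * v₂ - (u₁ * u₁ + v₁ * v₁) - 2 * z * (v₂ - v₁))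
    (2 * (u₁ - u₂) + 2 * c * (v₁ - v₂))
  rw [← sub_nonneg (b := power u₁ v₁ r (z + c * r))]
  convert this using 2
  · unfold rayTest power
    ring_nf
  · unfold power
    ring

/-- The comparison of two fronts at height `y`. -/
theorem rayTest_horizontal {u₁ v₁ u₂ v₂ y : ℝ} (h₁ : 0 < u₁) (h₂ : 0 < u₂) :
    rayTest u₁ v₁ u₂ v₂ 0 y ↔ front u₁ v₁ y ≤ front u₂ v₂ y := by
  rw [front_le_front_iff h₂, rayTest_iff (r := min (front u₁ v₁ y) 0)]
  · simp
  · intro t t' ht ht'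
    unfold power
    nlinarith
  · exact min_le_right _ _
  · rw [zero_mul, add_zero, power_front]
    rcases le_total (front u₁ v₁ y) 0 with h | h
    · left; exact max_eq_right h
    · right
      refine ⟨min_eq_right h, ?_⟩
      have := power_front (u := u₁) (v := v₁) (y := y)
      rw [min_eq_right h] at this
      rw [this]; exact le_max_right _ _

/-- Slope of the bisector of two points. -/
noncomputable def bisSlope (u₁ v₁ u₂ v₂ : ℝ) : ℝ := (u₁ - u₂) / (v₂ - v₁)

/-- Ordinate at which the bisector of two points meets the `y`-axis. -/
noncomputable def bisOrd (u₁ v₁ u₂ v₂ : ℝ) : ℝ :=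
  (u₂ * u₂ + v₂ * v₂ - (u₁ * u₁ + v₁ * v₁)) / (2 * (v₂ - v₁))

theorem power_bisector {u₁ v₁ u₂ v₂ : ℝ} (hv : v₁ < v₂) (t : ℝ) :
    power u₁ v₁ t (bisOrd u₁ v₁ u₂ v₂ + bisSlope u₁ v₁ u₂ v₂ * t) =
      power u₂ v₂ t (bisOrd u₁ v₁ u₂ v₂ + bisSlope u₁ v₁ u₂ v₂ * t) := by
  have : v₂ - v₁ ≠ 0 := by linarith [sub_pos.mpr hv]
  unfold power bisOrd bisSlope
  field_simp
  ring

/-- The bisector passes through the midpoint of the centres, and the power on it is a constant plus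
the squared distance to that midpoint, which lies to the right of the axis. -/
theorem power_bisector_anti {u₁ v₁ u₂ v₂ : ℝ} (h₁ : 0 < u₁) (h₂ : 0 < u₂) (hv : v₁ < v₂)
    (t t' : ℝ) (ht : t < t') (ht' : t' ≤ 0) :
    power u₁ v₁ t' (bisOrd u₁ v₁ u₂ v₂ + bisSlope u₁ v₁ u₂ v₂ * t') <
      power u₁ v₁ t (bisOrd u₁ v₁ u₂ v₂ + bisSlope u₁ v₁ u₂ v₂ * t) := by
  set c := bisSlope u₁ v₁ u₂ v₂ with hc
  have hne : v₂ - v₁ ≠ 0 := by linarith [sub_pos.mpr hv]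
  have hz : bisOrd u₁ v₁ u₂ v₂ = (v₁ + v₂) / 2 - c * (u₁ + u₂) / 2 := by
    rw [hc]; unfold bisOrd bisSlope; field_simp; ring
  have hcv : c * (v₂ - v₁) = u₁ - u₂ := by rw [hc, bisSlope]; field_simp
  have key : power u₁ v₁ t (bisOrd u₁ v₁ u₂ v₂ + c * t) -
      power u₁ v₁ t' (bisOrd u₁ v₁ u₂ v₂ + c * t') =
      (1 + c ^ 2) * ((t' - t) * (u₁ + u₂ - t - t')) := by
    rw [hz]; unfold power
    linear_combination (t - t') * hcv
  have : 0 < (1 + c ^ 2) * ((t' - t) * (u₁ + u₂ - t - t')) :=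
    mul_pos (by positivity) (mul_pos (by linarith) (by linarith))
  linarith

/-- Two fronts meet on the bisector of the centres. -/
theorem exists_front_eq {u₁ v₁ u₂ v₂ : ℝ} (h₁ : 0 < u₁) (h₂ : 0 < u₂) (hv : v₁ < v₂) :
    ∃ r ≤ 0, (power u₁ v₁ r (bisOrd u₁ v₁ u₂ v₂ + bisSlope u₁ v₁ u₂ v₂ * r) = 0 ∨
        r = 0 ∧ 0 ≤ power u₁ v₁ 0 (bisOrd u₁ v₁ u₂ v₂)) ∧
      front u₁ v₁ (bisOrd u₁ v₁ u₂ v₂ + bisSlope u₁ v₁ u₂ v₂ * r) =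
        front u₂ v₂ (bisOrd u₁ v₁ u₂ v₂ + bisSlope u₁ v₁ u₂ v₂ * r) ∧
      r = min (front u₁ v₁ (bisOrd u₁ v₁ u₂ v₂ + bisSlope u₁ v₁ u₂ v₂ * r)) 0 := by
  have hb := power_bisector (u₁ := u₁) (u₂ := u₂) hv
  set c := bisSlope u₁ v₁ u₂ v₂
  set z := bisOrd u₁ v₁ u₂ v₂
  -- If the bisector hits the axis outside the open discs, both fronts at that height are the common
  -- power. Otherwise they meet where the bisector leaves the discs, found by the intermediate value
  -- theorem.
  by_cases h0 : 0 ≤ power u₁ v₁ 0 z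
  · have hf : ∀ {u v : ℝ}, 0 < u → 0 ≤ power u v 0 z → front u v z = power u v 0 z := by
      intro u v hu h
      refine front_eq_of_clip hu ?_
      rw [clip, min_eq_right h, max_eq_left h, sub_self]
    have hb0 := hb 0
    simp only [mul_zero, add_zero] at hb0
    refine ⟨0, le_rfl, .inr ⟨rfl, h0⟩, ?_, ?_⟩
    · rw [mul_zero, add_zero, hf h₁ h0, hf h₂ (hb0 ▸ h0), hb0]
    · rw [mul_zero, add_zero, hf h₁ h0, min_eq_right h0]
  · have hcont : ContinuousOn (fun t => power u₁ v₁ t (z + c * t)) (Set.Icc (-1) 0) := by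
      unfold power; fun_prop
    -- At abscissa `-1` the horizontal distance to the centre already exceeds `1`.
    have hm1 : 0 ≤ power u₁ v₁ (-1) (z + c * (-1)) := by
      unfold power; nlinarith [sq_nonneg (z + c * (-1) - v₁)]
    obtain ⟨r, hr, hr0⟩ := intermediate_value_Icc' (by norm_num) hcont
      (show (0 : ℝ) ∈ Set.Icc _ _ from ⟨by simpa using (not_le.mp h0).le, hm1⟩)
    simp only at hr0
    have hf : ∀ {u v : ℝ}, 0 < u → power u v r (z + c * r) = 0 → front u v (z + c * r) = r := by
      intro u v hu h
      refine front_eq_of_clip hu ?_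
      rw [clip, min_eq_left hr.2, max_eq_right hr.2, h, sub_zero]
    refine ⟨r, hr.2, .inl hr0, ?_, ?_⟩
    · rw [hf h₁ hr0, hf h₂ (hb r ▸ hr0)]
    · rw [hf h₁ hr0, min_eq_left hr.2]

/-- For `v₁ < v₂ < v₃`: the second front is nowhere below both other ones. -/
def redundant (u₁ v₁ u₂ v₂ u₃ v₃ : ℝ) : Prop :=
  rayTest u₁ v₁ u₂ v₂ ((u₁ - u₃) / (v₃ - v₁))
    ((u₃ * u₃ + v₃ * v₃ - (u₁ * u₁ + v₁ * v₁)) / (2 * (v₃ - v₁)))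

/-! ### Three fronts: redundancy of the middle one -/

section three

variable {u₁ v₁ u₂ v₂ u₃ v₃ : ℝ}

/-- The outer fronts meet on the bisector of their centres, and `redundant` runs the ray test along
it. This compares the middle front with them at the meeting height, which is never computed. -/
theorem redundant_iff (h₁ : 0 < u₁) (h₂ : 0 < u₂) (h₃ : 0 < u₃) (h : v₁ < v₃) :
    ∃ y, front u₁ v₁ y = front u₃ v₃ y ∧
      (redundant u₁ v₁ u₂ v₂ u₃ v₃ ↔ front u₁ v₁ y ≤ front u₂ v₂ y) := by
  obtain ⟨r, hr, hqr, hf, hre⟩ := exists_front_eq h₁ h₃ h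
  refine ⟨_, hf, ?_⟩
  rw [front_le_front_iff h₂, ← hre]
  exact rayTest_iff (power_bisector_anti h₁ h₃ h) hr hqr

/-- Below the meeting height of the outer fronts the first one stays in front of the second, above
it the third one does, because fronts cross only once. -/
theorem front_le_of_redundant (h₁ : 0 < u₁) (h₂ : 0 < u₂) (h₃ : 0 < u₃) (h₁₂ : v₁ < v₂)
    (h₂₃ : v₂ < v₃) (h : redundant u₁ v₁ u₂ v₂ u₃ v₃) (y : ℝ) :
    front u₁ v₁ y ≤ front u₂ v₂ y ∨ front u₃ v₃ y ≤ front u₂ v₂ y := by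
  obtain ⟨y₀, he, hiff⟩ := redundant_iff (u₂ := u₂) (v₂ := v₂) h₁ h₂ h₃ (h₁₂.trans h₂₃)
  have h12 := hiff.mp h
  rcases lt_trichotomy y y₀ with hy | rfl | hy
  · left
    by_contra hcon
    exact absurd h12 (not_le.mpr (front_lt_front_of_lt h₁ h₂ h₁₂ hy (not_le.mp hcon).le))
  · exact .inl h12
  · exact .inr (front_lt_front_of_lt h₂ h₃ h₂₃ hy (he ▸ h12)).le

/-- At the meeting height `y₀` of the outer fronts the second is strictly ahead. So the second
overtakes the first before `y₀` and the third overtakes the second only after it. This is what makes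
the fronts along an envelope unimodal at every height. -/
theorem front_le_of_not_redundant (h₁ : 0 < u₁) (h₂ : 0 < u₂) (h₃ : 0 < u₃) (h₁₂ : v₁ < v₂)
    (h₂₃ : v₂ < v₃) (h : ¬ redundant u₁ v₁ u₂ v₂ u₃ v₃) {y : ℝ}
    (hy : front u₁ v₁ y ≤ front u₂ v₂ y) : front u₂ v₂ y ≤ front u₃ v₃ y := by
  obtain ⟨y₀, he, hiff⟩ := redundant_iff (u₂ := u₂) (v₂ := v₂) h₁ h₂ h₃ (h₁₂.trans h₂₃)
  have h21 := (not_le.mp fun h' => h (hiff.mpr h')).le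
  have hlt : y < y₀ := by
    by_contra hcon
    rcases (not_lt.mp hcon).eq_or_lt with rfl | hlt
    · exact h (hiff.mpr hy)
    · exact absurd hy (not_le.mpr (front_lt_front_of_lt h₁ h₂ h₁₂ hlt h21))
  by_contra hcon
  have := front_lt_front_of_lt h₂ h₃ h₂₃ hlt (not_le.mp hcon).le
  linarith [not_le.mp fun h' => h (hiff.mpr h')]

end three

/-! ## Segments that meet `σ` -/

/-- The segment meets the y-axis at the height `(a 1 * b 0 - a 0 * b 1) / (b 0 - a 0)`; that it is
at least `0` and at most `τ` becomes, after clearing denominators, the two slope comparisons. -/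
theorem segment_inter_sigma {τ : ℝ} (hτ : 0 ≤ τ) {a b : Plane} (ha : a 0 < 0) (hb : 0 < b 0) :
    (segment ℝ a b ∩ sigma τ).Nonempty ↔
      a 1 / a 0 ≤ b 1 / b 0 ∧ (b 1 - τ) / b 0 ≤ (a 1 - τ) / a 0 := by
  have hd : 0 < b 0 - a 0 := by linarith
  have e1 : a 1 / a 0 ≤ b 1 / b 0 ↔ 0 ≤ a 1 * b 0 - a 0 * b 1 := by
    rw [div_le_iff_of_neg ha, div_mul_eq_mul_div, div_le_iff₀ hb]
    constructor <;> intro h <;> linarith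
  have e2 : (b 1 - τ) / b 0 ≤ (a 1 - τ) / a 0 ↔ a 1 * b 0 - a 0 * b 1 ≤ τ * (b 0 - a 0) := by
    rw [div_le_iff₀ hb, div_mul_eq_mul_div, le_div_iff_of_neg ha]
    constructor <;> intro h <;> linarith
  rw [e1, e2]
  constructor
  · rintro ⟨p, ⟨s, t, hs, ht, hst, rfl⟩, ⟨s', t', hs', ht', hst', hp⟩⟩
    have h0 := congrArg (fun q : Plane => q 0) hp
    have h1 := congrArg (fun q : Plane => q 1) hp
    simp at h0 h1
    have hss : s = 1 - t := by linarith
    subst hss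
    have ht0 : t * (b 0 - a 0) = - a 0 := by linarith
    have hk : a 1 * b 0 - a 0 * b 1 = t' * τ * (b 0 - a 0) := by
      rw [h1]; linear_combination (a 1 - b 1) * ht0
    have htτ : t' * τ ≤ τ := mul_le_of_le_one_left hτ (by linarith)
    rw [hk]
    exact ⟨by positivity, mul_le_mul_of_nonneg_right htτ hd.le⟩
  · rintro ⟨h1, h2⟩
    set k := (a 1 * b 0 - a 0 * b 1) / (b 0 - a 0) with hk
    have hk0 : 0 ≤ k := by positivity
    have hkτ : k ≤ τ := (div_le_iff₀ hd).mpr h2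
    refine ⟨!₂[0, k], ⟨b 0 / (b 0 - a 0), - a 0 / (b 0 - a 0), by positivity,
      div_nonneg (by linarith) hd.le, by field_simp; ring, ?_⟩, ?_⟩
    · ext i
      fin_cases i
      · simp; field_simp; ring
      · simp [hk]; field_simp; ring
    -- For `τ = 0` the segment is a point and `k / τ` is useless as a parameter.
    · rcases hτ.eq_or_lt with rfl | hτ
      · have : k = 0 := le_antisymm hkτ hk0
        rw [this, sigma]
        exact left_mem_segment _ _ _
      · refine ⟨1 - k / τ, k / τ, ?_, by positivity, by ring, ?_⟩
        · rw [sub_nonneg, div_le_one hτ]; exact hkτ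
        · ext i
          fin_cases i
          · simp
          · simp; field_simp

theorem dist_le_one_iff (a b : Plane) : dist a b ≤ 1 ↔ power (b 0) (b 1) (a 0) (a 1) ≤ 0 := by
  rw [EuclideanSpace.dist_eq, Real.sqrt_le_one]
  simp only [Fin.sum_univ_two, Real.dist_eq, sq_abs, power]
  constructor <;> intro h <;> linarith

end SegmentQuery

namespace RealRAM

/-! ## Merge sort -/

namespace Reg

@[simp] def i : ℕ := 10
@[simp] def j : ℕ := 11
@[simp] def d : ℕ := 12
@[simp] def lo : ℕ := 13
@[simp] def mid : ℕ := 14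
@[simp] def hi : ℕ := 15
@[simp] def h : ℕ := 16

end Reg

/-- The number `n` of input points. -/
def size : NExpr := var 0

@[simp] theorem eval_size (W : ℕ) (s : State) : size.eval W s = s.nat 0 0 := eval_var W s 0

/-- `lt` decides the relation `r` on machines whose real memory is `ρ`. -/
def Decides (W : ℕ) (ρ : ℕ → ℕ → ℝ) (lt : NExpr → NExpr → Test) (r : ℕ → ℕ → Prop) : Prop :=
  ∀ s : State, s.real = ρ → ∀ e f, (lt e f).holds W s ↔ r (e.eval W s) (f.eval W s)

/-- Strict weak orders. -/
structure WeakOrder (r : ℕ → ℕ → Prop) : Prop where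
  asymm : ∀ a b, r a b → ¬ r b a
  trans : ∀ a b c, ¬ r b a → ¬ r c b → ¬ r c a

/-- `g` holds on `[lo, d)` the merged segments `[lo, i)` and `[mid, j)` of `f`. -/
structure Merging (r : ℕ → ℕ → Prop) (f g : ℕ → ℕ) (lo mid hi i j d : ℕ) : Prop where
  lo_le : lo ≤ i
  i_le : i ≤ mid
  mid_le : mid ≤ j
  j_le : j ≤ hi
  sum : d + mid = i + j
  sorted : ∀ x y, lo ≤ x → x < y → y < d → ¬ r (g y) (g x)
  left : ∀ x y, lo ≤ x → x < d → i ≤ y → y < mid → ¬ r (f y) (g x)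
  right : ∀ x y, lo ≤ x → x < d → j ≤ y → y < hi → ¬ r (f y) (g x)
  image : ∀ b, (∃ x, lo ≤ x ∧ x < d ∧ g x = b) ↔
    (∃ x, lo ≤ x ∧ x < i ∧ f x = b) ∨ (∃ x, mid ≤ x ∧ x < j ∧ f x = b)

theorem exists_lt_succ_iff {f : ℕ → ℕ} {lo d b : ℕ} (h : lo ≤ d) :
    (∃ x, lo ≤ x ∧ x < d + 1 ∧ f x = b) ↔ (∃ x, lo ≤ x ∧ x < d ∧ f x = b) ∨ f d = b := by
  constructor
  · rintro ⟨x, h1, h2, rfl⟩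
    rcases Nat.lt_succ_iff_lt_or_eq.mp h2 with h2 | rfl
    · exact .inl ⟨x, h1, h2, rfl⟩
    · exact .inr rfl
  · rintro (⟨x, h1, h2, rfl⟩ | rfl)
    · exact ⟨x, h1, by omega, rfl⟩
    · exact ⟨d, h, by omega, rfl⟩

section merging

variable {r : ℕ → ℕ → Prop} {f g g' : ℕ → ℕ} {lo mid hi i j d : ℕ}

/-- The head of the right run is written. The head of the left run does not precede it, and negative
transitivity extends this to the rest of the left run. `Merging.step` is the mirror image. -/
theorem Merging.swap_step (hr : WeakOrder r) (hm : Merging r f g lo mid hi i j d)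
    (hfr : ∀ x y, mid ≤ x → x < y → y < hi → ¬ r (f y) (f x))
    (hj : j < hi) (hle : i < mid → ¬ r (f i) (f j))
    (hfl : ∀ x y, lo ≤ x → x < y → y < mid → ¬ r (f y) (f x))
    (hd : g' d = f j) (hg : ∀ x, lo ≤ x → x < d → g' x = g x) :
    Merging r f g' lo mid hi i (j + 1) (d + 1) := by
  obtain ⟨h1, h2, h3, h4, h5, h6, h7, h8, h9⟩ := hm
  refine ⟨h1, h2, by omega, hj, by omega, ?_, ?_, ?_, ?_⟩
  · intro x y hx hxy hy
    rcases Nat.lt_succ_iff_lt_or_eq.mp hy with hy | rfl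
    · rw [hg x hx (by omega), hg y (by omega) hy]; exact h6 x y hx hxy hy
    · rw [hg x hx hxy, hd]; exact h8 x j hx hxy le_rfl hj
  · intro x y hx hxd hy hym
    rcases Nat.lt_succ_iff_lt_or_eq.mp hxd with hxd | rfl
    · rw [hg x hx hxd]; exact h7 x y hx hxd hy hym
    · rw [hd]
      have := hle (by omega)
      rcases hy.eq_or_lt with rfl | hy
      · exact this
      · exact hr.trans _ _ _ this (hfl i y h1 hy hym)
  · intro x y hx hxd hy hym
    rcases Nat.lt_succ_iff_lt_or_eq.mp hxd with hxd | rfl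
    · rw [hg x hx hxd]; exact h8 x y hx hxd (by omega) hym
    · rw [hd]; exact hfr j y h3 (by omega) hym
  · intro b
    rw [exists_lt_succ_iff (by omega), exists_lt_succ_iff h3, hd, ← or_assoc, ← h9]
    refine or_congr_left (exists_congr fun x => ?_)
    constructor <;> rintro ⟨a1, a2, a3⟩ <;> refine ⟨a1, a2, ?_⟩ <;> rw [← a3, hg x a1 a2]

theorem Merging.step (hr : WeakOrder r) (hm : Merging r f g lo mid hi i j d)
    (hfl : ∀ x y, lo ≤ x → x < y → y < mid → ¬ r (f y) (f x))
    (hi' : i < mid) (hle : j < hi → ¬ r (f j) (f i))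
    (hfr : ∀ x y, mid ≤ x → x < y → y < hi → ¬ r (f y) (f x))
    (hd : g' d = f i) (hg : ∀ x, lo ≤ x → x < d → g' x = g x) :
    Merging r f g' lo mid hi (i + 1) j (d + 1) := by
  obtain ⟨h1, h2, h3, h4, h5, h6, h7, h8, h9⟩ := hm
  refine ⟨by omega, hi', h3, h4, by omega, ?_, ?_, ?_, ?_⟩
  · intro x y hx hxy hy
    rcases Nat.lt_succ_iff_lt_or_eq.mp hy with hy | rfl
    · rw [hg x hx (by omega), hg y (by omega) hy]; exact h6 x y hx hxy hy
    · rw [hg x hx hxy, hd]; exact h7 x i hx hxy le_rfl hi'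
  · intro x y hx hxd hy hym
    rcases Nat.lt_succ_iff_lt_or_eq.mp hxd with hxd | rfl
    · rw [hg x hx hxd]; exact h7 x y hx hxd (by omega) hym
    · rw [hd]; exact hfl i y h1 (by omega) hym
  · intro x y hx hxd hy hym
    rcases Nat.lt_succ_iff_lt_or_eq.mp hxd with hxd | rfl
    · rw [hg x hx hxd]; exact h8 x y hx hxd hy hym
    · rw [hd]
      have := hle (by omega)
      rcases hy.eq_or_lt with rfl | hy
      · exact this
      · exact hr.trans _ _ _ this (hfr j y h3 hy hym)
  · intro b
    rw [exists_lt_succ_iff (by omega), exists_lt_succ_iff h1, hd, or_right_comm, ← h9]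
    refine or_congr_left (exists_congr fun x => ?_)
    constructor <;> rintro ⟨a1, a2, a3⟩ <;> refine ⟨a1, a2, ?_⟩ <;> rw [← a3, hg x a1 a2]

end merging

open Reg

/-- Advances the merging of two runs by one element. The runs are in the array `o + 100` behind
the address in the variable `o + 101`, the result is written `n` cells further. -/
def mergeStep (lt : NExpr → NExpr → Test) (o : ℕ) : Program :=
  .ite (.conj (.natLt (var i) (var mid)) (.disj (.neg (.natLt (var j) (var hi)))
      (.neg (lt (.get (o + 100) (var (o + 101) + var j)) (.get (o + 100) (var (o + 101) + var i))))))
    (.setNat (o + 100) (var (o + 101) + size + var d) (.get (o + 100) (var (o + 101) + var i)) ;;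
      i ←ₙ var i + 1)
    (.setNat (o + 100) (var (o + 101) + size + var d) (.get (o + 100) (var (o + 101) + var j)) ;;
      j ←ₙ var j + 1) ;;
  d ←ₙ var d + 1

def mergeLoop (lt : NExpr → NExpr → Test) (o : ℕ) : Program :=
  .loop (.natLt (var d) (var hi)) (mergeStep lt o)

def mergeStepTime (lt : NExpr → NExpr → Test) (o : ℕ) : ℕ :=
  (mergeStep lt o).bound + (Test.natLt (var d) (var hi)).cost + 1

/-- Source and target windows are disjoint, because the target starts `n` cells further; hence the
runs are never overwritten. The frame clause lets a pass keep the blocks merged before. -/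
theorem mergeLoop_spec {W : ℕ} {lt : NExpr → NExpr → Test} {r : ℕ → ℕ → Prop} {o : ℕ} {s : State}
    (hlt : Decides W s.real lt r) (hr : WeakOrder r) {n src l m e : ℕ}
    (hn : s.nat 0 0 = n) (hsrc : s.nat (o + 101) 0 = src) (hW : src + n + n + 2 < W)
    (hl : s.nat i 0 = l) (hm : s.nat mid 0 = m) (he : s.nat hi 0 = e) (hj : s.nat j 0 = m)
    (hd : s.nat d 0 = l) (hlm : l ≤ m) (hme : m ≤ e) (hen : e ≤ n)
    (hfl : ∀ x y, l ≤ x → x < y → y < m →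
      ¬ r (s.nat (o + 100) (src + y)) (s.nat (o + 100) (src + x)))
    (hfr : ∀ x y, m ≤ x → x < y → y < e →
      ¬ r (s.nat (o + 100) (src + y)) (s.nat (o + 100) (src + x))) :
    Runs W (mergeLoop lt o) s (mergeStepTime lt o * (e - l) + mergeStepTime lt o) fun s' =>
      Merging r (fun x => s.nat (o + 100) (src + x)) (fun x => s'.nat (o + 100) (src + n + x))
        l m e m e e ∧
      ∀ x, (x < src + n + l ∨ src + n + e ≤ x) → s'.nat (o + 100) x = s.nat (o + 100) x := by
  have key := Runs.loop (W := W) (b := .natLt (var d) (var hi)) (c := mergeStep lt o)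
    (ι := ℕ × ℕ × ℕ) (s := s) (i := (l, m, l))
    (Q := fun s' => Merging r (fun x => s.nat (o + 100) (src + x))
        (fun x => s'.nat (o + 100) (src + n + x)) l m e m e e ∧
      ∀ x, (x < src + n + l ∨ src + n + e ≤ x) → s'.nat (o + 100) x = s.nat (o + 100) x)
    (fun p s' => (s'.nat i 0 = p.1 ∧ s'.nat j 0 = p.2.1 ∧ s'.nat d 0 = p.2.2) ∧
      s'.nat 0 0 = n ∧ s'.nat (o + 101) 0 = src ∧ s'.nat mid 0 = m ∧ s'.nat hi 0 = e ∧
      s'.real = s.real ∧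
      Merging r (fun x => s.nat (o + 100) (src + x)) (fun x => s'.nat (o + 100) (src + n + x))
        l m e p.1 p.2.1 p.2.2 ∧
      ∀ x, (x < src + n + l ∨ src + n + p.2.2 ≤ x) → s'.nat (o + 100) x = s.nat (o + 100) x)
    (fun p => mergeStepTime lt o * (e - p.2.2)) ?_ ?_ ?_
  · refine key.mono ?_ fun _ h => h
    simp only [mergeStepTime]; omega
  · rintro ⟨pi, pj, pd⟩ s' ⟨⟨h1, h2, h3⟩, h4, h5, h6, h7, h8, hM, hF⟩ hb
    simp only at h1 h2 h3 hM hF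
    have hde : pd < e := by simpa [Test.holds, -Reg.d, -Reg.hi, h3, h7] using hb
    obtain ⟨a1, a2, a3, a4, a5, -⟩ := id hM
    have hfi : s'.nat (o + 100) (src + pi) = s.nat (o + 100) (src + pi) := hF _ (by omega)
    have hfj : pj < e → s'.nat (o + 100) (src + pj) = s.nat (o + 100) (src + pj) :=
      fun h => hF _ (by omega)
    refine ⟨_, Runs.straight (by simp [mergeStep, Program.LoopFree]) ?_⟩
    have htime : ∀ T, T = (mergeStep lt o).bound →
        (Test.natLt (var d) (var hi)).cost + 1 + T + mergeStepTime lt o * (e - (pd + 1)) ≤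
          mergeStepTime lt o * (e - pd) := by
      rintro T rfl
      have : e - pd = (e - (pd + 1)) + 1 := by omega
      rw [this, mul_add, mergeStepTime]
      omega
    simp only [i, j, mid, hi, d] at h1 h2 h3 h6 h7
    by_cases hc : pi < m ∧ (e ≤ pj ∨ ¬ r (s'.nat (o + 100) (src + pj)) (s'.nat (o + 100) (src + pi)))
    · have hrun : (mergeStep lt o).run W s' = ((s'.setNat (o + 100) (src + n + pd)
          (s.nat (o + 100) (src + pi))).setNat i 0 (pi + 1)).setNat d 0 (pd + 1) := by
        simp (disch := omega) [mergeStep, Program.run, Test.holds, State.nat_setNat, h1, h2, h3, h4,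
          h5, h6, h7, hlt s' h8, Nat.mod_eq_of_lt, ← hfi, Program.select_pos hc]
      rw [hrun]
      refine ⟨(pi + 1, pj, pd + 1), ⟨?_, ?_, ?_, ?_, ?_, ?_, ?_, ?_⟩, htime _ rfl⟩
      iterate 6 simp [State.nat_setNat, h2, h4, h5, h6, h7, h8]
      · refine hM.step hr hfl hc.1 (fun (h : pj < e) => ?_) hfr (by simp [State.nat_setNat]) ?_
        · have := hc.2.resolve_left (by omega)
          rwa [hfj h, hfi] at this
        · intro x _ hx; simp [State.nat_setNat]; omega
      · intro x hx
        dsimp only at hx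
        rw [← hF x (by omega)]
        simp [State.nat_setNat]; omega
    · have hje : pj < e := by
        by_contra h
        exact hc ⟨by omega, .inl (by omega)⟩
      have hrun : (mergeStep lt o).run W s' = ((s'.setNat (o + 100) (src + n + pd)
          (s.nat (o + 100) (src + pj))).setNat j 0 (pj + 1)).setNat d 0 (pd + 1) := by
        rw [← hfj hje]
        simp (disch := omega) [mergeStep, Program.run, Test.holds, State.nat_setNat, h1, h2, h3, h4,
          h5, h6, h7, hlt s' h8, Nat.mod_eq_of_lt, Program.select_neg hc]
      rw [hrun]
      refine ⟨(pi, pj + 1, pd + 1), ⟨?_, ?_, ?_, ?_, ?_, ?_, ?_, ?_⟩, htime _ rfl⟩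
      iterate 6 simp [State.nat_setNat, h1, h4, h5, h6, h7, h8]
      · refine hM.swap_step hr hfr hje (fun (h : pi < m) => ?_) hfl (by simp [State.nat_setNat]) ?_
        · intro h'
          rw [hfj hje, hfi] at hc
          exact hc ⟨h, .inr (hr.asymm _ _ h')⟩
        · intro x _ hx; simp [State.nat_setNat]; omega
      · intro x hx
        dsimp only at hx
        rw [← hF x (by omega)]
        simp [State.nat_setNat]; omega
  · rintro ⟨pi, pj, pd⟩ s' ⟨⟨h1, h2, h3⟩, h4, h5, h6, h7, h8, hM, hF⟩ hb
    simp only at h1 h2 h3 hM hF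
    have hde : ¬ pd < e := by simpa [Test.holds, -Reg.d, -Reg.hi, h3, h7] using hb
    obtain ⟨a1, a2, a3, a4, a5, -⟩ := id hM
    obtain ⟨rfl, rfl, rfl⟩ : pi = m ∧ pj = e ∧ pd = e := by omega
    exact ⟨hM, hF⟩
  · refine ⟨⟨hl, hj, hd⟩, hn, hsrc, hm, he, rfl, ⟨le_rfl, hlm, le_rfl, hme, rfl, ?_, ?_, ?_, ?_⟩,
      fun _ _ => rfl⟩
    · intros; simp at *; omega
    · intros; simp at *; omega
    · intros; simp at *; omega
    · intro b; simp; constructor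
      · rintro ⟨x, _, _, _⟩; omega
      · rintro (⟨x, _, _, _⟩ | ⟨x, _, _, _⟩) <;> omega

end RealRAM

/-! ### Passes of merge sort -/

namespace RealRAM

open Reg

/-- Every block `[q * h, (q + 1) * h)` is sorted, up to `n`. -/
def BlockSorted (r : ℕ → ℕ → Prop) (f : ℕ → ℕ) (n h : ℕ) : Prop :=
  ∀ q x y, q * h ≤ x → x < y → y < (q + 1) * h → y < n → ¬ r (f y) (f x)

/-- The boundary `L` is a multiple of the block length, so no block contains positions on both sides
of it. -/
theorem BlockSorted.extend {r : ℕ → ℕ → Prop} {g g' : ℕ → ℕ} {q L e H : ℕ}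
    (hg : BlockSorted r g L (2 * H)) (hL : L = q * (2 * H))
    (hs : ∀ x y, L ≤ x → x < y → y < e → ¬ r (g' y) (g' x)) (hgg : ∀ x < L, g' x = g x) :
    BlockSorted r g' e (2 * H) := by
  intro k x y hx hxy hy hye
  by_cases hyL : y < L
  · rw [hgg x (by omega), hgg y hyL]
    exact hg k x y hx hxy hy hyL
  · refine hs x y ?_ hxy hye
    have hkq : q ≤ k := by
      by_contra hcon
      have := Nat.mul_le_mul_right (2 * H) (show k + 1 ≤ q by omega)
      omega
    rw [hL]
    exact (Nat.mul_le_mul_right _ hkq).trans hx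

theorem Merging.image_extend {r : ℕ → ℕ → Prop} {f f' g g' : ℕ → ℕ} {L m e : ℕ}
    (hm : Merging r f' g' L m e m e e) (hgg : ∀ x < L, g' x = g x) (hff : ∀ x < e, f' x = f x)
    (hg : ∀ b, (∃ x, 0 ≤ x ∧ x < L ∧ g x = b) ↔ ∃ x, 0 ≤ x ∧ x < L ∧ f x = b) (b : ℕ) :
    (∃ x, 0 ≤ x ∧ x < e ∧ g' x = b) ↔ ∃ x, 0 ≤ x ∧ x < e ∧ f x = b := by
  have hLm := hm.lo_le
  have hme := hm.mid_le
  constructor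
  · rintro ⟨x, hx, hxe, hxb⟩
    rcases lt_or_ge x L with hxL | hxL
    · obtain ⟨z, hz, hzL, hzb⟩ := (hg b).mp ⟨x, hx, hxL, by rw [← hgg x hxL, hxb]⟩
      exact ⟨z, hz, hzL.trans_le (hLm.trans hme), hzb⟩
    · rcases (hm.image b).mp ⟨x, hxL, hxe, hxb⟩ with ⟨z, hz, hzm, hzb⟩ | ⟨z, hz, hzm, hzb⟩
      · have := hzm.trans_le hme
        exact ⟨z, Nat.zero_le _, this, by rw [← hff z this, hzb]⟩
      · exact ⟨z, Nat.zero_le _, hzm, by rw [← hff z hzm, hzb]⟩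
  · rintro ⟨x, hx, hxe, hxb⟩
    rcases lt_or_ge x L with hxL | hxL
    · obtain ⟨z, hz, hzL, hzb⟩ := (hg b).mpr ⟨x, hx, hxL, hxb⟩
      exact ⟨z, hz, hzL.trans_le (hLm.trans hme), by rw [hgg z hzL, hzb]⟩
    · obtain ⟨z, hz, hzm, hzb⟩ := (hm.image b).mpr (by
        rcases lt_or_ge x m with hxm | hxm
        · exact .inl ⟨x, hxL, hxm, by rw [hff x hxe, hxb]⟩
        · exact .inr ⟨x, hxm, hxe, by rw [hff x hxe, hxb]⟩)
      exact ⟨z, Nat.zero_le _, hzm, hzb⟩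

/-- With truncated subtraction `n - (n - x)` is `min x n`, which clips the last, possibly
incomplete, pair of blocks. -/
def mergeInit : Program :=
  mid ←ₙ size - (size - (var lo + var h)) ;;
  hi ←ₙ size - (size - (var mid + var h)) ;;
  i ←ₙ var lo ;;
  j ←ₙ var mid ;;
  d ←ₙ var lo

def mergeBlock (lt : NExpr → NExpr → Test) (o : ℕ) : Program :=
  mergeInit ;; mergeLoop lt o ;; lo ←ₙ var hi

/-- Merges adjacent blocks of size `h`. -/
def mergePass (lt : NExpr → NExpr → Test) (o : ℕ) : Program :=
  lo ←ₙ 0 ;; .loop (.natLt (var lo) size) (mergeBlock lt o)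

def mergeBlockTime (lt : NExpr → NExpr → Test) (o : ℕ) : ℕ :=
  (Test.natLt (var lo) size).cost + 1 + mergeInit.bound + 2 * mergeStepTime lt o +
    (lo ←ₙ var hi).bound + (lo ←ₙ 0).bound

@[simp] theorem mods_mergeStep (lt : NExpr → NExpr → Test) (o : ℕ) :
    (mergeStep lt o).mods = [o + 100, i, o + 100, j, d] := rfl

theorem mergePass_spec {W : ℕ} {lt : NExpr → NExpr → Test} {r : ℕ → ℕ → Prop} {o : ℕ} {s : State}
    (hlt : Decides W s.real lt r) (hr : WeakOrder r) {n src H : ℕ}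
    (hn : s.nat 0 0 = n) (hsrc : s.nat (o + 101) 0 = src) (hW : src + n + n + 2 < W)
    (hh : s.nat h 0 = H) (hH : 0 < H) (hHn : H < n)
    (hf : BlockSorted r (fun x => s.nat (o + 100) (src + x)) n H) :
    Runs W (mergePass lt o) s (mergeBlockTime lt o * (n + 1)) fun s' =>
      BlockSorted r (fun x => s'.nat (o + 100) (src + n + x)) n (2 * H) ∧
      ∀ b, (∃ x, 0 ≤ x ∧ x < n ∧ s'.nat (o + 100) (src + n + x) = b) ↔
        (∃ x, 0 ≤ x ∧ x < n ∧ s.nat (o + 100) (src + x) = b) := by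
  have key := Runs.loop (W := W) (b := .natLt (var lo) size) (c := mergeBlock lt o)
    (ι := ℕ) (s := (lo ←ₙ 0).run W s) (i := 0)
    (Q := fun s' => BlockSorted r (fun x => s'.nat (o + 100) (src + n + x)) n (2 * H) ∧
      ∀ b, (∃ x, 0 ≤ x ∧ x < n ∧ s'.nat (o + 100) (src + n + x) = b) ↔
        (∃ x, 0 ≤ x ∧ x < n ∧ s.nat (o + 100) (src + x) = b))
    (fun q s' => s'.nat lo 0 = min (q * (2 * H)) n ∧
      s'.nat 0 0 = n ∧ s'.nat (o + 101) 0 = src ∧ s'.nat h 0 = H ∧ s'.real = s.real ∧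
      (∀ x < src + n, s'.nat (o + 100) x = s.nat (o + 100) x) ∧
      BlockSorted r (fun x => s'.nat (o + 100) (src + n + x)) (min (q * (2 * H)) n) (2 * H) ∧
      ∀ b, (∃ x, 0 ≤ x ∧ x < min (q * (2 * H)) n ∧ s'.nat (o + 100) (src + n + x) = b) ↔
        (∃ x, 0 ≤ x ∧ x < min (q * (2 * H)) n ∧ s.nat (o + 100) (src + x) = b))
    (fun q => mergeBlockTime lt o * (n - min (q * (2 * H)) n)) ?_ ?_ ?_
  · refine (Runs.straight_seq (by simp) key).mono ?_ fun _ h => h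
    simp only [mergeBlockTime, zero_mul, Nat.zero_min, Nat.sub_zero, mul_add]
    omega
  · rintro q s' ⟨h1, h2, h3, h4, h5, h6, h7, h8⟩ hb
    obtain ⟨L, hL⟩ : ∃ L, L = q * (2 * H) := ⟨_, rfl⟩
    have hLn : min (q * (2 * H)) n < n := by
      simpa [Test.holds, -Reg.lo, h1, h2] using hb
    have hmL : min (q * (2 * H)) n = L := by omega
    have hL' : (q + 1) * (2 * H) = L + 2 * H := by rw [hL]; ring
    rw [hmL] at h1 h7 h8
    obtain ⟨s1, hs1⟩ : ∃ s1, s1 = mergeInit.run W s' := ⟨_, rfl⟩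
    have hfr : ∀ A ∉ [mid, hi, i, j, d], s1.nat A = s'.nat A := by
      intro A hA; rw [hs1]; exact Program.run_frame (by simp [mergeInit, Program.LoopFree]) _ hA
    have hreal : s1.real = s.real := by
      rw [hs1, Program.run_real (by simp [mergeInit, Program.LoopFree])
        (by simp [mergeInit, Program.RealFree]), h5]
    simp only [h, lo] at h1 h4
    have e1 : s1.nat mid 0 = min (L + H) n := by
      rw [hs1]
      simp (disch := omega) [mergeInit, Program.run, State.nat_setNat, h1, h2, h4,
        Nat.mod_eq_of_lt]
      omega
    have e2 : s1.nat hi 0 = min (L + 2 * H) n := by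
      rw [hs1]
      simp (disch := omega) [mergeInit, Program.run, State.nat_setNat, h1, h2, h4,
        Nat.mod_eq_of_lt]
      omega
    have e3 : s1.nat i 0 = L := by
      rw [hs1]; simp [mergeInit, Program.run, State.nat_setNat, h1]
    have e4 : s1.nat j 0 = min (L + H) n := by
      rw [← e1, hs1]; simp [mergeInit, Program.run, State.nat_setNat, h1]
    have e5 : s1.nat d 0 = L := by
      rw [hs1]; simp [mergeInit, Program.run, State.nat_setNat, h1]
    have hM : s1.nat (o + 100) = s'.nat (o + 100) := hfr _ (by simp)
    have hsort : ∀ k, k = 2 * q ∨ k = 2 * q + 1 → ∀ x y, k * H ≤ x → x < y →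
        y < min ((k + 1) * H) n →
        ¬ r (s1.nat (o + 100) (src + y)) (s1.nat (o + 100) (src + x)) := by
      intro k _ x y hx hxy hy
      rw [hM, h6 _ (by omega), h6 _ (by omega)]
      exact hf k x y hx hxy (by omega) (by omega)
    have k1 : 2 * q * H = L := by rw [hL]; ring
    have k2 : (2 * q + 1) * H = L + H := by rw [hL]; ring
    have k3 : (2 * q + 1 + 1) * H = L + 2 * H := by rw [hL]; ring
    have hmain := mergeLoop_spec (W := W) (s := s1) (o := o) (l := L) (m := min (L + H) n)
      (e := min (L + 2 * H) n) (by rwa [hreal]) hr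
      ((congrFun (hfr 0 (by simp)) 0).trans h2)
      ((congrFun (hfr (o + 101) (by simp)) 0).trans h3) hW e3 e1 e2 e4 e5 (by omega) (by omega)
      (by omega) (fun x y hx hxy hy => hsort (2 * q) (.inl rfl) x y (by omega) hxy (by omega))
      (fun x y hx hxy hy => hsort (2 * q + 1) (.inr rfl) x y (by omega) hxy (by omega))
    refine ⟨_, Runs.straight_seq (by simp [mergeInit, Program.LoopFree]) (Runs.seq_of
      (hs1 ▸ hmain.frame (by simp [mergeLoop, mergeStep, Program.RealFree]))
      fun s2 ⟨⟨hm, hF⟩, hfr2, hreal2⟩ => Runs.straight (by simp) ?_)⟩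
    replace hfr2 : ∀ A ∉ [o + 100, i, j, d], s2.nat A = s1.nat A := by
      rw [hs1]
      intro A hA; refine hfr2 A ?_
      simp only [mergeLoop, Program.mods, mods_mergeStep]
      simp at hA ⊢
      tauto
    rw [← hs1] at hm hF hreal2
    have hhi : s2.nat 15 0 = min (L + 2 * H) n := (congrFun (hfr2 15 (by simp)) 0).trans e2
    refine ⟨q + 1, ⟨?_, ?_, ?_, ?_, ?_, ?_, ?_, ?_⟩, ?_⟩
    · simp [State.nat_setNat, hhi, hL']
    · simp [State.nat_setNat, hfr2 0, hfr 0, h2]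
    · simp [State.nat_setNat, hfr2 (o + 101), hfr (o + 101), h3]
    · simp [State.nat_setNat, hfr2 16, hfr 16, h4]
    · simp [hreal2, hreal]
    · intro x hx
      simp only [Program.run_assign, State.nat_setNat, lo]
      rw [if_neg (by simp), hF x (.inl (hx.trans_le (Nat.le_add_right _ _))), hM, h6 x hx]
    · rw [hL']
      refine h7.extend hL (fun x y hx hxy hy => ?_) fun x hx => ?_
      · simp only [Program.run_assign, State.nat_setNat, lo]
        rw [if_neg (by simp), if_neg (by simp)]
        exact hm.sorted x y hx hxy hy
      · simp only [Program.run_assign, State.nat_setNat, lo]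
        rw [if_neg (by simp), hF _ (.inl (Nat.add_lt_add_left hx _)), hM]
    · rw [hL']
      intro b
      rw [show ((lo ←ₙ var hi).run W s2).nat (o + 100) = s2.nat (o + 100) from
        Program.run_frame (by simp) _ (by simp)]
      refine hm.image_extend (fun x hx => ?_) (fun x hx => ?_) h8 b
      · rw [hF _ (.inl (Nat.add_lt_add_left hx _)), hM]
      · rw [hM, h6 _ (Nat.add_lt_add_left (hx.trans_le (min_le_right _ _)) _)]
    · rw [hL', hmL]
      -- The fixed cost of a pair of blocks is charged to one of its elements, of which there is at
      -- least one; the cost of merging is charged to all of them.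
      have hd : n - L = (n - min (L + 2 * H) n) + (min (L + 2 * H) n - L) := by omega
      have hpos : 1 ≤ min (L + 2 * H) n - L := by omega
      rw [hd, mul_add]
      have e1 := Nat.mul_le_mul_left (mergeBlockTime lt o - mergeStepTime lt o) hpos
      have e2 : mergeBlockTime lt o = (mergeBlockTime lt o - mergeStepTime lt o) +
        mergeStepTime lt o := by simp only [mergeBlockTime]; omega
      have e3 : mergeBlockTime lt o * (min (L + 2 * H) n - L) =
        (mergeBlockTime lt o - mergeStepTime lt o) * (min (L + 2 * H) n - L) +
        mergeStepTime lt o * (min (L + 2 * H) n - L) := by rw [← add_mul, ← e2]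
      rw [e3]
      have e4 : (Test.natLt (var lo) size).cost + 1 + mergeInit.bound + mergeStepTime lt o +
        (lo ←ₙ var hi).bound ≤ mergeBlockTime lt o - mergeStepTime lt o := by
        simp only [mergeBlockTime]; omega
      omega
  · rintro q s' ⟨h1, h2, h3, h4, h5, h6, h7, h8⟩ hb
    have hLn : min (q * (2 * H)) n = n := by
      have : ¬ min (q * (2 * H)) n < n := by
        simpa [Test.holds, -Reg.lo, h1, h2] using hb
      omega
    rw [hLn] at h7 h8
    exact ⟨h7, h8⟩
  · simp only [h] at hh
    refine ⟨?_, ?_, ?_, ?_, ?_, ?_, ?_, ?_⟩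
    · simp [State.nat_setNat]
    · simp [State.nat_setNat, hn]
    · simp [State.nat_setNat, hsrc]
    · simp [State.nat_setNat, hh]
    · simp
    · intro x _; simp [State.nat_setNat]
    · intro q x y _ _ _ hy; simp at hy
    · intro b; simp

/-- Sorts the indices of the points by `lt`; the result is in the array `o + 100`, behind the
address in the variable `o + 101`. -/
def sort (lt : NExpr → NExpr → Test) (o : ℕ) : Program :=
  i ←ₙ 0 ;;
  .loop (.natLt (var i) size) (.setNat (o + 100) (var i) (var i) ;; i ←ₙ var i + 1) ;;
  (o + 101 ←ₙ 0 ;; h ←ₙ 1) ;;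
  .loop (.natLt (var h) size)
    (mergePass lt o ;; o + 101 ←ₙ var (o + 101) + size ;; h ←ₙ 2 * var h)

/-- The array `o + 100` lists, behind the address in the variable `o + 101`, the numbers below `n`
in the order `r`. -/
structure Sorted (r : ℕ → ℕ → Prop) (o n : ℕ) (s : State) : Prop where
  le : s.nat (o + 101) 0 ≤ n * n + n
  sorted : ∀ x y, x < y → y < n →
    ¬ r (s.nat (o + 100) (s.nat (o + 101) 0 + y)) (s.nat (o + 100) (s.nat (o + 101) 0 + x))
  image : ∀ b, (∃ x < n, s.nat (o + 100) (s.nat (o + 101) 0 + x) = b) ↔ b < n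

def sortTime (lt : NExpr → NExpr → Test) (o : ℕ) : ℕ :=
  (i ←ₙ 0).bound + (Test.natLt (var i) size).cost + 1 +
  (Program.setNat (o + 100) (var i) (var i) ;; i ←ₙ var i + 1).bound +
  (o + 101 ←ₙ 0 ;; h ←ₙ 1).bound + (Test.natLt (var h) size).cost + 1 + mergeBlockTime lt o +
  (o + 101 ←ₙ var (o + 101) + size ;; h ←ₙ 2 * var h).bound

theorem sort_init_spec {W o n : ℕ} {s : State} (hn : s.nat 0 0 = n) (hW : n + 2 < W) :
    Runs W (.loop (.natLt (var i) size) (.setNat (o + 100) (var i) (var i) ;; i ←ₙ var i + 1))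
      ((i ←ₙ 0).run W s)
      (((Test.natLt (var i) size).cost + 1 +
        (Program.setNat (o + 100) (var i) (var i) ;; i ←ₙ var i + 1).bound) * n +
        (Test.natLt (var i) size).cost + 1)
      fun s' => ∀ x < n, s'.nat (o + 100) x = x := by
  refine (Runs.loop (ι := ℕ) (i := 0) (fun k s' => s'.nat i 0 = k ∧ k ≤ n ∧ s'.nat 0 0 = n ∧
      ∀ x < k, s'.nat (o + 100) x = x)
    (fun k => ((Test.natLt (var i) size).cost + 1 +
        (Program.setNat (o + 100) (var i) (var i) ;; i ←ₙ var i + 1).bound) * (n - k))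
    ?_ ?_ ?_).mono (by simp) fun _ h => h
  · rintro k s' ⟨h1, h2, h3, h4⟩ hb
    have hk : k < n := by simpa [Test.holds, -Reg.i, h1, h3] using hb
    refine ⟨_, Runs.straight (by simp [Program.LoopFree]) ⟨k + 1, ⟨?_, hk, ?_, ?_⟩, ?_⟩⟩
    · simp only [i] at h1
      simp (disch := omega) [Program.run, State.nat_setNat, h1, Nat.mod_eq_of_lt]
    · simp [Program.run, State.nat_setNat, h3]
    · intro x hx
      simp only [i] at h1
      simp [Program.run, State.nat_setNat, h1]
      split_ifs with hxk
      · exact hxk.symm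
      · exact h4 x (by omega)
    · have : n - k = (n - (k + 1)) + 1 := by omega
      rw [this, mul_add]; omega
  · rintro k s' ⟨h1, h2, h3, h4⟩ hb
    have hk : ¬ k < n := by simpa [Test.holds, -Reg.i, h1, h3] using hb
    exact fun x hx => h4 x (by omega)
  · exact ⟨by simp [State.nat_setNat], Nat.zero_le _, by simp [State.nat_setNat, hn], by simp⟩

/-- Block lengths double, so `Nat.clog 2 n` passes suffice. A pass writes its result `n` cells
further instead of copying it back, so addresses reach about `n * n`; this is the purpose of `hW`.
-/
theorem sort_spec {W : ℕ} {lt : NExpr → NExpr → Test} {r : ℕ → ℕ → Prop} {o : ℕ} {s : State}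
    (hlt : Decides W s.real lt r) (hr : WeakOrder r) {n : ℕ}
    (hn : s.nat 0 0 = n) (hW : n * n + 4 * n + 4 < W) :
    Runs W (sort lt o) s (sortTime lt o * ((n + 1) * (Nat.log 2 n + 3)))
      (Sorted r o n) := by
  have hWn : n + 2 < W := by omega
  set m₀ := Nat.clog 2 n with hm₀
  have hm₀n : m₀ ≤ n := by
    rw [hm₀, Nat.clog_le_iff_le_pow (by norm_num)]
    exact Nat.lt_two_pow_self.le
  have hm₀l : m₀ ≤ Nat.log 2 n + 1 := by
    rw [hm₀, Nat.clog_le_iff_le_pow (by norm_num)]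
    exact (Nat.lt_pow_succ_log_self (by norm_num) n).le
  have hmain : ∀ s1 : State, s1.nat 0 0 = n → s1.real = s.real →
      (∀ x < n, s1.nat (o + 100) x = x) →
      Runs W (.loop (.natLt (var h) size)
        (mergePass lt o ;; o + 101 ←ₙ var (o + 101) + size ;; h ←ₙ 2 * var h))
        ((o + 101 ←ₙ 0 ;; h ←ₙ 1).run W s1)
        (((Test.natLt (var h) size).cost + 1 + (mergeBlockTime lt o * (n + 1) +
            (o + 101 ←ₙ var (o + 101) + size ;; h ←ₙ 2 * var h).bound)) * m₀ +
          (Test.natLt (var h) size).cost + 1)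
        (Sorted r o n) := by
    intro s1 hn1 hreal1 hid
    -- The ghost parameters are the number of passes still allowed and the block length. The
    -- inequality `n ≤ 2 ^ p.1 * p.2` says that the passes suffice, and `src + p.1 * n ≤ m₀ * n`
    -- bounds the addresses.
    refine Runs.loop (ι := ℕ × ℕ) (i := (m₀, 1))
      (fun p s' => ∃ src, s'.nat (o + 101) 0 = src ∧ s'.nat h 0 = p.2 ∧ s'.nat 0 0 = n ∧
        s'.real = s.real ∧ 0 < p.2 ∧ n ≤ 2 ^ p.1 * p.2 ∧ src + p.1 * n ≤ m₀ * n ∧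
        BlockSorted r (fun x => s'.nat (o + 100) (src + x)) n p.2 ∧
        ∀ b, (∃ x, 0 ≤ x ∧ x < n ∧ s'.nat (o + 100) (src + x) = b) ↔ b < n)
      (fun p => ((Test.natLt (var h) size).cost + 1 + (mergeBlockTime lt o * (n + 1) +
        (o + 101 ←ₙ var (o + 101) + size ;; h ←ₙ 2 * var h).bound)) * p.1) ?_ ?_ ?_
    · rintro ⟨m, H⟩ s' ⟨src, h1, h2, h3, h4, h5, h6, h7, h8, h9⟩ hb
      dsimp only at *
      have hHn : H < n := by simpa [Test.holds, -Reg.h, h2, h3] using hb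
      obtain ⟨m, rfl⟩ : ∃ m', m = m' + 1 := by
        refine Nat.exists_eq_succ_of_ne_zero fun h0 => ?_
        rw [h0] at h6; omega
      have hsrcn : src + n ≤ n * n := by
        have := Nat.mul_le_mul_right n hm₀n
        rw [add_mul] at h7; omega
      refine ⟨_, Runs.seq_of ((mergePass_spec (h4 ▸ hlt) hr h3 h1 (by omega) h2 h5 hHn h8).frame
        (by simp [mergePass, mergeBlock, mergeInit, mergeLoop, mergeStep, Program.RealFree]))
        fun s2 ⟨⟨hS, hI⟩, hfr, hre⟩ =>
        Runs.straight (by simp [Program.LoopFree]) ⟨(m, 2 * H), ⟨src + n, ?_⟩, ?_⟩⟩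
      · have f0 : s2.nat 0 = s'.nat 0 := hfr _ (by
          simp [mergePass, mergeBlock, mergeInit, mergeLoop, mergeStep, Program.mods])
        have f1 : s2.nat (o + 101) = s'.nat (o + 101) := hfr _ (by
          simp [mergePass, mergeBlock, mergeInit, mergeLoop, mergeStep, Program.mods])
        have f2 : s2.nat 16 = s'.nat 16 := hfr _ (by
          simp [mergePass, mergeBlock, mergeInit, mergeLoop, mergeStep, Program.mods])
        simp only [h] at h2
        refine ⟨?_, ?_, ?_, ?_, by simp [h5], ?_, ?_, ?_, ?_⟩
        · simp (disch := omega) [Program.run, State.nat_setNat, f0, f1, h1, h3, Nat.mod_eq_of_lt]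
        · simp (disch := omega) [Program.run, State.nat_setNat, f2, h2, Nat.mod_eq_of_lt]
        · simp [Program.run, State.nat_setNat, f0, h3]
        · simp [Program.run, hre, h4]
        · calc n ≤ 2 ^ (m + 1) * H := h6
            _ = 2 ^ m * (2 * H) := by ring
        · rw [add_mul] at h7; dsimp only; omega
        · simpa [Program.run, State.nat_setNat] using hS
        · intro b
          rw [← h9, ← hI]
          simp [Program.run, State.nat_setNat]
      · dsimp only; rw [mul_add _ m 1]; omega
    · rintro ⟨m, H⟩ s' ⟨src, h1, h2, h3, h4, h5, h6, h7, h8, h9⟩ hb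
      dsimp only at *
      have hHn : ¬ H < n := by simpa [Test.holds, -Reg.h, h2, h3] using hb
      have hmn := Nat.mul_le_mul_right n hm₀n
      refine ⟨by rw [h1]; omega, ?_, ?_⟩
      · intro x y hxy hy
        rw [h1]
        exact h8 0 x y (by omega) hxy (by omega) hy
      · intro b
        rw [← h9, h1]
        simp
    · refine ⟨0, ?_, ?_, ?_, ?_, one_pos, ?_, by simp, ?_, ?_⟩
      · simp [Program.run, State.nat_setNat]
      · simp (disch := omega) [Program.run, State.nat_setNat, Nat.mod_eq_of_lt]
      · simp [Program.run, State.nat_setNat, hn1]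
      · simp [Program.run, hreal1]
      · rw [mul_one]; exact Nat.le_pow_clog (by norm_num) n
      · intro q x y hx hxy hy; dsimp only at *; omega
      · intro b
        simp only [Program.run, Program.run_assign, State.nat_setNat]
        simp
        constructor
        · rintro ⟨x, hx, rfl⟩; rw [hid x hx]; exact hx
        · intro hb; exact ⟨b, hb, hid b hb⟩
  refine (Runs.straight_seq (by simp) (Runs.seq_of ((sort_init_spec hn hWn).frame
    (by simp [Program.RealFree])) fun s1 ⟨hid, hfr, hre⟩ => Runs.straight_seq
    (by simp [Program.LoopFree]) (hmain s1 ?_ ?_ hid))).mono ?_ fun _ h => h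
  · rw [hfr 0 (by simp [Program.mods])]; simp [State.nat_setNat, hn]
  · rw [hre]; simp
  · set A := (Test.natLt (var h) size).cost
    set B := (o + 101 ←ₙ var (o + 101) + size ;; h ←ₙ 2 * var h).bound
    set C := (Test.natLt (var i) size).cost
    set D := (Program.setNat (o + 100) (var i) (var i) ;; i ←ₙ var i + 1).bound
    set E := (i ←ₙ 0).bound
    set F := (o + 101 ←ₙ 0 ;; h ←ₙ 1).bound
    set G := mergeBlockTime lt o
    have hK : sortTime lt o = E + C + 1 + D + F + A + 1 + G + B := rfl
    rw [hK]
    set l := Nat.log 2 n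
    calc _ ≤ E + ((C + 1 + D) * n + C + 1 + (F + ((A + 1 + (G * (n + 1) + B)) * (l + 1) + A + 1))) := by
          gcongr
      _ ≤ (E + C + 1 + D + F + A + 1 + G + B) * ((n + 1) * (l + 3)) := by
          ring_nf
          nlinarith [Nat.zero_le (n * l), Nat.zero_le (E * n),
            Nat.zero_le (E * l), Nat.zero_le (E * n * l)]

end RealRAM

namespace RealRAM

/-! ## Distributing the points into a table of stacks -/

namespace Reg

@[simp] def b : ℕ := 20
@[simp] def K : ℕ := 21
@[simp] def c : ℕ := 22

end Reg

open Reg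

/-- Uniqueness of division with remainder. Tables have rows of length `n + 1`, and keys are numbers
with several digits to this base. -/
theorem addr_inj {n a b x y : ℕ} (h : a * (n + 1) + x = b * (n + 1) + y) (hx : x ≤ n)
    (hy : y ≤ n) : a = b ∧ x = y := by
  have h1 : (a * (n + 1) + x) / (n + 1) = a := by
    rw [mul_comm, Nat.mul_add_div (by omega), Nat.div_eq_of_lt (by omega), add_zero]
  have h2 : (b * (n + 1) + y) / (n + 1) = b := by
    rw [mul_comm, Nat.mul_add_div (by omega), Nat.div_eq_of_lt (by omega), add_zero]
  have : a = b := by rw [← h1, h, h2]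
  subst this
  omega

def distInit (o : ℕ) (key : NExpr) : Program :=
  b ←ₙ .get (o + 100) (var (o + 101) + var i) ;; K ←ₙ key ;; c ←ₙ .get (o + 102) (var K)

def distPush (o : ℕ) : Program :=
  .setNat (o + 103) (var K * (size + 1) + var c) (var b) ;;
  .setNat (o + 104) (var K * (size + 1) + var b) (var c) ;;
  .setNat (o + 102) (var K) (var c + 1) ;;
  i ←ₙ var i + 1

/-- Pushes the points, in their order in the array `o + 100`, to the stacks determined by `key`;
before a point is pushed, `pop` may shorten the stack. Array `o + 103` holds the stacks, `o + 102`
their heights and `o + 104` the positions of the points. -/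
def distribute (o : ℕ) (key : NExpr) (pop : Program) : Program :=
  i ←ₙ 0 ;; .loop (.natLt (var i) size) (distInit o key ;; pop ;; distPush o)

/-- Invariants of stacks: `I P f c r` says that the cells `f x`, `x < c`, are a valid stack for the
set `P` of points, and that `r` gives the positions of the points. -/
abbrev StackInv : Type := Finset ℕ → (ℕ → ℕ) → ℕ → (ℕ → ℕ) → Prop

/-- A push changes one row of the table; locality is what lets the stacks in all other rows stay
valid. -/
def StackInv.Local (I : StackInv) : Prop :=
  ∀ P f f' c r r', (∀ x < c, f' x = f x) → (∀ x ∈ P, r' x = r x) → I P f c r → I P f' c r'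

/-- The stack with key `κ` is valid for the set `P κ`. -/
def Table (o n : ℕ) (I : StackInv) (P : ℕ → Finset ℕ) (s : State) : Prop :=
  ∀ κ, I (P κ) (fun x => s.nat (o + 103) (κ * (n + 1) + x)) (s.nat (o + 102) κ)
      (fun x => s.nat (o + 104) (κ * (n + 1) + x)) ∧
    s.nat (o + 102) κ ≤ (P κ).card ∧ P κ ⊆ Finset.range n

theorem Table.count_le {o n : ℕ} {I : StackInv} {P : ℕ → Finset ℕ} {s : State}
    (h : Table o n I P s) (κ : ℕ) : s.nat (o + 102) κ ≤ n :=
  (h κ).2.1.trans ((Finset.card_le_card (h κ).2.2).trans (by simp))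

theorem Table.congr {o n : ℕ} {I : StackInv} {P P' : ℕ → Finset ℕ} {s s' : State}
    (h : Table o n I P s) (hP : ∀ κ, P' κ = P κ) (h2 : s'.nat (o + 102) = s.nat (o + 102))
    (h3 : s'.nat (o + 103) = s.nat (o + 103)) (h4 : s'.nat (o + 104) = s.nat (o + 104)) :
    Table o n I P' s' := by
  intro κ
  rw [hP κ, h2, h3, h4]
  exact h κ

/-- Effect of pushing one point. -/
theorem Table.push {o n : ℕ} {I : StackInv} {P P' : ℕ → Finset ℕ} {s s' : State} {κ bb c' : ℕ}
    (hI : I.Local) (h : Table o n I P s) (hbb : bb < n) (hbP : bb ∉ P κ)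
    (hc' : c' ≤ s.nat (o + 102) κ)
    (hpush : ∀ f' r', (∀ x < c', f' x = s.nat (o + 103) (κ * (n + 1) + x)) → f' c' = bb →
      (∀ x ∈ P κ, r' x = s.nat (o + 104) (κ * (n + 1) + x)) → r' bb = c' →
      I (insert bb (P κ)) f' (c' + 1) r')
    (hP : P' κ = insert bb (P κ)) (hP' : ∀ κ' ≠ κ, P' κ' = P κ')
    (h2 : ∀ x, s'.nat (o + 102) x = if x = κ then c' + 1 else s.nat (o + 102) x)
    (h3 : ∀ x, s'.nat (o + 103) x = if x = κ * (n + 1) + c' then bb else s.nat (o + 103) x)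
    (h4 : ∀ x, s'.nat (o + 104) x = if x = κ * (n + 1) + bb then c' else s.nat (o + 104) x) :
    Table o n I P' s' := by
  have hc'n := hc'.trans (h.count_le κ)
  intro κ'
  by_cases hκ : κ' = κ
  · subst hκ
    rw [hP, h2, if_pos rfl]
    refine ⟨hpush _ _ (fun x hx => ?_) ?_ (fun x hx => ?_) ?_, ?_, ?_⟩
    · rw [h3, if_neg (by omega)]
    · rw [h3, if_pos rfl]
    · rw [h4, if_neg]
      intro he
      have : x = bb := by omega
      exact hbP (this ▸ hx)
    · rw [h4, if_pos rfl]
    · rw [Finset.card_insert_of_notMem hbP]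
      have := (h κ').2.1
      omega
    · exact Finset.insert_subset (by simpa using hbb) (h κ').2.2
  · rw [hP' κ' hκ, h2, if_neg hκ]
    refine ⟨hI _ _ _ _ _ _ (fun x hx => ?_) (fun x hx => ?_) (h κ').1, (h κ').2⟩
    · have := h.count_le κ'
      rw [h3, if_neg fun he => hκ (addr_inj he (by omega) hc'n).1]
    · have := Finset.mem_range.mp ((h κ').2.2 hx)
      rw [h4, if_neg fun he => hκ (addr_inj he (by omega) (by omega)).1]

/-- The specification of the program `pop` used in `distribute`. -/
def PopSpec (W o n : ℕ) (ord : ℕ → ℕ → Prop) (I : StackInv) (ρ : ℕ → ℕ → ℝ) (pop : Program)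
    (tp : ℕ) : Prop :=
  ∀ (s : State) (P : Finset ℕ) (κ bb cnt : ℕ) (r : ℕ → ℕ), s.real = ρ → s.nat 0 0 = n →
    s.nat b 0 = bb → s.nat K 0 = κ → s.nat c 0 = cnt → (κ + 1) * (n + 1) + 2 < W → cnt ≤ n →
    bb < n → bb ∉ P → P ⊆ Finset.range n → (∀ x ∈ P, ¬ ord bb x) →
    I P (fun x => s.nat (o + 103) (κ * (n + 1) + x)) cnt r →
    ∃ c' ≤ cnt, Runs W pop s (tp * (cnt - c' + 1)) (fun s' => s'.nat c 0 = c') ∧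
      ∀ f' r', (∀ x < c', f' x = s.nat (o + 103) (κ * (n + 1) + x)) → f' c' = bb →
        (∀ x ∈ P, r' x = r x) → r' bb = c' → I (insert bb P) f' (c' + 1) r'

/-- Each point pays `tp` for the call of `pop` before its push and `tp` for its own later removal.
-/
def distTime (o : ℕ) (key : NExpr) (tp : ℕ) : ℕ :=
  (i ←ₙ 0).bound + (Test.natLt (var i) size).cost + 1 + (distInit o key).bound + 2 * tp +
    (distPush o).bound

/-- A map from `range n` onto `range n` is injective. Hence no point is pushed twice. -/
theorem Sorted.injOn {r : ℕ → ℕ → Prop} {o n : ℕ} {s : State} (h : Sorted r o n s) :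
    Set.InjOn (fun x => s.nat (o + 100) (s.nat (o + 101) 0 + x)) (Finset.range n) := by
  rw [← Finset.card_image_iff]
  congr 1
  ext b
  simpa using h.image b

/-- Amortised analysis: a push raises the total height of the stacks by one and every removal lowers
it by one, so there are at most `n` removals. By `hP₀` only empty rows are filled, so tables of
earlier levels survive. The last clause protects positions recorded under other keys, since keys of
the second hierarchy are computed from such positions. -/
theorem distribute_spec {W o n : ℕ} {ord : ℕ → ℕ → Prop} {I : StackInv} {pop : Program} {tp : ℕ}
    {s : State} {key : NExpr} {kf : ℕ → ℕ} {P₀ : ℕ → Finset ℕ} (hI : I.Local)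
    (hpop : PopSpec W o n ord I s.real pop tp) (hpm : ∀ A ∈ pop.mods, A = c)
    (hpr : pop.RealFree) (hn : s.nat 0 0 = n) (hW : n * n + 4 * n + 4 < W)
    (hs : Sorted ord o n s)
    (hkey : ∀ s' : State, (∀ A ∉ [i, b, K, c, o + 102, o + 103, o + 104], s'.nat A = s.nat A) →
      s'.nat b 0 < n → key.eval W s' = kf (s'.nat b 0))
    (hkf : ∀ x < n, (kf x + 1) * (n + 1) + 2 < W)
    (hT : Table o n I P₀ s) (hP₀ : ∀ x < n, P₀ (kf x) = ∅) :
    Runs W (distribute o key pop) s (distTime o key tp * (n + 1)) fun s' =>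
      Table o n I (fun κ => P₀ κ ∪ (Finset.range n).filter (kf · = κ)) s' ∧
      ∀ κ, (∀ x < n, kf x ≠ κ) → ∀ x ≤ n,
        s'.nat (o + 104) (κ * (n + 1) + x) = s.nat (o + 104) (κ * (n + 1) + x) := by
  set src := s.nat (o + 101) 0 with hsrc
  set g : ℕ → ℕ := fun x => s.nat (o + 100) (src + x) with hg
  have hgn : ∀ x < n, g x < n := fun x hx => (hs.image _).mp ⟨x, hx, rfl⟩
  have himg : (Finset.range n).image g = Finset.range n := by
    ext x; simpa using hs.image x
  set keys := (Finset.range n).image kf with hkeys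
  set P : ℕ → ℕ → Finset ℕ :=
    fun k κ => P₀ κ ∪ ((Finset.range k).image g).filter (kf · = κ) with hP
  set A := (Test.natLt (var i) size).cost + 1 + (distInit o key).bound + 2 * tp +
    (distPush o).bound with hA
  have hsrcW : src + n + 2 < W := by have := hs.le; omega
  -- The ghost parameters are the number of points pushed and the total height of the stacks in use;
  -- the term `tp * p.2` saves time for future removals.
  have key' := Runs.loop (W := W) (b := .natLt (var i) size)
    (c := distInit o key ;; pop ;; distPush o) (ι := ℕ × ℕ) (s := (i ←ₙ 0).run W s) (i := (0, 0))
    (Q := fun s' => Table o n I (fun κ => P₀ κ ∪ (Finset.range n).filter (kf · = κ)) s' ∧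
      ∀ κ, (∀ x < n, kf x ≠ κ) → ∀ x ≤ n,
        s'.nat (o + 104) (κ * (n + 1) + x) = s.nat (o + 104) (κ * (n + 1) + x))
    (fun p s' => s'.nat i 0 = p.1 ∧ p.1 ≤ n ∧
      (∀ A ∉ [i, b, K, c, o + 102, o + 103, o + 104], s'.nat A = s.nat A) ∧ s'.real = s.real ∧
      Table o n I (P p.1) s' ∧ ∑ κ ∈ keys, s'.nat (o + 102) κ = p.2 ∧
      ∀ κ, (∀ x < n, kf x ≠ κ) → ∀ x ≤ n,
        s'.nat (o + 104) (κ * (n + 1) + x) = s.nat (o + 104) (κ * (n + 1) + x))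
    (fun p => A * (n - p.1) + tp * p.2) ?_ ?_ ?_
  · refine (Runs.straight_seq (by simp) key').mono ?_ fun _ h => h
    have : distTime o key tp = (i ←ₙ 0).bound + A := by simp only [distTime, hA]; omega
    have hA' : (Test.natLt (var i) size).cost + 1 ≤ A := by simp only [hA]; omega
    have e : ((i ←ₙ 0).bound + A) * (n + 1) =
      (i ←ₙ 0).bound * n + (i ←ₙ 0).bound + A * n + A := by ring
    rw [this, e, Nat.sub_zero, mul_zero]
    omega
  · rintro ⟨k, σ⟩ s' ⟨h1, h2, h3, h4, h5, h6, h7⟩ hb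
    dsimp only at *
    have hn' : s'.nat 0 0 = n := by rw [h3 0 (by simp)]; exact hn
    have hk : k < n := by simpa [Test.holds, -Reg.i, h1, hn'] using hb
    obtain ⟨bb, hbb⟩ : ∃ bb, bb = g k := ⟨_, rfl⟩
    have hbbn : bb < n := hbb ▸ hgn k hk
    obtain ⟨κ, hκ⟩ : ∃ κ, κ = kf bb := ⟨_, rfl⟩
    have hκW : (κ + 1) * (n + 1) + 2 < W := hκ ▸ hkf bb hbbn
    have hκW' : κ * (n + 1) + n + 3 < W := by
      have : (κ + 1) * (n + 1) = κ * (n + 1) + (n + 1) := by ring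
      omega
    have hκW2 : κ < W := by
      have := Nat.le_mul_of_pos_right κ (Nat.succ_pos n)
      simp only [Nat.succ_eq_add_one] at this
      omega
    have hκW3 : κ * (n + 1) < W := by omega
    have hbP : bb ∉ P k κ := by
      simp only [hP, hκ, hP₀ bb hbbn, Finset.empty_union, Finset.mem_filter, Finset.mem_image,
        Finset.mem_range, not_and]
      rintro ⟨x, hx, hxb⟩
      rw [hbb] at hxb
      have := hs.injOn (by simp; omega) (by simpa using hk) hxb
      omega
    have hord : ∀ x ∈ P k κ, ¬ ord bb x := by
      intro x hx
      simp only [hP, hκ, hP₀ bb hbbn, Finset.empty_union, Finset.mem_filter, Finset.mem_image,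
        Finset.mem_range] at hx
      obtain ⟨⟨z, hz, rfl⟩, -⟩ := hx
      rw [hbb]
      exact hs.sorted z k hz hk
    obtain ⟨s1, hs1⟩ : ∃ s1, s1 = (distInit o key).run W s' := ⟨_, rfl⟩
    have hLF : (distInit o key).LoopFree := by simp [distInit, Program.LoopFree]
    have f1 : ∀ A ∉ [b, K, c], s1.nat A = s'.nat A := fun A hA => by
      rw [hs1]; exact Program.run_frame hLF _ hA
    have r1 : s1.real = s'.real := by
      rw [hs1]; exact Program.run_real hLF (by simp [distInit, Program.RealFree]) _
    simp only [i] at h1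
    have hb0 : (s'.nat (o + 100) ((s'.nat (o + 101) 0 + s'.nat 10 0) % W)) = bb := by
      rw [h3 (o + 100) (by simp), h3 (o + 101) (by simp), h1, ← hsrc, hbb, Nat.mod_eq_of_lt (by omega)]
    have hkey0 : key.eval W (s'.setNat 20 0 bb) = κ := by
      rw [hkey _ (fun A hA => ?_) (by simpa [State.nat_setNat] using hbbn)]
      · simp [State.nat_setNat, hκ]
      · rw [State.nat_setNat_of_ne _ _ _ (by simp at hA; tauto), h3 A hA]
    have b1 : s1.nat b 0 = bb := by
      rw [hs1]; simp [distInit, Program.run, State.nat_setNat, hb0]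
    have K1 : s1.nat K 0 = κ := by
      rw [hs1]; simp [distInit, Program.run, State.nat_setNat, hb0, hkey0]
    have c1 : s1.nat c 0 = s'.nat (o + 102) κ := by
      rw [hs1]; simp [distInit, Program.run, State.nat_setNat, hb0, hkey0]
    have hf : s1.nat (o + 103) = s'.nat (o + 103) := f1 _ (by simp)
    obtain ⟨c', hc', hrun, hpush⟩ := hpop s1 (P k κ) κ bb _ _ (r1.trans h4)
      ((congrFun (f1 0 (by simp)) 0).trans hn') b1 K1 c1 hκW (h5.count_le κ) hbbn hbP (h5 κ).2.2 hord
      (by rw [hf]; exact (h5 κ).1)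
    have hc'n := hc'.trans (h5.count_le κ)
    refine ⟨_, Runs.straight_seq hLF (Runs.seq_of (hs1 ▸ hrun.frame hpr)
      fun s2 ⟨c2, f2, r2⟩ => Runs.straight (by simp [distPush, Program.LoopFree]) ?_)⟩
    rw [← hs1] at f2 r2
    have f2' : ∀ A ≠ c, s2.nat A = s1.nat A := fun A hA => f2 A fun h => hA (hpm A h)
    have b2 : s2.nat 20 0 = bb := (congrFun (f2' 20 (by simp)) 0).trans b1
    have K2 : s2.nat 21 0 = κ := (congrFun (f2' 21 (by simp)) 0).trans K1
    have i2 : s2.nat 10 0 = k := by rw [f2' 10 (by simp), f1 10 (by simp), h1]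
    have n2 : s2.nat 0 0 = n := by rw [f2' 0 (by simp), f1 0 (by simp), hn']
    simp only [c] at c2
    have hpr : (distPush o).run W s2 = (((s2.setNat (o + 103) (κ * (n + 1) + c') bb).setNat
        (o + 104) (κ * (n + 1) + bb) c').setNat (o + 102) κ (c' + 1)).setNat 10 0 (k + 1) := by
      simp (disch := omega) [distPush, Program.run, State.nat_setNat, b2, K2, c2, n2, i2,
        Nat.mod_eq_of_lt]
    rw [hpr]
    have hPk : ∀ κ', P (k + 1) κ' = if κ' = κ then insert bb (P k κ') else P k κ' := by
      intro κ'
      simp only [hP, Finset.range_add_one, Finset.image_insert, Finset.filter_insert, ← hbb, ← hκ]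
      by_cases h : κ' = κ
      · rw [if_pos h.symm, if_pos h, Finset.union_insert]
      · rw [if_neg (Ne.symm h), if_neg h]
    have hC : ∀ x, ((((s2.setNat (o + 103) (κ * (n + 1) + c') bb).setNat
        (o + 104) (κ * (n + 1) + bb) c').setNat (o + 102) κ (c' + 1)).setNat 10 0 (k + 1)).nat
        (o + 102) x = if x = κ then c' + 1 else s'.nat (o + 102) x := by
      intro x; simp [State.nat_setNat, f2' (o + 102) (by simp), f1 (o + 102)]
    have hκkeys : κ ∈ keys := Finset.mem_image.mpr ⟨bb, by simpa using hbbn, hκ.symm⟩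
    have hsum : ∑ x ∈ keys, (if x = κ then c' + 1 else s'.nat (o + 102) x) +
        s'.nat (o + 102) κ = σ + (c' + 1) := by
      rw [← h6, ← Finset.add_sum_erase _ _ hκkeys, ← Finset.add_sum_erase _ _ hκkeys, if_pos rfl]
      have : ∑ x ∈ keys.erase κ, (if x = κ then c' + 1 else s'.nat (o + 102) x) =
          ∑ x ∈ keys.erase κ, s'.nat (o + 102) x :=
        Finset.sum_congr rfl fun x hx => if_neg (Finset.ne_of_mem_erase hx)
      rw [this]; omega
    obtain ⟨S, hS⟩ : ∃ S, S = ∑ x ∈ keys, (if x = κ then c' + 1 else s'.nat (o + 102) x) :=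
      ⟨_, rfl⟩
    rw [← hS] at hsum
    have hR : ∀ x, ((((s2.setNat (o + 103) (κ * (n + 1) + c') bb).setNat
        (o + 104) (κ * (n + 1) + bb) c').setNat (o + 102) κ (c' + 1)).setNat 10 0 (k + 1)).nat
        (o + 104) x = if x = κ * (n + 1) + bb then c' else s'.nat (o + 104) x := by
      intro x; simp [State.nat_setNat, f2' (o + 104) (by simp), f1 (o + 104)]
    refine ⟨(k + 1, S), ⟨?_, hk, ?_, ?_, ?_, ?_, ?_⟩, ?_⟩
    · simp [State.nat_setNat]
    · intro B hB
      simp only [List.mem_cons, List.not_mem_nil, or_false, not_or, i, b, K, c] at hB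
      rw [State.nat_setNat_of_ne _ _ _ hB.1, State.nat_setNat_of_ne _ _ _ hB.2.2.2.2.1,
        State.nat_setNat_of_ne _ _ _ hB.2.2.2.2.2.2, State.nat_setNat_of_ne _ _ _ hB.2.2.2.2.2.1,
        f2' B hB.2.2.2.1, f1 B (by simp; tauto), h3 B (by simp; tauto)]
    · simp [r2, r1, h4]
    · refine h5.push hI hbbn hbP hc' (fun f' r' hf' hf'' hr' hr'' => hpush f' r'
        (fun x hx => by rw [hf' x hx, hf]) hf'' hr' hr'') ?_ ?_ hC ?_ hR
      · dsimp only; rw [hPk, if_pos rfl]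
      · intro κ' h; dsimp only; rw [hPk, if_neg h]
      · intro x; simp [State.nat_setNat, f2' (o + 103) (by simp), f1 (o + 103)]
    · dsimp only; rw [hS]; exact Finset.sum_congr rfl fun x _ => hC x
    · intro κ' hκ' x hx
      rw [hR, if_neg, h7 κ' hκ' x hx]
      intro he
      exact hκ' bb hbbn ((addr_inj he hx hbbn.le).1.trans hκ).symm
    · have e1 : n - k = (n - (k + 1)) + 1 := by omega
      have e2 : S + (s'.nat (o + 102) κ - c' + 1) = σ + 2 := by omega
      have e3 := congrArg (tp * ·) e2
      simp only [mul_add] at e3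
      rw [e1, mul_add A, hA]
      simp only [mul_add]
      omega
  · rintro ⟨k, σ⟩ s' ⟨h1, h2, h3, h4, h5, h6, h7⟩ hb
    dsimp only at *
    have hn' : s'.nat 0 0 = n := by rw [h3 0 (by simp)]; exact hn
    have hk : k = n := by
      have : ¬ k < n := by simpa [Test.holds, -Reg.i, h1, hn'] using hb
      omega
    subst hk
    simp only [hP, himg] at h5
    exact ⟨h5, h7⟩
  · refine ⟨by simp [State.nat_setNat], Nat.zero_le _, ?_, by simp, ?_, ?_, ?_⟩
    · intro A hA
      exact Program.run_frame (by simp) _ (by simp at hA ⊢; tauto)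
    · refine hT.congr (by simp [hP]) ?_ ?_ ?_ <;> exact Program.run_frame (by simp) _ (by simp)
    · refine Finset.sum_eq_zero fun κ hκ => ?_
      obtain ⟨x, hx, rfl⟩ := Finset.mem_image.mp hκ
      rw [Program.run_frame (by simp) _ (by simp)]
      have := (hT (kf x)).2.1
      rwa [hP₀ x (by simpa using hx), Finset.card_empty, Nat.le_zero] at this
    · intro κ _ x _
      rw [Program.run_frame (by simp) _ (by simp)]

end RealRAM

namespace SegmentQuery

open RealRAM RealRAM.Reg

/-! ## The three orders of the points -/

/-- Abscissa and ordinate of a point, given by its index. -/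
def xE (e : NExpr) : RExpr := .get 1 e
def yE (e : NExpr) : RExpr := .get 2 e
def tauE : RExpr := .get 0 0

@[simp] theorem eval_xE (W : ℕ) (s : State) (e : NExpr) :
    (xE e).eval W s = s.real 1 (e.eval W s) := rfl
@[simp] theorem eval_yE (W : ℕ) (s : State) (e : NExpr) :
    (yE e).eval W s = s.real 2 (e.eval W s) := rfl
@[simp] theorem eval_tauE (W : ℕ) (s : State) : tauE.eval W s = s.real 0 0 := by simp [tauE]

/-- Slope of the line through `s` and the point `b`. -/
noncomputable def slopeS (ρ : ℕ → ℕ → ℝ) (b : ℕ) : ℝ := ρ 2 b / ρ 1 b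
/-- Slope of the line through `t` and the point `b`. -/
noncomputable def slopeT (ρ : ℕ → ℕ → ℝ) (b : ℕ) : ℝ := (ρ 2 b - ρ 0 0) / ρ 1 b

def slopeSE (e : NExpr) : RExpr := yE e / xE e
def slopeTE (e : NExpr) : RExpr := (yE e - tauE) / xE e

@[simp] theorem eval_slopeSE (W : ℕ) (s : State) (e : NExpr) :
    (slopeSE e).eval W s = slopeS s.real (e.eval W s) := rfl
@[simp] theorem eval_slopeTE (W : ℕ) (s : State) (e : NExpr) :
    (slopeTE e).eval W s = slopeT s.real (e.eval W s) := by simp [slopeTE, slopeT]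

def ltS (e f : NExpr) : Test := .realLt (slopeSE e) (slopeSE f)
def ltT (e f : NExpr) : Test := .realLt (slopeTE e) (slopeTE f)
def ltY (e f : NExpr) : Test :=
  .disj (.realLt (yE e) (yE f)) (.conj (.realEq (yE e) (yE f)) (.realLt (xE f) (xE e)))

def ordS (ρ : ℕ → ℕ → ℝ) (a b : ℕ) : Prop := slopeS ρ a < slopeS ρ b
def ordT (ρ : ℕ → ℕ → ℝ) (a b : ℕ) : Prop := slopeT ρ a < slopeT ρ b
/-- Upwards, and from right to left among points of the same height. -/
def ordY (ρ : ℕ → ℕ → ℝ) (a b : ℕ) : Prop := ρ 2 a < ρ 2 b ∨ ρ 2 a = ρ 2 b ∧ ρ 1 b < ρ 1 a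

theorem weakOrder_of_key (k : ℕ → ℝ) : WeakOrder fun a b => k a < k b :=
  ⟨fun _ _ h => h.not_gt, fun _ _ _ h h' => not_lt.mpr ((not_lt.mp h).trans (not_lt.mp h'))⟩

theorem weakOrder_ordY (ρ : ℕ → ℕ → ℝ) : WeakOrder (ordY ρ) where
  asymm a b h h' := by
    rcases h with h | ⟨h1, h2⟩ <;> rcases h' with h' | ⟨h1', h2'⟩ <;> linarith
  trans a b c h h' := by
    simp only [ordY, not_or, not_lt, not_and] at *
    refine ⟨h.1.trans h'.1, fun e => ?_⟩
    have e1 : ρ 2 b = ρ 2 a := le_antisymm (e ▸ h'.1) h.1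
    exact (h'.2 (e.trans e1.symm)).trans (h.2 e1)

theorem decides_ltS (W : ℕ) (ρ : ℕ → ℕ → ℝ) : Decides W ρ ltS (ordS ρ) := by
  rintro s rfl e f; exact Iff.rfl
theorem decides_ltT (W : ℕ) (ρ : ℕ → ℕ → ℝ) : Decides W ρ ltT (ordT ρ) := by
  rintro s rfl e f; simp [ltT, Test.holds, ordT]
theorem decides_ltY (W : ℕ) (ρ : ℕ → ℕ → ℝ) : Decides W ρ ltY (ordY ρ) := by
  rintro s rfl e f; exact Iff.rfl

/-! ## Stacks that are never shortened -/

/-- The stack lists the set `P` in the order `r`. -/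
def listInv (r : ℕ → ℕ → Prop) : StackInv := fun P f c rk =>
  (∀ x < c, f x ∈ P) ∧ (∀ x y, x < y → y < c → ¬ r (f y) (f x)) ∧ ∀ b ∈ P, rk b < c ∧ f (rk b) = b

theorem listInv_local (r : ℕ → ℕ → Prop) : (listInv r).Local := by
  rintro P f f' c rk rk' hf hrk ⟨h1, h2, h3⟩
  refine ⟨fun x hx => hf x hx ▸ h1 x hx, fun x y hxy hy => ?_, fun b hb => ?_⟩
  · rw [hf x (hxy.trans hy), hf y hy]; exact h2 x y hxy hy
  · rw [hrk b hb]; exact ⟨(h3 b hb).1, (hf _ (h3 b hb).1).trans (h3 b hb).2⟩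

/-- Points arrive in the order `r`, so pushing on top keeps the list sorted and nothing has to be
removed. -/
theorem popSpec_skip (W o n : ℕ) (r : ℕ → ℕ → Prop) (ρ : ℕ → ℕ → ℝ) :
    PopSpec W o n r (listInv r) ρ .skip 1 := by
  rintro s P κ bb cnt rk - - - - hc - - - hbb - hord ⟨h1, h2, h3⟩
  refine ⟨cnt, le_rfl, (Runs.straight (c := .skip) trivial hc).mono (by simp [Program.bound])
    fun _ h => h, fun f' r' hf hfb hr hrb => ⟨?_, ?_, ?_⟩⟩
  · intro x hx
    rcases Nat.lt_succ_iff_lt_or_eq.mp hx with hx | rfl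
    · rw [hf x hx]; exact Finset.mem_insert_of_mem (h1 x hx)
    · rw [hfb]; exact Finset.mem_insert_self _ _
  · intro x y hxy hy
    rw [hf x (by omega)]
    rcases Nat.lt_succ_iff_lt_or_eq.mp hy with hy | rfl
    · rw [hf y hy]; exact h2 x y hxy hy
    · rw [hfb]; exact hord _ (h1 x hxy)
  · intro b hb
    rcases Finset.mem_insert.mp hb with rfl | hb
    · rw [hrb]; exact ⟨Nat.lt_succ_self _, hfb⟩
    · rw [hr b hb]
      exact ⟨(h3 b hb).1.trans (Nat.lt_succ_self _), (hf _ (h3 b hb).1).trans (h3 b hb).2⟩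

/-! ## Envelopes -/

/-- The front of the unit disc around the point with index `b`. -/
noncomputable def frontOf (ρ : ℕ → ℕ → ℝ) (b : ℕ) (y : ℝ) : ℝ := front (ρ 1 b) (ρ 2 b) y

/-- The stack is the lower envelope of the fronts of the points in `P`, from bottom to top. -/
def envInv (ρ : ℕ → ℕ → ℝ) : StackInv := fun P f c _ =>
  (∀ x < c, f x ∈ P) ∧ (∀ x, x + 1 < c → ρ 2 (f x) < ρ 2 (f (x + 1))) ∧
  (∀ x, x + 2 < c → ∀ y, frontOf ρ (f x) y ≤ frontOf ρ (f (x + 1)) y →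
    frontOf ρ (f (x + 1)) y ≤ frontOf ρ (f (x + 2)) y) ∧
  ∀ b ∈ P, ∀ y, ∃ x < c, frontOf ρ (f x) y ≤ frontOf ρ b y

theorem envInv_local (ρ : ℕ → ℕ → ℝ) : (envInv ρ).Local := by
  rintro P f f' c rk rk' hf - ⟨h1, h2, h3, h4⟩
  refine ⟨fun x hx => hf x hx ▸ h1 x hx, fun x hx => ?_, fun x hx y => ?_, fun b hb y => ?_⟩
  · rw [hf x (by omega), hf (x + 1) hx]; exact h2 x hx
  · rw [hf x (by omega), hf (x + 1) (by omega), hf (x + 2) hx]; exact h3 x hx y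
  · obtain ⟨x, hx, hxy⟩ := h4 b hb y
    exact ⟨x, hx, by rwa [hf x hx]⟩

def redundantOf (ρ : ℕ → ℕ → ℝ) (a b c : ℕ) : Prop :=
  redundant (ρ 1 a) (ρ 2 a) (ρ 1 b) (ρ 2 b) (ρ 1 c) (ρ 2 c)

/-- The topmost of the `c` elements of the stack `f` is to be removed when `bb` is pushed. -/
def PopCond (ρ : ℕ → ℕ → ℝ) (f : ℕ → ℕ) (bb c : ℕ) : Prop :=
  0 < c ∧ (ρ 2 (f (c - 1)) = ρ 2 bb ∨ 1 < c ∧ redundantOf ρ (f (c - 2)) (f (c - 1)) bb)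

/-- Gives the height at which popping stops: the largest one at which the pop condition fails. It
exists because an empty stack is never popped. -/
theorem exists_last_not (p : ℕ → Prop) (h0 : ¬ p 0) (m : ℕ) :
    ∃ k ≤ m, ¬ p k ∧ ∀ x, k < x → x ≤ m → p x := by
  induction m with
  | zero => exact ⟨0, le_rfl, h0, fun x hx hx' => by omega⟩
  | succ m ih =>
    by_cases hp : p (m + 1)
    · obtain ⟨k, hk, hk', h⟩ := ih
      refine ⟨k, by omega, hk', fun x hx hx' => ?_⟩
      rcases Nat.le_succ_iff.mp hx' with h' | rfl
      · exact h x hx h'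
      · exact hp
    · exact ⟨m + 1, le_rfl, hp, fun x hx hx' => by omega⟩

/-! ### Pushing a point onto an envelope -/

section env

variable {ρ : ℕ → ℕ → ℝ} {n : ℕ} {P : Finset ℕ} {f r : ℕ → ℕ} {cnt bb c' : ℕ}

/-- Induction on the number of removed elements. A removed element of the same height as `bb` is not
to the left of `bb`, by the tie-breaking in `ordY`, so `bb` dominates it everywhere. Any other one
is dominated at each height by its predecessor on the stack or by `bb`, by `front_le_of_redundant`.
-/
theorem envInv_dominates (hρ : ∀ b < n, 0 < ρ 1 b) (hP : P ⊆ Finset.range n) (hbb : bb < n)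
    (hord : ∀ x ∈ P, ¬ ordY ρ bb x) (h : envInv ρ P f cnt r)
    (hpop : ∀ c, c' < c → c ≤ cnt → PopCond ρ f bb c) (m : ℕ) (hm : c' + m ≤ cnt) :
    ∀ b ∈ P, ∀ y, (∃ x < cnt - m, frontOf ρ (f x) y ≤ frontOf ρ b y) ∨
      frontOf ρ bb y ≤ frontOf ρ b y := by
  obtain ⟨h1, h2, h3, h4⟩ := h
  have hpos : ∀ x < cnt, 0 < ρ 1 (f x) := fun x hx => hρ _ (Finset.mem_range.mp (hP (h1 x hx)))
  induction m with
  | zero => exact fun b hb y => .inl (h4 b hb y)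
  | succ m ih =>
    intro b hb y
    rcases ih (by omega) b hb y with ⟨x, hx, hxy⟩ | h
    · by_cases hx' : x < cnt - (m + 1)
      · exact .inl ⟨x, hx', hxy⟩
      obtain ⟨d, hd⟩ : ∃ d, cnt - m = d + 1 := ⟨cnt - m - 1, by omega⟩
      have hxd : x = d := by omega
      subst hxd
      obtain ⟨-, hc⟩ := hpop (x + 1) (by omega) (by omega)
      have hordx := hord _ (h1 x (by omega))
      simp only [ordY, not_or, not_lt, not_and] at hordx
      rw [Nat.add_sub_cancel] at hc
      by_cases he : ρ 2 (f x) = ρ 2 bb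
      · right
        refine le_trans ?_ hxy
        unfold frontOf
        rw [he]
        exact front_mono (hρ bb hbb) (hordx.2 he.symm)
      · obtain ⟨hx1, hred⟩ := hc.resolve_left he
        obtain ⟨z, rfl⟩ : ∃ z, x = z + 1 := ⟨x - 1, by omega⟩
        have hzz : z + 1 + 1 - 2 = z := by omega
        rw [hzz] at hred
        rcases front_le_of_redundant (hpos z (by omega)) (hpos (z + 1) (by omega)) (hρ bb hbb)
          (h2 z (by omega)) (lt_of_le_of_ne hordx.1 he) hred y with h | h
        · exact .inl ⟨z, by omega, h.trans hxy⟩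
        · exact .inr (h.trans hxy)
    · exact .inr h

/-- Popping loses no minimum by `envInv_dominates`. That it stopped, `hkeep`, yields the strict
increase of heights at the new top and, by `front_le_of_not_redundant`, unimodality for the new
topmost triple. -/
theorem envInv_push (hρ : ∀ b < n, 0 < ρ 1 b) (hP : P ⊆ Finset.range n) (hbb : bb < n)
    (hord : ∀ x ∈ P, ¬ ordY ρ bb x) (h : envInv ρ P f cnt r) (hc' : c' ≤ cnt)
    (hkeep : ¬ PopCond ρ f bb c') (hpop : ∀ c, c' < c → c ≤ cnt → PopCond ρ f bb c)
    {f' r' : ℕ → ℕ} (hf : ∀ x < c', f' x = f x) (hfb : f' c' = bb) :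
    envInv ρ (insert bb P) f' (c' + 1) r' := by
  have hdom := envInv_dominates hρ hP hbb hord h hpop (cnt - c') (by omega)
  rw [show cnt - (cnt - c') = c' by omega] at hdom
  obtain ⟨h1, h2, h3, h4⟩ := h
  have hpos : ∀ x < cnt, 0 < ρ 1 (f x) := fun x hx => hρ _ (Finset.mem_range.mp (hP (h1 x hx)))
  have htop : ∀ x, x + 1 = c' → ρ 2 (f x) < ρ 2 bb := by
    rintro x rfl
    have hordx := hord _ (h1 x (by omega))
    simp only [ordY, not_or, not_lt, not_and] at hordx
    refine lt_of_le_of_ne hordx.1 fun he => hkeep ⟨Nat.succ_pos x, .inl ?_⟩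
    rwa [Nat.add_sub_cancel]
  refine ⟨?_, ?_, ?_, ?_⟩
  · intro x hx
    rcases Nat.lt_succ_iff_lt_or_eq.mp hx with hx | rfl
    · rw [hf x hx]; exact Finset.mem_insert_of_mem (h1 x (by omega))
    · rw [hfb]; exact Finset.mem_insert_self _ _
  · intro x hx
    rw [hf x (by omega)]
    rcases Nat.lt_succ_iff_lt_or_eq.mp hx with hx | hx
    · rw [hf _ hx]; exact h2 x (by omega)
    · rw [hx, hfb]; exact htop x hx
  · intro x hx y
    rw [hf x (by omega), hf (x + 1) (by omega)]
    rcases Nat.lt_succ_iff_lt_or_eq.mp hx with hx | hx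
    · rw [hf _ hx]; exact h3 x (by omega) y
    · rw [hx, hfb]
      refine front_le_of_not_redundant (hpos x (by omega)) (hpos (x + 1) (by omega)) (hρ bb hbb)
        (h2 x (by omega)) (htop (x + 1) (by omega)) fun hred => hkeep ⟨by omega, .inr ⟨by omega, ?_⟩⟩
      rwa [show c' - 2 = x by omega, show c' - 1 = x + 1 by omega]
  · intro b hb y
    rcases Finset.mem_insert.mp hb with rfl | hb
    · exact ⟨c', by omega, by rw [hfb]⟩
    · rcases hdom b hb y with ⟨x, hx, hxy⟩ | h
      · exact ⟨x, by omega, by rwa [hf x hx]⟩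
      · exact ⟨c', by omega, by rwa [hfb]⟩

end env

/-! ## The tests as programs -/

def exitTestE (e₀ e₁ q : RExpr) : Test :=
  .disj (.conj (.disj (.realEq e₁ 0) (.disj (.realLt 0 (0 - e₀ / e₁)) (.realLt 0 q)))
      (.neg (.realLt e₀ 0)))
    (.conj (.neg (.disj (.realEq e₁ 0) (.disj (.realLt 0 (0 - e₀ / e₁)) (.realLt 0 q))))
      (.disj (.realEq q 0) (.neg (.realLt 0 e₁))))

def rayTestE (u₁ v₁ u₂ v₂ c z : RExpr) : Test :=
  let e₀ := u₂ * u₂ + v₂ * v₂ - (u₁ * u₁ + v₁ * v₁) - 2 * z * (v₂ - v₁)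
  let e₁ := 2 * (u₁ - u₂) + 2 * c * (v₁ - v₂)
  let t := 0 - e₀ / e₁
  exitTestE e₀ e₁ ((t - u₁) * (t - u₁) + (z + c * t - v₁) * (z + c * t - v₁) - 1)

theorem holds_rayTestE (W : ℕ) (s : State) (u₁ v₁ u₂ v₂ c z : RExpr) :
    (rayTestE u₁ v₁ u₂ v₂ c z).holds W s ↔ rayTest (u₁.eval W s) (v₁.eval W s) (u₂.eval W s)
      (v₂.eval W s) (c.eval W s) (z.eval W s) := by
  simp only [rayTestE, exitTestE, Test.holds, RExpr.eval_add, RExpr.eval_sub, RExpr.eval_mul,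
    RExpr.eval_div, RExpr.eval_zero, RExpr.eval_one, RExpr.eval_two, rayTest, exitTest]

def redundantE (e f g : NExpr) : Test :=
  rayTestE (xE e) (yE e) (xE f) (yE f) ((xE e - xE g) / (yE g - yE e))
    ((xE g * xE g + yE g * yE g - (xE e * xE e + yE e * yE e)) / (2 * (yE g - yE e)))

theorem holds_redundantE (W : ℕ) (s : State) (e f g : NExpr) :
    (redundantE e f g).holds W s ↔
      redundantOf s.real (e.eval W s) (f.eval W s) (g.eval W s) := by
  rw [redundantE, holds_rayTestE]
  simp only [RExpr.eval_add, RExpr.eval_sub, RExpr.eval_mul, RExpr.eval_div, RExpr.eval_two,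
    eval_xE, eval_yE, redundantOf, redundant]

def popTest : Test :=
  .conj (.natLt 0 (var c)) (.disj
    (.realEq (yE (.get 123 (var K * (size + 1) + (var c - 1)))) (yE (var b)))
    (.conj (.natLt 1 (var c)) (redundantE (.get 123 (var K * (size + 1) + (var c - 2)))
      (.get 123 (var K * (size + 1) + (var c - 1))) (var b))))

/-- Removes the points that are no longer on the envelope when a point is pushed. -/
def popEnv : Program := .loop popTest (c ←ₙ var c - 1)

theorem popSpec_popEnv {W n : ℕ} {ρ : ℕ → ℕ → ℝ} (hρ : ∀ b < n, 0 < ρ 1 b) :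
    PopSpec W 20 n (ordY ρ) (envInv ρ) ρ popEnv (popTest.cost + 1 + (c ←ₙ var c - 1).bound) := by
  intro s P κ bb cnt r hreal hn hb hK hc hW hcn hbb _ hP hord hI
  have hκW : κ * (n + 1) + n + 3 < W := by
    have : (κ + 1) * (n + 1) = κ * (n + 1) + (n + 1) := by ring
    omega
  have hκ2 : κ < W := by
    have := Nat.le_mul_of_pos_right κ (Nat.succ_pos n)
    simp only [Nat.succ_eq_add_one] at this
    omega
  obtain ⟨c', hc', hkeep, hpop⟩ := exists_last_not
    (PopCond ρ (fun x => s.nat 123 (κ * (n + 1) + x)) bb) (fun h => absurd h.1 (lt_irrefl 0)) cnt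
  refine ⟨c', hc', ?_, fun f' r' hf hfb _ _ =>
    envInv_push hρ hP hbb hord hI hc' hkeep hpop hf hfb⟩
  -- Popping changes only the height register, so every test reads the stack as it was at the start.
  have htest : ∀ s' : State, ∀ k ≤ cnt, (∀ A ≠ 22, s'.nat A = s.nat A) → s'.real = s.real →
      s'.nat 22 0 = k →
      (popTest.holds W s' ↔ PopCond ρ (fun x => s.nat 123 (κ * (n + 1) + x)) bb k) := by
    intro s' k hk hfr hre hck
    simp only [Reg.b, K] at hb hK
    have e1 : s'.nat 20 0 = bb := by rw [hfr 20 (by simp), hb]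
    have e2 : s'.nat 21 0 = κ := by rw [hfr 21 (by simp), hK]
    have e3 : s'.nat 0 0 = n := by rw [hfr 0 (by simp), hn]
    have e4 : s'.nat 123 = s.nat 123 := hfr 123 (by simp)
    simp (disch := omega) [popTest, Test.holds, holds_redundantE, PopCond, e1, e2, e3, e4, hre,
      hreal, hck, Nat.mod_eq_of_lt]
  refine (Runs.loop (ι := ℕ) (i := cnt) (fun k s' => c' ≤ k ∧ k ≤ cnt ∧
    (∀ A ≠ 22, s'.nat A = s.nat A) ∧ s'.real = s.real ∧ s'.nat 22 0 = k)
    (fun k => (popTest.cost + 1 + (c ←ₙ var c - 1).bound) * (k - c')) ?_ ?_ ?_).mono ?_ fun _ h => h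
  · rintro k s' ⟨h1, h2, h3, h4, h5⟩ hb
    rw [htest s' k h2 h3 h4 h5] at hb
    have hk : c' < k := lt_of_le_of_ne h1 fun h => hkeep (h ▸ hb)
    refine ⟨_, Runs.straight (by simp) ⟨k - 1, ⟨by omega, by omega, ?_, by simp [h4], ?_⟩, ?_⟩⟩
    · intro A hA
      rw [Program.run_frame (by simp) _ (by simpa using hA), h3 A hA]
    · simp (disch := omega) [State.nat_setNat, h5, Nat.mod_eq_of_lt]
    · rw [show k - c' = (k - 1 - c') + 1 by omega, mul_add]; omega
  · rintro k s' ⟨h1, h2, h3, h4, h5⟩ hb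
    rw [htest s' k h2 h3 h4 h5] at hb
    simp only [c]
    rw [h5]
    by_contra hne
    exact hb (hpop k (by omega) h2)
  · exact ⟨hc', le_rfl, fun _ _ => rfl, rfl, hc⟩
  · rw [mul_add]; omega

end SegmentQuery

namespace RealRAM.Reg

@[simp] def lev : ℕ := 30
@[simp] def blk : ℕ := 31
@[simp] def lev' : ℕ := 32
@[simp] def blk' : ℕ := 33

end RealRAM.Reg

namespace SegmentQuery

open RealRAM RealRAM.Reg

/-! ## The preprocessing -/

/-- Key of the stack that contains the point `b` on level `lev` of the first hierarchy. -/
def keyT : NExpr := var lev * (size + 1) + .get 104 (var b) / var blk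

/-- Key of the stack that contains the point `b` on level `lev'` of the second hierarchy. -/
def keyY : NExpr :=
  ((var lev * (size + 1) + var lev') * (size + 1) + .get 104 (var b) / var blk) * (size + 1) +
    .get 114 (keyT * (size + 1) + var b) / var blk'

def innerLevel : Program :=
  distribute 20 keyY popEnv ;; lev' ←ₙ var lev' + 1 ;; blk' ←ₙ 2 * var blk'

def innerLevels : Program :=
  (lev' ←ₙ 0 ;; blk' ←ₙ 1) ;; .loop (.neg (.natLt size (var blk'))) innerLevel

def outerLevel : Program :=
  distribute 10 keyT .skip ;; innerLevels ;; lev ←ₙ var lev + 1 ;; blk ←ₙ 2 * var blk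

def outerLevels : Program :=
  (lev ←ₙ 0 ;; blk ←ₙ 1) ;; .loop (.neg (.natLt size (var blk))) outerLevel

/-- The distribution with constant key `0` puts all points on one stack in the order by `slopeS`;
its array of positions inverts the sorted list and supplies the ranks from which block numbers are
computed. -/
def preprocess : Program :=
  sort ltS 0 ;; sort ltT 10 ;; sort ltY 20 ;; distribute 0 0 .skip ;; outerLevels

/-- Position of the point `b` in the order by `slopeS`. -/
def posS (s : State) (b : ℕ) : ℕ := s.nat 104 b

def kfT (n : ℕ) (s : State) (ℓ b : ℕ) : ℕ := ℓ * (n + 1) + posS s b / 2 ^ ℓ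

/-- Position of the point `b` in its block on level `ℓ` of the first hierarchy. -/
def posT (n : ℕ) (s : State) (ℓ b : ℕ) : ℕ := s.nat 114 (kfT n s ℓ b * (n + 1) + b)

def kfY (n : ℕ) (s : State) (ℓ j b : ℕ) : ℕ :=
  ((ℓ * (n + 1) + j) * (n + 1) + posS s b / 2 ^ ℓ) * (n + 1) + posT n s ℓ b / 2 ^ j

-- The contents of row `κ` when the levels below `ℓ` are built. A key determines its level, so at
-- most one `ℓ'` contributes.
open Classical in
noncomputable def setT (n : ℕ) (s : State) (ℓ κ : ℕ) : Finset ℕ :=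
  (Finset.range n).filter fun b => ∃ ℓ' < ℓ, kfT n s ℓ' b = κ

-- Pairs of levels are processed lexicographically. The condition `2 ^ j' ≤ n` keeps `j'` a digit to
-- base `n + 1`, so that different pairs of levels never share a key.
open Classical in
noncomputable def setY (n : ℕ) (s : State) (ℓ j κ : ℕ) : Finset ℕ :=
  (Finset.range n).filter fun b => ∃ ℓ' j', 2 ^ j' ≤ n ∧ (ℓ' < ℓ ∨ ℓ' = ℓ ∧ j' < j) ∧
    kfY n s ℓ' j' b = κ

section keys

variable {n : ℕ} {s s' : State}

theorem kfT_congr (h : s'.nat 104 = s.nat 104) (ℓ b : ℕ) : kfT n s' ℓ b = kfT n s ℓ b := by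
  simp only [kfT, posS, h]

theorem setT_congr (h : s'.nat 104 = s.nat 104) (ℓ κ : ℕ) : setT n s' ℓ κ = setT n s ℓ κ := by
  simp only [setT, kfT_congr h]

theorem kfY_congr {ℓ b : ℕ} (h : s'.nat 104 = s.nat 104) (h' : posT n s' ℓ b = posT n s ℓ b)
    (j : ℕ) : kfY n s' ℓ j b = kfY n s ℓ j b := by
  simp only [kfY, posS, h, h']

theorem div_two_pow_le {a n : ℕ} (h : a ≤ n) (k : ℕ) : a / 2 ^ k ≤ n := (Nat.div_le_self _ _).trans h

theorem kfT_inj {ℓ ℓ' b b' : ℕ} (hb : posS s b ≤ n) (hb' : posS s b' ≤ n)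
    (h : kfT n s ℓ b = kfT n s ℓ' b') : ℓ = ℓ' :=
  (addr_inj h (div_two_pow_le hb _) (div_two_pow_le hb' _)).1

theorem kfY_inj {ℓ ℓ' j j' k k' m m' : ℕ} (hj : j ≤ n) (hj' : j' ≤ n) (hk : k ≤ n) (hk' : k' ≤ n)
    (hm : m ≤ n) (hm' : m' ≤ n)
    (h : ((ℓ * (n + 1) + j) * (n + 1) + k) * (n + 1) + m =
      ((ℓ' * (n + 1) + j') * (n + 1) + k') * (n + 1) + m') :
    ℓ = ℓ' ∧ j = j' ∧ k = k' ∧ m = m' := by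
  obtain ⟨h, h4⟩ := addr_inj h hm hm'
  obtain ⟨h, h3⟩ := addr_inj h hk hk'
  obtain ⟨h, h2⟩ := addr_inj h hj hj'
  exact ⟨h, h2, h3, h4⟩

end keys

theorem lt_of_two_pow_le {k n : ℕ} (h : 2 ^ k ≤ n) : k < n := Nat.lt_two_pow_self.trans_le h

/-- A key has four digits to base `n + 1` and a cell in its row adds a fifth, so a word bound of `(n
+ 2) ^ 6` leaves room for all addresses. -/
theorem keyY_bound {n W ℓ j k m : ℕ} (hW : (n + 2) ^ 6 ≤ W) (hℓ : ℓ ≤ n) (hj : j ≤ n) (hk : k ≤ n)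
    (hm : m ≤ n) : (((ℓ * (n + 1) + j) * (n + 1) + k) * (n + 1) + m + 1) * (n + 1) + 2 < W := by
  refine lt_of_lt_of_le ?_ hW
  have h1 : ℓ * (n + 1) + j + 1 ≤ (n + 1) * (n + 1) := by
    have := Nat.mul_le_mul_right (n + 1) hℓ; linarith
  have h2 : (ℓ * (n + 1) + j) * (n + 1) + k + 1 ≤ (n + 1) ^ 3 := by
    have := Nat.mul_le_mul_right (n + 1) h1
    calc _ ≤ (ℓ * (n + 1) + j + 1) * (n + 1) := by linarith
      _ ≤ _ := this
      _ = _ := by ring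
  have h3 : ((ℓ * (n + 1) + j) * (n + 1) + k) * (n + 1) + m + 1 ≤ (n + 1) ^ 4 := by
    have := Nat.mul_le_mul_right (n + 1) h2
    calc _ ≤ ((ℓ * (n + 1) + j) * (n + 1) + k + 1) * (n + 1) := by linarith
      _ ≤ _ := this
      _ = _ := by ring
  have h4 := Nat.mul_le_mul_right (n + 1) h3
  have h5 : (n + 1) ^ 4 * (n + 1) + 2 < (n + 2) ^ 6 := by
    have e : (n + 2) ^ 6 = (n + 1) ^ 4 * (n + 1) + 2 + (n ^ 6 + 11 * n ^ 5 + 55 * n ^ 4 +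
      150 * n ^ 3 + 230 * n ^ 2 + 187 * n + 61) := by ring
    omega
  omega

theorem keyT_bound {n W ℓ k : ℕ} (hW : (n + 2) ^ 6 ≤ W) (hℓ : ℓ ≤ n) (hk : k ≤ n) :
    (ℓ * (n + 1) + k + 1) * (n + 1) + 2 < W := by
  have := keyY_bound (W := W) (ℓ := 0) (j := 0) hW (Nat.zero_le n) (Nat.zero_le n) hℓ hk
  have e : ((0 * (n + 1) + 0) * (n + 1) + ℓ) * (n + 1) + k = ℓ * (n + 1) + k := by ring
  rwa [e] at this

theorem eval_keyT {W n ℓ : ℕ} {s : State} (hW : (n + 2) ^ 6 ≤ W) (hn : s.nat 0 0 = n)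
    (hℓ : s.nat lev 0 = ℓ) (hblk : s.nat blk 0 = 2 ^ ℓ) (hℓn : 2 ^ ℓ ≤ n)
    (hpos : posS s (s.nat b 0) ≤ n) : keyT.eval W s = kfT n s ℓ (s.nat b 0) := by
  have hq := div_two_pow_le hpos ℓ
  have hbd := keyT_bound hW (lt_of_two_pow_le hℓn).le hq
  have hn2 : n + 1 < W := by have := keyT_bound hW (Nat.zero_le n) (Nat.zero_le n); omega
  simp only [lev, blk, b] at hℓ hblk hq hpos hbd
  have e1 : (ℓ * (n + 1) + posS s (s.nat 20 0) / 2 ^ ℓ) ≤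
      (ℓ * (n + 1) + posS s (s.nat 20 0) / 2 ^ ℓ) * (n + 1) := Nat.le_mul_of_pos_right _ n.succ_pos
  have e2 : (ℓ * (n + 1) + posS s (s.nat 20 0) / 2 ^ ℓ + 1) * (n + 1) =
    (ℓ * (n + 1) + posS s (s.nat 20 0) / 2 ^ ℓ) * (n + 1) + (n + 1) := by ring
  simp only [posS] at *
  simp (disch := omega) [keyT, kfT, posS, hn, hℓ, hblk, Nat.mod_eq_of_lt]

theorem eval_keyY {W n ℓ j : ℕ} {s : State} (hW : (n + 2) ^ 6 ≤ W) (hn : s.nat 0 0 = n)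
    (hℓ : s.nat lev 0 = ℓ) (hblk : s.nat blk 0 = 2 ^ ℓ) (hℓn : 2 ^ ℓ ≤ n)
    (hj : s.nat lev' 0 = j) (hblk' : s.nat blk' 0 = 2 ^ j) (hjn : 2 ^ j ≤ n)
    (hb : s.nat b 0 < n) (hpos : posS s (s.nat b 0) ≤ n) (hpos' : posT n s ℓ (s.nat b 0) ≤ n) :
    keyY.eval W s = kfY n s ℓ j (s.nat b 0) := by
  have hT := eval_keyT hW hn hℓ hblk hℓn hpos
  have hq := div_two_pow_le hpos ℓ
  have hq' := div_two_pow_le hpos' j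
  have hbd := keyY_bound hW (lt_of_two_pow_le hℓn).le (lt_of_two_pow_le hjn).le hq hq'
  have hbdT := keyT_bound hW (lt_of_two_pow_le hℓn).le hq
  have hn2 : n + 1 < W := by have := keyT_bound hW (Nat.zero_le n) (Nat.zero_le n); omega
  simp only [lev, blk, lev', blk', b] at *
  have e0 : kfT n s ℓ (s.nat 20 0) * (n + 1) + s.nat 20 0 < W := by
    have : (kfT n s ℓ (s.nat 20 0) + 1) * (n + 1) =
      kfT n s ℓ (s.nat 20 0) * (n + 1) + (n + 1) := by ring
    have h2 : (kfT n s ℓ (s.nat 20 0) + 1) * (n + 1) + 2 < W := hbdT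
    omega
  have eT : (NExpr.get 114 (keyT * (size + 1) + var 20)).eval W s = posT n s ℓ (s.nat 20 0) := by
    have : kfT n s ℓ (s.nat 20 0) * (n + 1) < W := by omega
    simp (disch := omega) [hT, hn, posT, Nat.mod_eq_of_lt]
  obtain ⟨q, hqe⟩ : ∃ q, q = posS s (s.nat 20 0) / 2 ^ ℓ := ⟨_, rfl⟩
  obtain ⟨q', hqe'⟩ : ∃ q', q' = posT n s ℓ (s.nat 20 0) / 2 ^ j := ⟨_, rfl⟩
  rw [← hqe, ← hqe'] at hbd
  -- Naming the partial products of the key makes every overflow condition linear; all of them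
  -- follow from `hbd`.
  obtain ⟨a, ha⟩ : ∃ a, a = ℓ * (n + 1) := ⟨_, rfl⟩
  obtain ⟨a2, ha2⟩ : ∃ x, x = (a + j) * (n + 1) := ⟨_, rfl⟩
  obtain ⟨a3, ha3⟩ : ∃ x, x = (a2 + q) * (n + 1) := ⟨_, rfl⟩
  rw [← ha, ← ha2, ← ha3] at hbd
  have l3 : a3 + q' + 1 ≤ (a3 + q' + 1) * (n + 1) := Nat.le_mul_of_pos_right _ n.succ_pos
  have l2 : a2 + q ≤ a3 := ha3 ▸ Nat.le_mul_of_pos_right _ n.succ_pos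
  have l1 : a + j ≤ a2 := ha2 ▸ Nat.le_mul_of_pos_right _ n.succ_pos
  have hS : s.nat 104 (s.nat 20 0) / 2 ^ ℓ = q := hqe.symm
  rw [keyY, NExpr.eval_add, NExpr.eval_div]
  simp only [eval_var, b, blk', eT]
  rw [kfY, ← hqe, ← ha, ← ha2, ← ha3, hblk', ← hqe']
  simp (disch := omega) [hn, hℓ, hblk, hj, hS, Nat.mod_eq_of_lt, ← ha, ← ha2, ← ha3]

end SegmentQuery

namespace RealRAM

theorem Sorted.congr {r : ℕ → ℕ → Prop} {o n : ℕ} {s s' : State} (h : Sorted r o n s)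
    (h0 : s'.nat (o + 100) = s.nat (o + 100)) (h1 : s'.nat (o + 101) = s.nat (o + 101)) :
    Sorted r o n s' := by
  obtain ⟨a, b, c⟩ := h
  exact ⟨by rwa [h1], by rwa [h0, h1], by rwa [h0, h1]⟩

theorem Table.empty {o n : ℕ} {I : StackInv} {s : State} (hI : ∀ f r, I ∅ f 0 r)
    (h : ∀ x, s.nat (o + 102) x = 0) : Table o n I (fun _ => ∅) s := by
  intro κ
  rw [h]
  exact ⟨hI _ _, by simp, by simp⟩

theorem mods_distribute (o : ℕ) (key : NExpr) (pop : Program) :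
    (distribute o key pop).mods = Reg.i :: ([Reg.b, Reg.K, Reg.c] ++ (pop.mods ++
      [o + 103, o + 104, o + 102, Reg.i])) := rfl

theorem realFree_distribute (o : ℕ) (key : NExpr) {pop : Program} (h : pop.RealFree) :
    (distribute o key pop).RealFree := by
  simpa [distribute, distInit, distPush, Program.RealFree] using h

theorem mods_sort (lt : NExpr → NExpr → Test) (o : ℕ) :
    ∀ A ∈ (sort lt o).mods, A = o + 100 ∨ A = o + 101 ∨ (10 ≤ A ∧ A ≤ 16) := by
  intro A hA
  simp [sort, mergePass, mergeBlock, mergeInit, mergeLoop, Program.mods] at hA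
  omega

theorem realFree_sort (lt : NExpr → NExpr → Test) (o : ℕ) : (sort lt o).RealFree := by
  simp [sort, mergePass, mergeBlock, mergeInit, mergeLoop, mergeStep, Program.RealFree]

end RealRAM

/-! ### Adding one level to a hierarchy -/

namespace SegmentQuery

open RealRAM RealRAM.Reg

variable {W n : ℕ} {ρ : ℕ → ℕ → ℝ}

/-- The situation after the points have been sorted in all three ways. -/
structure Base (n : ℕ) (ρ : ℕ → ℕ → ℝ) (s : State) : Prop where
  size : s.nat 0 0 = n
  real : s.real = ρ
  sortedT : Sorted (ordT ρ) 10 n s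
  sortedY : Sorted (ordY ρ) 20 n s
  top : Table 0 n (listInv (ordS ρ)) (fun κ => (Finset.range n).filter fun _ => 0 = κ) s

theorem Base.congr {s s' : State} (h : Base n ρ s) (hr : s'.real = s.real)
    (hf : ∀ A ∈ [0, 110, 111, 120, 121, 102, 103, 104], s'.nat A = s.nat A) : Base n ρ s' where
  size := by rw [hf 0 (by simp), h.size]
  real := hr.trans h.real
  sortedT := h.sortedT.congr (hf _ (by simp)) (hf _ (by simp))
  sortedY := h.sortedY.congr (hf _ (by simp)) (hf _ (by simp))
  top := h.top.congr (fun _ => rfl) (hf _ (by simp)) (hf _ (by simp)) (hf _ (by simp))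

theorem Base.topList {s : State} (h : Base n ρ s) :
    listInv (ordS ρ) (Finset.range n) (s.nat 103) (s.nat 102 0) (s.nat 104) ∧ s.nat 102 0 ≤ n := by
  have := h.top 0
  refine ⟨?_, h.top.count_le 0⟩
  simpa using this.1

theorem Base.posS_lt {s : State} (h : Base n ρ s) {x : ℕ} (hx : x < n) :
    posS s x < s.nat 102 0 := (h.topList.1.2.2 x (by simpa using hx)).1

theorem Base.posS_le {s : State} (h : Base n ρ s) {x : ℕ} (hx : x < n) : posS s x ≤ n :=
  (h.posS_lt hx).le.trans h.topList.2

theorem posT_le {s : State} {L ℓ x : ℕ} (hT : Table 10 n (listInv (ordT ρ)) (setT n s L) s)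
    (hℓ : ℓ < L) (hx : x < n) : posT n s ℓ x ≤ n := by
  obtain ⟨⟨-, -, h⟩, -, -⟩ := hT (kfT n s ℓ x)
  exact (h x (by simp only [setT, Finset.mem_filter, Finset.mem_range]
                 exact ⟨hx, ℓ, hℓ, rfl⟩)).1.le.trans (hT.count_le _)

theorem setY_congr {s s' : State} {ℓ j : ℕ}
    (h : ∀ x < n, ∀ ℓ' j', ℓ' < ℓ ∨ ℓ' = ℓ ∧ j' < j → kfY n s' ℓ' j' x = kfY n s ℓ' j' x) (κ : ℕ) :
    setY n s' ℓ j κ = setY n s ℓ j κ := by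
  ext x
  simp only [setY, Finset.mem_filter, Finset.mem_range]
  refine and_congr_right fun hx => exists_congr fun ℓ' => exists_congr fun j' =>
    and_congr_right fun _ => and_congr_right fun h2 => ?_
  rw [h x hx ℓ' j' h2]

/-- The tables of the first hierarchy are built below level `L`, those of the second hierarchy
below level `(ℓ, j)`. -/
structure Levels (n : ℕ) (ρ : ℕ → ℕ → ℝ) (L ℓ j : ℕ) (s : State) : Prop extends Base n ρ s where
  tableT : Table 10 n (listInv (ordT ρ)) (setT n s L) s
  tableY : Table 20 n (envInv ρ) (setY n s ℓ j) s
  lev_eq : s.nat lev 0 = ℓ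
  blk_eq : s.nat blk 0 = 2 ^ ℓ

theorem Levels.congr {s s' : State} {L ℓ j : ℕ} (h : Levels n ρ L ℓ j s) (hr : s'.real = s.real)
    (hf : ∀ A ∉ [lev', blk'], s'.nat A = s.nat A) : Levels n ρ L ℓ j s' where
  toBase := h.toBase.congr hr fun A hA => hf A (by simp at hA ⊢; omega)
  tableT := h.tableT.congr (setT_congr (hf _ (by simp)) _) (hf _ (by simp)) (hf _ (by simp))
    (hf _ (by simp))
  tableY := h.tableY.congr (setY_congr fun x _ ℓ' j' _ => by
    simp only [kfY, posT, kfT, posS, hf 104 (by simp), hf 114 (by simp)]) (hf _ (by simp))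
    (hf _ (by simp)) (hf _ (by simp))
  lev_eq := by rw [hf _ (by simp), h.lev_eq]
  blk_eq := by rw [hf _ (by simp), h.blk_eq]

theorem realFree_popEnv : popEnv.RealFree := by simp [popEnv, Program.RealFree]

/-- The time constant of `popEnv`. -/
def popTime : ℕ := popTest.cost + 1 + (c ←ₙ var c - 1).bound

/-- Pushing all points in the order `ordY`, each to the stack of its subblock, builds all envelopes
of this pair of levels simultaneously. The rows are fresh by `kfY_inj`. -/
theorem innerDist_spec {s : State} {L ℓ j : ℕ} (hW : (n + 2) ^ 6 ≤ W) (hρ : ∀ b < n, 0 < ρ 1 b)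
    (h : Levels n ρ L ℓ j s) (hL : ℓ < L) (hj : s.nat lev' 0 = j) (hblk' : s.nat blk' 0 = 2 ^ j)
    (hℓn : 2 ^ ℓ ≤ n) (hjn : 2 ^ j ≤ n) :
    Runs W (distribute 20 keyY popEnv) s (distTime 20 keyY popTime * (n + 1)) fun s' =>
      Levels n ρ L ℓ (j + 1) s' ∧ s'.nat lev' 0 = j ∧ s'.nat blk' 0 = 2 ^ j := by
  have hposS : ∀ x < n, posS s x ≤ n := fun x hx => h.posS_le hx
  have hposT : ∀ ℓ' ≤ ℓ, ∀ x < n, posT n s ℓ' x ≤ n :=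
    fun ℓ' hℓ' x hx => posT_le h.tableT (hℓ'.trans_lt hL) hx
  have hn4 : n * n + 4 * n + 4 < W := by
    have := keyT_bound hW le_rfl le_rfl
    nlinarith [Nat.zero_le (n ^ 3)]
  have hspec := distribute_spec (W := W) (o := 20) (n := n) (ord := ordY ρ) (I := envInv ρ)
    (pop := popEnv) (tp := popTime) (s := s) (key := keyY) (kf := kfY n s ℓ j)
    (P₀ := setY n s ℓ j) (envInv_local ρ) (by rw [h.real]; exact popSpec_popEnv hρ)
    (by simp [popEnv, Program.mods]) realFree_popEnv h.size hn4 h.sortedY ?_ ?_ h.tableY ?_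
  · refine (hspec.frame (realFree_distribute _ _ realFree_popEnv)).mono le_rfl ?_
    rintro s' ⟨⟨hT, -⟩, hf, hr⟩
    replace hf : ∀ A ∉ [10, 20, 21, 22, 123, 124, 122], s'.nat A = s.nat A := by
      intro A hA
      refine hf A ?_
      rw [mods_distribute]
      simp [popEnv, Program.mods] at hA ⊢
      tauto
    refine ⟨⟨?_, ?_, ?_, ?_, ?_⟩, ?_, ?_⟩
    · exact h.toBase.congr hr fun A hA => hf A (by simp at hA ⊢; omega)
    · exact h.tableT.congr (setT_congr (hf _ (by simp)) _) (hf _ (by simp)) (hf _ (by simp))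
        (hf _ (by simp))
    · refine hT.congr (fun κ => ?_) rfl rfl rfl
      ext x
      have e : ∀ ℓ' j', kfY n s' ℓ' j' x = kfY n s ℓ' j' x := by
        intro ℓ' j'
        simp only [kfY, posT, kfT, posS, hf 104 (by simp), hf 114 (by simp)]
      simp only [setY, Finset.mem_union, Finset.mem_filter, Finset.mem_range, e]
      constructor
      · rintro ⟨hx, ℓ', j', h1, h2 | ⟨rfl, h2⟩, h3⟩
        · exact .inl ⟨hx, ℓ', j', h1, .inl h2, h3⟩
        · rcases Nat.lt_succ_iff_lt_or_eq.mp h2 with h2 | rfl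
          · exact .inl ⟨hx, ℓ', j', h1, .inr ⟨rfl, h2⟩, h3⟩
          · exact .inr ⟨hx, h3⟩
      · rintro (⟨hx, ℓ', j', h1, h2, h3⟩ | ⟨hx, h3⟩)
        · exact ⟨hx, ℓ', j', h1, h2.imp_right fun h2 => ⟨h2.1, by omega⟩, h3⟩
        · exact ⟨hx, ℓ, j, hjn, .inr ⟨rfl, by omega⟩, h3⟩
    · rw [hf _ (by simp), h.lev_eq]
    · rw [hf _ (by simp), h.blk_eq]
    · rw [hf _ (by simp), hj]
    · rw [hf _ (by simp), hblk']
  · intro s' hf hbn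
    have h104 : s'.nat 104 = s.nat 104 := hf _ (by simp)
    have h114 : s'.nat 114 = s.nat 114 := hf _ (by simp)
    have hTc : ∀ x, posT n s' ℓ x = posT n s ℓ x := by
      intro x; simp only [posT, kfT, posS, h104, h114]
    rw [eval_keyY (ℓ := ℓ) (j := j) hW (by rw [hf _ (by simp), h.size])
      (by rw [hf _ (by simp), h.lev_eq]) (by rw [hf _ (by simp), h.blk_eq]) hℓn
      (by rw [hf _ (by simp), hj]) (by rw [hf _ (by simp), hblk']) hjn hbn
      (by rw [posS, h104]; exact hposS _ hbn) (by rw [hTc]; exact hposT ℓ le_rfl _ hbn)]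
    exact kfY_congr h104 (hTc _) j
  · intro x hx
    exact keyY_bound hW (lt_of_two_pow_le hℓn).le (lt_of_two_pow_le hjn).le
      (div_two_pow_le (hposS x hx) _) (div_two_pow_le (hposT ℓ le_rfl x hx) _)
  · intro x hx
    simp only [setY, Finset.filter_eq_empty_iff, Finset.mem_range]
    rintro y hy ⟨ℓ', j', h1, h2, h3⟩
    have hℓ' : ℓ' ≤ ℓ := by omega
    obtain ⟨e1, e2, -, -⟩ := kfY_inj (lt_of_two_pow_le h1).le (lt_of_two_pow_le hjn).le
      (div_two_pow_le (hposS y hy) _) (div_two_pow_le (hposS x hx) _)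
      (div_two_pow_le (hposT ℓ' hℓ' y hy) _) (div_two_pow_le (hposT ℓ le_rfl x hx) _) h3
    omega

/-- Distributing the points in the order `ordT` sorts every block of the level by `slopeT` in linear
time. The rows are fresh by `kfT_inj`. -/
theorem outerDist_spec {s : State} {ℓ : ℕ} (hW : (n + 2) ^ 6 ≤ W)
    (h : Levels n ρ ℓ ℓ 0 s) (hℓn : 2 ^ ℓ ≤ n) :
    Runs W (distribute 10 keyT .skip) s (distTime 10 keyT 1 * (n + 1))
      (Levels n ρ (ℓ + 1) ℓ 0) := by
  have hposS : ∀ x < n, posS s x ≤ n := fun x hx => h.posS_le hx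
  have hn4 : n * n + 4 * n + 4 < W := by
    have := keyT_bound hW le_rfl le_rfl
    nlinarith [Nat.zero_le (n ^ 3)]
  have hspec := distribute_spec (W := W) (o := 10) (n := n) (ord := ordT ρ) (I := listInv (ordT ρ))
    (pop := .skip) (tp := 1) (s := s) (key := keyT) (kf := kfT n s ℓ)
    (P₀ := setT n s ℓ) (listInv_local _) (popSpec_skip _ _ _ _ _)
    (by simp [Program.mods]) trivial h.size hn4 h.sortedT ?_ ?_ h.tableT ?_
  · refine (hspec.frame (realFree_distribute _ _ trivial)).mono le_rfl ?_
    rintro s' ⟨⟨hT, hR⟩, hf, hr⟩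
    replace hf : ∀ A ∉ [10, 20, 21, 22, 113, 114, 112], s'.nat A = s.nat A := by
      intro A hA
      refine hf A ?_
      rw [mods_distribute]
      simp [Program.mods] at hA ⊢
      tauto
    have h104 : s'.nat 104 = s.nat 104 := hf _ (by simp)
    refine ⟨?_, ?_, ?_, ?_, ?_⟩
    · exact h.toBase.congr hr fun A hA => hf A (by simp at hA ⊢; omega)
    · refine hT.congr (fun κ => ?_) rfl rfl rfl
      rw [setT_congr h104]
      ext x
      simp only [setT, Finset.mem_union, Finset.mem_filter, Finset.mem_range]
      constructor
      · rintro ⟨hx, ℓ', h1, h2⟩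
        rcases Nat.lt_succ_iff_lt_or_eq.mp h1 with h1 | rfl
        · exact .inl ⟨hx, ℓ', h1, h2⟩
        · exact .inr ⟨hx, h2⟩
      · rintro (⟨hx, ℓ', h1, h2⟩ | ⟨hx, h2⟩)
        · exact ⟨hx, ℓ', by omega, h2⟩
        · exact ⟨hx, ℓ, by omega, h2⟩
    · refine h.tableY.congr (setY_congr fun x hx ℓ' j' h2 => ?_) (hf _ (by simp)) (hf _ (by simp))
        (hf _ (by simp))
      -- Keys of the second hierarchy read positions from array `114`, which was just written; those
      -- of earlier levels lie in rows that this level does not use.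
      refine kfY_congr h104 ?_ j'
      rw [posT, posT, kfT_congr h104]
      refine hR _ (fun y hy hyx => ?_) x hx.le
      have := kfT_inj (hposS y hy) (hposS x hx) hyx
      omega
    · rw [hf _ (by simp), h.lev_eq]
    · rw [hf _ (by simp), h.blk_eq]
  · intro s' hf hbn
    have h104 : s'.nat 104 = s.nat 104 := hf _ (by simp)
    rw [eval_keyT (ℓ := ℓ) hW (by rw [hf _ (by simp), h.size])
      (by rw [hf _ (by simp), h.lev_eq]) (by rw [hf _ (by simp), h.blk_eq]) hℓn
      (by rw [posS, h104]; exact hposS _ hbn)]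
    exact kfT_congr h104 ℓ _
  · intro x hx
    exact keyT_bound hW (lt_of_two_pow_le hℓn).le (div_two_pow_le (hposS x hx) _)
  · intro x hx
    simp only [setT, Finset.filter_eq_empty_iff, Finset.mem_range]
    rintro y hy ⟨ℓ', h1, h2⟩
    have := kfT_inj (hposS y hy) (hposS x hx) h2
    omega

end SegmentQuery

/-! ### All levels of both hierarchies, with running times -/

namespace SegmentQuery

open RealRAM RealRAM.Reg

variable {W n : ℕ} {ρ : ℕ → ℕ → ℝ}

theorem lt_of_pow_six {k : ℕ} (hW : (n + 2) ^ 6 ≤ W) (hk : k ≤ n) : 2 * k + 2 < W := by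
  refine lt_of_lt_of_le ?_ hW
  have : (n + 2) ^ 6 = (n + 2) * (n + 2) ^ 5 := by ring
  have h2 : 2 ^ 5 ≤ (n + 2) ^ 5 := Nat.pow_le_pow_left (by omega) 5
  nlinarith

/-- The bound for the running time of `innerLevels`, up to the factor `(n + 1) * (log n + 3)`. -/
def innerTime : ℕ :=
  (lev' ←ₙ 0 ;; blk' ←ₙ 1).bound + (Test.neg (.natLt size (var blk'))).cost + 1 +
    distTime 20 keyY popTime + (lev' ←ₙ var lev' + 1 ;; blk' ←ₙ 2 * var blk').bound

theorem innerLevels_spec {s : State} {ℓ : ℕ} (hW : (n + 2) ^ 6 ≤ W) (hρ : ∀ b < n, 0 < ρ 1 b)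
    (h : Levels n ρ (ℓ + 1) ℓ 0 s) (hℓn : 2 ^ ℓ ≤ n) :
    Runs W innerLevels s (innerTime * ((n + 1) * (Nat.log 2 n + 3))) fun s' =>
      ∃ j, n < 2 ^ j ∧ Levels n ρ (ℓ + 1) ℓ j s' := by
  set t := (Test.neg (.natLt size (var blk'))).cost with ht
  set u := (lev' ←ₙ var lev' + 1 ;; blk' ←ₙ 2 * var blk').bound with hu
  set D := distTime 20 keyY popTime with hD
  refine (Runs.straight_seq (by simp [Program.LoopFree]) (Runs.loop (ι := ℕ) (i := 0)
    (Q := fun s' => ∃ j, n < 2 ^ j ∧ Levels n ρ (ℓ + 1) ℓ j s')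
    (fun j s' => Levels n ρ (ℓ + 1) ℓ j s' ∧ s'.nat lev' 0 = j ∧ s'.nat blk' 0 = 2 ^ j)
    (fun j => (t + 1 + (D * (n + 1) + u)) * (Nat.log 2 n + 1 - j)) ?_ ?_ ?_)).mono ?_ fun _ h => h
  · rintro j s' ⟨h1, h2, h3⟩ hb
    have hjn : 2 ^ j ≤ n := by simpa [Test.holds, -Reg.blk', h1.size, h3] using hb
    have hjl : j ≤ Nat.log 2 n := Nat.le_log_of_pow_le (by norm_num) hjn
    have hWj := lt_of_pow_six hW hjn
    have hj2 : j + 1 < W := by have := lt_of_pow_six hW (lt_of_two_pow_le hjn).le; omega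
    refine ⟨_, Runs.seq_of (innerDist_spec hW hρ h1 (Nat.lt_succ_self _) h2 h3 hℓn hjn)
      fun s2 ⟨k1, k2, k3⟩ => Runs.straight (by simp [Program.LoopFree])
        ⟨j + 1, ⟨k1.congr ?_ ?_, ?_, ?_⟩, ?_⟩⟩
    · exact Program.run_real (by simp [Program.LoopFree]) (by simp [Program.RealFree]) _
    · intro A hA
      exact Program.run_frame (by simp [Program.LoopFree]) _ (by simpa [Program.mods] using hA)
    · simp only [Reg.lev', Reg.blk'] at k2 k3
      simp (disch := omega) [Program.run, State.nat_setNat, k2, Nat.mod_eq_of_lt]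
    · simp only [Reg.lev', Reg.blk'] at k2 k3
      simp (disch := omega) [Program.run, State.nat_setNat, k3, Nat.mod_eq_of_lt, pow_succ']
    · rw [show Nat.log 2 n + 1 - j = (Nat.log 2 n + 1 - (j + 1)) + 1 by omega,
        mul_add (t + 1 + (D * (n + 1) + u)) _ 1]
      change t + 1 + (D * (n + 1) + u) + _ ≤ _
      omega
  · rintro j s' ⟨h1, h2, h3⟩ hb
    exact ⟨j, by simpa [Test.holds, -Reg.blk', h1.size, h3] using hb, h1⟩
  · refine ⟨h.congr ?_ ?_, ?_, ?_⟩
    · exact Program.run_real (by simp [Program.LoopFree]) (by simp [Program.RealFree]) _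
    · intro A hA
      exact Program.run_frame (by simp [Program.LoopFree]) _ (by simpa [Program.mods] using hA)
    · simp [Program.run, State.nat_setNat]
    · have := lt_of_pow_six hW (Nat.zero_le n)
      simp (disch := omega) [Program.run, State.nat_setNat, Nat.mod_eq_of_lt]
  · set E := (lev' ←ₙ 0 ;; blk' ←ₙ 1).bound
    have hI : innerTime = E + t + 1 + D + u := rfl
    rw [hI, Nat.sub_zero, ← ht]
    set l := Nat.log 2 n
    have e1 : (t + 1 + (D * (n + 1) + u)) ≤ (t + 1 + D + u) * (n + 1) := by
      nlinarith [Nat.zero_le (t * n), Nat.zero_le (u * n)]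
    have e2 := Nat.mul_le_mul_right (l + 1) e1
    have e3 : (E + t + 1 + D + u) * ((n + 1) * (l + 3)) = (t + 1 + D + u) * (n + 1) * (l + 1) +
      2 * ((t + 1 + D + u) * (n + 1)) + E * ((n + 1) * (l + 3)) := by ring
    have e4 : E ≤ E * ((n + 1) * (l + 3)) := Nat.le_mul_of_pos_right _ (by positivity)
    have e5 : t + 1 ≤ 2 * ((t + 1 + D + u) * (n + 1)) := by
      have := Nat.le_mul_of_pos_right (t + 1 + D + u) n.succ_pos
      simp only [Nat.succ_eq_add_one] at this
      omega
    omega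

def outerTime : ℕ :=
  (lev ←ₙ 0 ;; blk ←ₙ 1).bound + (Test.neg (.natLt size (var blk))).cost + 1 +
    distTime 10 keyT 1 + innerTime + (lev ←ₙ var lev + 1 ;; blk ←ₙ 2 * var blk).bound

/-- All tables are built. -/
def Ready (n : ℕ) (ρ : ℕ → ℕ → ℝ) (s : State) : Prop :=
  Base n ρ s ∧ ∃ L, n < 2 ^ L ∧ Table 10 n (listInv (ordT ρ)) (setT n s L) s ∧
    Table 20 n (envInv ρ) (setY n s L 0) s

theorem outerLevels_spec {s : State} (hW : (n + 2) ^ 6 ≤ W) (hρ : ∀ b < n, 0 < ρ 1 b)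
    (h : Base n ρ s) (hz : ∀ A ∈ [112, 122], ∀ x, s.nat A x = 0) :
    Runs W outerLevels s (outerTime * ((n + 1) * (Nat.log 2 n + 3) ^ 2)) (Ready n ρ) := by
  have hW2 := lt_of_pow_six hW (Nat.zero_le n)
  set t := (Test.neg (.natLt size (var blk))).cost with ht
  set u := (lev ←ₙ var lev + 1 ;; blk ←ₙ 2 * var blk).bound with hu
  set D := distTime 10 keyT 1 with hD
  set l := Nat.log 2 n with hl
  refine (Runs.straight_seq (by simp [Program.LoopFree]) (Runs.loop (ι := ℕ) (i := 0)
    (Q := Ready n ρ) (fun ℓ s' => Levels n ρ ℓ ℓ 0 s')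
    (fun ℓ => (t + 1 + (D * (n + 1) + (innerTime * ((n + 1) * (l + 3)) + u))) * (l + 1 - ℓ))
    ?_ ?_ ?_)).mono ?_ fun _ h => h
  · rintro ℓ s' h1 hb
    have hjn : 2 ^ ℓ ≤ n := by simpa [Test.holds, -Reg.blk, h1.size, h1.blk_eq] using hb
    have hjl : ℓ ≤ l := Nat.le_log_of_pow_le (by norm_num) hjn
    have hWj := lt_of_pow_six hW hjn
    have hj2 : ℓ + 1 < W := by have := lt_of_pow_six hW (lt_of_two_pow_le hjn).le; omega
    refine ⟨_, Runs.seq_of (outerDist_spec hW h1 hjn) fun s2 k => Runs.seq_of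
      (innerLevels_spec hW hρ k hjn) fun s3 ⟨j, hnj, k3⟩ => Runs.straight
        (by simp [Program.LoopFree]) ⟨ℓ + 1, ?_, ?_⟩⟩
    · have hr : ((lev ←ₙ var lev + 1 ;; blk ←ₙ 2 * var blk).run W s3).real = s3.real :=
        Program.run_real (by simp [Program.LoopFree]) (by simp [Program.RealFree]) _
      have hf : ∀ A ∉ [30, 31], ((lev ←ₙ var lev + 1 ;; blk ←ₙ 2 * var blk).run W s3).nat A =
          s3.nat A := fun A hA =>
        Program.run_frame (by simp [Program.LoopFree]) _ (by simpa [Program.mods] using hA)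
      obtain ⟨a1, a2, a3, a4, a5⟩ := k3
      simp only [lev, blk] at a4 a5
      refine ⟨?_, ?_, ?_, ?_, ?_⟩
      · exact a1.congr hr fun A hA => hf A (by simp at hA ⊢; omega)
      · exact a2.congr (setT_congr (hf _ (by simp)) _) (hf _ (by simp)) (hf _ (by simp))
          (hf _ (by simp))
      -- Since `n < 2 ^ j`, all inner levels belonging to `ℓ` are finished, and the bound `(ℓ, j)`
      -- may be replaced by `(ℓ + 1, 0)`.
      · refine a3.congr (fun κ => ?_) (hf _ (by simp)) (hf _ (by simp)) (hf _ (by simp))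
        rw [setY_congr (s := s3) fun x _ ℓ' j' _ => by
          simp only [kfY, posT, kfT, posS, hf 104 (by simp), hf 114 (by simp)]]
        ext x
        simp only [setY, Finset.mem_filter, Finset.mem_range]
        refine and_congr_right fun hx => exists_congr fun ℓ' => exists_congr fun j' =>
          and_congr_right fun hj' => and_congr_left fun _ => ?_
        have : j' < j := (Nat.pow_lt_pow_iff_right (by norm_num)).mp (hj'.trans_lt hnj)
        omega
      · simp (disch := omega) [Program.run, State.nat_setNat, a4, Nat.mod_eq_of_lt]
      · simp (disch := omega) [Program.run, State.nat_setNat, a5, Nat.mod_eq_of_lt, pow_succ']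
    · rw [show l + 1 - ℓ = (l + 1 - (ℓ + 1)) + 1 by omega,
        mul_add (t + 1 + (D * (n + 1) + (innerTime * ((n + 1) * (l + 3)) + u))) _ 1]
      change t + 1 + (D * (n + 1) + (innerTime * ((n + 1) * (l + 3)) + u)) + _ ≤ _
      omega
  · rintro ℓ s' h1 hb
    exact ⟨h1.toBase, ℓ, by simpa [Test.holds, -Reg.blk, h1.size, h1.blk_eq] using hb,
      h1.tableT, h1.tableY⟩
  · have hf : ∀ A ∉ [30, 31], ((lev ←ₙ 0 ;; blk ←ₙ 1).run W s).nat A = s.nat A := fun A hA =>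
      Program.run_frame (by simp [Program.LoopFree]) _ (by simpa [Program.mods] using hA)
    refine ⟨h.congr ?_ fun A hA => hf A (by simp at hA ⊢; omega), ?_, ?_, ?_, ?_⟩
    · exact Program.run_real (by simp [Program.LoopFree]) (by simp [Program.RealFree]) _
    · refine (Table.empty (fun f r => ⟨by simp, by simp, by simp⟩) fun x => ?_).congr
        (fun κ => ?_) rfl rfl rfl
      · rw [hf _ (by simp)]; exact hz _ (by simp) x
      · simp [setT]
    · refine (Table.empty (fun f r => ⟨by simp, by simp, by simp, by simp⟩) fun x => ?_).congr
        (fun κ => ?_) rfl rfl rfl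
      · rw [hf _ (by simp)]; exact hz _ (by simp) x
      · simp [setY]
    · simp [Program.run, State.nat_setNat]
    · simp (disch := omega) [Program.run, State.nat_setNat, Nat.mod_eq_of_lt]
  · set E := (lev ←ₙ 0 ;; blk ←ₙ 1).bound
    have hI : outerTime = E + t + 1 + D + innerTime + u := rfl
    rw [hI, Nat.sub_zero, ← ht]
    set J := innerTime
    have hpos : 1 ≤ l + 3 := by omega
    have e1 : t + 1 + (D * (n + 1) + (J * ((n + 1) * (l + 3)) + u)) ≤
        (t + 1 + D + J + u) * ((n + 1) * (l + 3)) := by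
      have a1 : 1 ≤ (n + 1) * (l + 3) := Nat.mul_pos (by omega) (by omega)
      have a2 := Nat.mul_le_mul_left (t + 1 + u) a1
      have a3 : D * (n + 1) ≤ D * ((n + 1) * (l + 3)) :=
        Nat.mul_le_mul_left _ (Nat.le_mul_of_pos_right _ (by omega))
      calc _ ≤ (t + 1 + u) * ((n + 1) * (l + 3)) + D * ((n + 1) * (l + 3)) +
            J * ((n + 1) * (l + 3)) := by omega
        _ = _ := by ring
    have e2 := Nat.mul_le_mul_right (l + 1) e1
    have e3 : (E + t + 1 + D + J + u) * ((n + 1) * (l + 3) ^ 2) =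
      (t + 1 + D + J + u) * ((n + 1) * (l + 3)) * (l + 1) +
      2 * ((t + 1 + D + J + u) * ((n + 1) * (l + 3))) + E * ((n + 1) * (l + 3) ^ 2) := by ring
    have e4 : E ≤ E * ((n + 1) * (l + 3) ^ 2) := Nat.le_mul_of_pos_right _ (by positivity)
    have e5 : t + 1 ≤ 2 * ((t + 1 + D + J + u) * ((n + 1) * (l + 3))) := by
      have := Nat.le_mul_of_pos_right (t + 1 + D + J + u) (show 0 < (n + 1) * (l + 3) by positivity)
      omega
    omega

def preprocessTime : ℕ :=
  sortTime ltS 0 + sortTime ltT 10 + sortTime ltY 20 + distTime 0 0 1 + outerTime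

theorem sort_runs {lt : NExpr → NExpr → Test} {r : ℕ → ℕ → Prop} (o : ℕ) {s : State}
    (hlt : Decides W s.real lt r) (hr : WeakOrder r) (hn : s.nat 0 0 = n)
    (hW : n * n + 4 * n + 4 < W) :
    Runs W (sort lt o) s (sortTime lt o * ((n + 1) * (Nat.log 2 n + 3))) fun s' =>
      Sorted r o n s' ∧
      (∀ A, ¬ (A = o + 100 ∨ A = o + 101 ∨ (10 ≤ A ∧ A ≤ 16)) → s'.nat A = s.nat A) ∧
      s'.real = s.real :=
  ((sort_spec hlt hr hn hW).frame (realFree_sort _ _)).mono le_rfl fun _ h =>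
    ⟨h.1, fun A hA => h.2.1 A fun h' => hA (mods_sort _ _ A h'), h.2.2⟩

/-- The O(log² n) pairs of levels cost linear time each, because no sorting is repeated inside them.
-/
theorem preprocess_spec {s : State} (hW : (n + 2) ^ 6 ≤ W) (hρ : ∀ b < n, 0 < s.real 1 b)
    (hn : s.nat 0 0 = n) (hz : ∀ A, A ≠ 0 → ∀ x, s.nat A x = 0) :
    Runs W preprocess s (preprocessTime * ((n + 1) * (Nat.log 2 n + 3) ^ 2))
      (Ready n s.real) := by
  have hn4 : n * n + 4 * n + 4 < W := by
    have := keyT_bound hW le_rfl le_rfl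
    nlinarith [Nat.zero_le (n ^ 3)]
  obtain ⟨ρ, hρe⟩ : ∃ ρ, ρ = s.real := ⟨_, rfl⟩
  rw [← hρe] at hρ ⊢
  set l := Nat.log 2 n with hl
  have hdist : ∀ s3 : State, Sorted (ordS ρ) 0 n s3 → s3.real = ρ → s3.nat 0 0 = n →
      (∀ x, s3.nat 102 x = 0) → Runs W (distribute 0 0 .skip) s3 (distTime 0 0 1 * (n + 1))
      fun s4 => Table 0 n (listInv (ordS ρ)) (fun κ => (Finset.range n).filter fun _ => 0 = κ) s4 ∧
        (∀ A ∉ [10, 20, 21, 22, 103, 104, 102], s4.nat A = s3.nat A) ∧ s4.real = s3.real := by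
    intro s3 h3 r3 n3 z3
    refine ((distribute_spec (n := n) (kf := fun _ => 0) (P₀ := fun _ => ∅)
      (listInv_local (ordS ρ)) (popSpec_skip _ _ _ _ _) (by simp [Program.mods]) trivial n3 hn4 h3
      ?_ ?_ ?_ ?_).frame (realFree_distribute _ _ trivial)).mono le_rfl ?_
    · intro s' _ _; simp
    · intro x _
      have := keyT_bound (ℓ := 0) (k := 0) hW (Nat.zero_le n) (Nat.zero_le n)
      simpa using this
    · exact Table.empty (fun f r => ⟨by simp, by simp, by simp⟩) z3
    · intros; rfl
    · rintro s4 ⟨⟨h4, -⟩, f4, r4⟩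
      refine ⟨h4.congr (fun κ => by simp) rfl rfl rfl, fun A hA => f4 A ?_, r4⟩
      rw [mods_distribute]
      simp [Program.mods] at hA ⊢
      tauto
  refine (Runs.seq_of (T₁ := sortTime ltS 0 * ((n + 1) * (l + 3)))
    (T₂ := sortTime ltT 10 * ((n + 1) * (l + 3)) + (sortTime ltY 20 * ((n + 1) * (l + 3)) +
      (distTime 0 0 1 * (n + 1) + outerTime * ((n + 1) * (l + 3) ^ 2))))
    (sort_runs 0 (r := ordS ρ) (by rw [← hρe]; exact decides_ltS W ρ) (weakOrder_of_key _) hn hn4)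
    ?_).mono ?_ fun _ h => h
  · rintro s1 ⟨h1, f1, r1⟩
    rw [← hρe] at r1
    have n1 : s1.nat 0 0 = n := by rw [f1 _ (by simp), hn]
    refine Runs.seq_of (sort_runs 10 (r := ordT ρ) (by rw [r1]; exact decides_ltT W ρ)
      (weakOrder_of_key _) n1 hn4) ?_
    rintro s2 ⟨h2, f2, r2⟩
    rw [r1] at r2
    have n2 : s2.nat 0 0 = n := by rw [f2 _ (by simp), n1]
    refine Runs.seq_of (sort_runs 20 (r := ordY ρ) (by rw [r2]; exact decides_ltY W ρ)
      (weakOrder_ordY _) n2 hn4) ?_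
    rintro s3 ⟨h3, f3, r3⟩
    rw [r2] at r3
    have n3 : s3.nat 0 0 = n := by rw [f3 _ (by simp), n2]
    have z3 : ∀ A ∈ [102, 112, 122], ∀ x, s3.nat A x = 0 := by
      intro A hA x
      simp only [List.mem_cons, List.not_mem_nil, or_false] at hA
      rw [f3 _ (by omega), f2 _ (by omega), f1 _ (by omega), hz _ (by omega)]
    refine Runs.seq_of (hdist s3 ((h1.congr (f2 _ (by simp)) (f2 _ (by simp))).congr
      (f3 _ (by simp)) (f3 _ (by simp))) r3 n3 (z3 102 (by simp))) ?_
    rintro s4 ⟨h4, f4, r4⟩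
    refine outerLevels_spec hW hρ ⟨by rw [f4 _ (by simp), n3], by rw [r4, r3],
      (h2.congr (f3 _ (by simp)) (f3 _ (by simp))).congr (f4 _ (by simp)) (f4 _ (by simp)),
      h3.congr (f4 _ (by simp)) (f4 _ (by simp)), h4⟩ fun A hA x => ?_
    rw [f4 A (by simp at hA ⊢; omega)]
    exact z3 A (List.mem_cons_of_mem _ hA) x
  · have e1 : (n + 1) * (l + 3) ≤ (n + 1) * (l + 3) ^ 2 :=
      Nat.mul_le_mul_left _ (Nat.le_self_pow (by norm_num) _)
    have e2 : n + 1 ≤ (n + 1) * (l + 3) ^ 2 := Nat.le_mul_of_pos_right _ (by positivity)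
    calc _ ≤ sortTime ltS 0 * ((n + 1) * (l + 3) ^ 2) + (sortTime ltT 10 * ((n + 1) * (l + 3) ^ 2) +
          (sortTime ltY 20 * ((n + 1) * (l + 3) ^ 2) + (distTime 0 0 1 * ((n + 1) * (l + 3) ^ 2) +
          outerTime * ((n + 1) * (l + 3) ^ 2)))) := by gcongr
      _ = _ := by rw [preprocessTime]; ring

end SegmentQuery

namespace RealRAM

open Reg

/-! ## Binary search -/

/-- Binary search in the interval from the variable `lo` to the variable `hi` for the first index at
which `test` fails. -/
def bsearch (test : Test) : Program :=
  .loop (.natLt (var lo) (var hi))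
    (mid ←ₙ (var lo + var hi) / 2 ;; .ite test (lo ←ₙ var mid + 1) (hi ←ₙ var mid))

def bsearchTime (test : Test) : ℕ :=
  (Test.natLt (var lo) (var hi)).cost + 1 +
    (mid ←ₙ (var lo + var hi) / 2 ;; .ite test (lo ←ₙ var mid + 1) (hi ←ₙ var mid)).bound

theorem bsearch_spec {W m n : ℕ} {test : Test} {p : ℕ → Prop} {s : State} (hlo : s.nat lo 0 = 0)
    (hhi : s.nat hi 0 = m) (hmn : m ≤ n) (hW : 2 * n + 2 < W)
    (htest : ∀ s' : State, (∀ A ∉ [13, 14, 15], s'.nat A = s.nat A) → s'.real = s.real →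
      s'.nat mid 0 < m → (test.holds W s' ↔ p (s'.nat mid 0)))
    (hp : ∀ x y, x ≤ y → y < m → p y → p x) :
    Runs W (bsearch test) s (bsearchTime test * (Nat.log 2 n + 2)) fun s' =>
      (∃ k ≤ m, s'.nat lo 0 = k ∧ (∀ x < k, p x) ∧ ∀ x, k ≤ x → x < m → ¬ p x) ∧
      (∀ A ∉ [13, 14, 15], s'.nat A = s.nat A) ∧ s'.real = s.real := by
  simp only [lo, hi, mid] at *
  -- The third ghost parameter is fuel: the remaining interval is shorter than two to its power.
  refine (Runs.loop (ι := ℕ × ℕ × ℕ) (i := (0, m, Nat.log 2 n + 1))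
    (fun q s' => (s'.nat 13 0 = q.1 ∧ s'.nat 15 0 = q.2.1) ∧ q.1 ≤ q.2.1 ∧ q.2.1 ≤ m ∧
      q.2.1 - q.1 < 2 ^ q.2.2 ∧ (∀ x < q.1, p x) ∧ (∀ x, q.2.1 ≤ x → x < m → ¬ p x) ∧
      (∀ A ∉ [13, 14, 15], s'.nat A = s.nat A) ∧ s'.real = s.real)
    (fun q => bsearchTime test * q.2.2) ?_ ?_ ?_).mono ?_ fun _ h => h
  · rintro ⟨l, h, f⟩ s' ⟨⟨h1, h2⟩, h3, h4, h5, h6, h7, h8, h9⟩ hb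
    simp only at h1 h2 h3 h4 h5 h6 h7
    have hlh : l < h := by simpa [Test.holds, h1, h2] using hb
    obtain ⟨f, rfl⟩ : ∃ g, f = g + 1 := ⟨f - 1, by
      rcases f with - | f
      · simp at h5; omega
      · simp⟩
    rw [pow_succ] at h5
    obtain ⟨k, hk⟩ : ∃ k, k = (l + h) / 2 := ⟨_, rfl⟩
    have hmid : (mid ←ₙ (var lo + var hi) / 2).run W s' = s'.setNat 14 0 k := by
      simp (disch := omega) [h1, h2, Nat.mod_eq_of_lt, hk]
    have ht := htest (s'.setNat 14 0 k) (fun A hA => by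
        rw [State.nat_setNat_of_ne _ _ _ (by simp at hA; omega), h8 A hA]) (by simp [h9])
        (by simp [State.nat_setNat]; omega)
    simp only [State.nat_setNat, and_self, if_true] at ht
    refine ⟨_, Runs.straight (by simp [Program.LoopFree]) ?_⟩
    rw [Program.run, hmid, Program.run]
    have htime : ∀ T, T = (mid ←ₙ (var lo + var hi) / 2 ;;
        .ite test (lo ←ₙ var mid + 1) (hi ←ₙ var mid)).bound →
        (Test.natLt (var lo) (var hi)).cost + 1 + T + bsearchTime test * f ≤
          bsearchTime test * (f + 1) := by
      rintro T rfl; rw [mul_add, bsearchTime]; omega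
    by_cases hpk : p k
    · rw [Program.select_pos (ht.mpr hpk)]
      refine ⟨(k + 1, h, f), ⟨⟨?_, ?_⟩, ?_, h4, ?_, ?_, h7, ?_, ?_⟩, htime _ rfl⟩
      · simp (disch := omega) [State.nat_setNat, Nat.mod_eq_of_lt]
      · simp [State.nat_setNat, h2]
      · simp only; omega
      · simp only; omega
      · intro x hx; exact hp x k (Nat.lt_succ_iff.mp hx) (by omega) hpk
      · intro A hA
        rw [← h8 A hA]
        simp at hA
        simp [State.nat_setNat_of_ne, hA]
      · simp [h9]
    · rw [Program.select_neg (mt ht.mp hpk)]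
      refine ⟨(l, k, f), ⟨⟨?_, ?_⟩, ?_, ?_, ?_, h6, ?_, ?_, ?_⟩, htime _ rfl⟩
      · simp [State.nat_setNat, h1]
      · simp [State.nat_setNat]
      · simp only; omega
      · simp only; omega
      · simp only; omega
      · intro x hx hxm hpx; exact hpk (hp k x hx hxm hpx)
      · intro A hA
        rw [← h8 A hA]
        simp at hA
        simp [State.nat_setNat_of_ne, hA]
      · simp [h9]
  · rintro ⟨l, h, f⟩ s' ⟨⟨h1, h2⟩, h3, h4, h5, h6, h7, h8, h9⟩ hb
    simp only at h1 h2 h3 h4 h5 h6 h7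
    have hlh : ¬ l < h := by simpa [Test.holds, h1, h2] using hb
    obtain rfl : l = h := by omega
    exact ⟨⟨l, h4, h1, h6, h7⟩, h8, h9⟩
  · refine ⟨⟨hlo, hhi⟩, Nat.zero_le _, le_rfl, ?_, by simp, ?_, fun _ _ => rfl, rfl⟩
    · have := Nat.lt_pow_succ_log_self (b := 2) (by norm_num) n
      simp only [Nat.succ_eq_add_one] at this ⊢
      omega
    · intro x h1 h2; simp only at h1; omega
  · simp only [mul_add, bsearchTime]; omega

/-! ## Decomposing an interval into dyadic blocks -/

/-- A block at an odd left end is the right half of its parent, whose left half is outside the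
interval; it must be used now. Likewise for the last block before an odd right end. Afterwards both
ends are even and can be halved. -/
def rangeLeft (o : ℕ) (use : Program) : Program :=
  .ite (.natEq (var o % 2) 1) (o + 4 ←ₙ var o ;; use ;; o ←ₙ var o + 1) .skip

def rangeRight (o : ℕ) (use : Program) : Program :=
  .ite (.natEq (var (o + 1) % 2) 1)
    ((o + 1 ←ₙ var (o + 1) - 1 ;; o + 4 ←ₙ var (o + 1)) ;; use) .skip

def rangeUp (o : ℕ) : Program :=
  o ←ₙ var o / 2 ;; o + 1 ←ₙ var (o + 1) / 2 ;; o + 2 ←ₙ var (o + 2) + 1 ;;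
    o + 3 ←ₙ 2 * var (o + 3)

/-- Calls `use` for dyadic blocks that partition the interval from the variable `o` to the variable
`o + 1`: for the block number `var (o + 4)` of size `var (o + 3) = 2 ^ var (o + 2)`. -/
def rangeLoop (o : ℕ) (use : Program) : Program :=
  (o + 2 ←ₙ 0 ;; o + 3 ←ₙ 1) ;; .loop (.natLt (var o) (var (o + 1)))
    (rangeLeft o use ;; rangeRight o use ;; rangeUp o)

/-- Some position in the interval `[l, r)` is a hit. -/
def Hits (Hit : ℕ → Prop) (l r : ℕ) : Prop := ∃ p, l ≤ p ∧ p < r ∧ Hit p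

theorem hits_split {Hit : ℕ → Prop} {l m r : ℕ} (h : l ≤ m) (h' : m ≤ r) :
    Hits Hit l r ↔ Hits Hit l m ∨ Hits Hit m r := by
  constructor
  · rintro ⟨p, h1, h2, h3⟩
    rcases lt_or_ge p m with h | h
    · exact .inl ⟨p, h1, h, h3⟩
    · exact .inr ⟨p, h, h2, h3⟩
  · rintro (⟨p, h1, h2, h3⟩ | ⟨p, h1, h2, h3⟩)
    · exact ⟨p, h1, by omega, h3⟩
    · exact ⟨p, by omega, h2, h3⟩

theorem not_hits {Hit : ℕ → Prop} {l r : ℕ} (h : r ≤ l) : ¬ Hits Hit l r := by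
  rintro ⟨p, h1, h2, -⟩; omega

/-- The states that differ from `s` only in the integer arrays in the list `L`. -/
def Agree (L : List ℕ) (s s' : State) : Prop := (∀ A ∉ L, s'.nat A = s.nat A) ∧ s'.real = s.real

theorem Agree.trans {L L' M : List ℕ} {s s' s'' : State} (h : Agree L s s') (h' : Agree L' s' s'')
    (hL : ∀ A ∈ L, A ∈ M) (hL' : ∀ A ∈ L', A ∈ M) : Agree M s s'' :=
  ⟨fun A hA => (h'.1 A (mt (hL' A) hA)).trans (h.1 A (mt (hL A) hA)), h'.2.trans h.2⟩

theorem Program.run_agree {W : ℕ} {c : Program} {L : List ℕ} (hc : c.LoopFree) (hc' : c.RealFree)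
    (hL : c.mods = L) (s : State) : Agree L s (c.run W s) :=
  ⟨fun _ hA => Program.run_frame hc s (hL ▸ hA), Program.run_real hc hc' s⟩

theorem Runs.agree {W : ℕ} {c : Program} {s : State} {T : ℕ} {Q : State → Prop}
    (h : Runs W c s T Q) (hc : c.RealFree) : Runs W c s T fun s' => Q s' ∧ Agree c.mods s s' :=
  (h.frame hc).mono le_rfl fun _ h => h

/-- `use` reports in the variable `F` whether there is a hit in a given block. -/
def BlockSpec (W o F n T : ℕ) (use : Program) (Hit : ℕ → Prop) (s : State) : Prop :=
  ∀ s' ℓ k, Agree ([o, o + 1, o + 2, o + 3, o + 4] ++ use.mods) s s' → s'.nat (o + 2) 0 = ℓ →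
    s'.nat (o + 4) 0 = k → (k + 1) * 2 ^ ℓ ≤ n →
    Runs W use s' T fun s'' => s''.nat F 0 ≠ 0 ↔
      (s'.nat F 0 ≠ 0 ∨ Hits Hit (k * 2 ^ ℓ) ((k + 1) * 2 ^ ℓ))

/-- The invariant of `rangeLoop`. -/
structure RangeInv (o F n : ℕ) (use : Program) (Hit : ℕ → Prop) (G : Prop) (s : State)
    (ℓ l r : ℕ) (s' : State) : Prop where
  agree : Agree ([o, o + 1, o + 2, o + 3, o + 4] ++ use.mods) s s'
  left : s'.nat o 0 = l
  right : s'.nat (o + 1) 0 = r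
  lev : s'.nat (o + 2) 0 = ℓ
  blk : s'.nat (o + 3) 0 = 2 ^ ℓ
  le : r * 2 ^ ℓ ≤ n
  hits : (s'.nat F 0 ≠ 0 ∨ Hits Hit (l * 2 ^ ℓ) (r * 2 ^ ℓ)) ↔ G

section range

variable {W o F n T : ℕ} {use : Program} {Hit : ℕ → Prop} {G : Prop} {s s' : State} {ℓ l r : ℕ}

theorem rangeLeft_spec (hr : use.RealFree)
    (hm : ∀ A ∈ use.mods, A ∉ [o, o + 1, o + 2, o + 3, o + 4])
    (hF : F ∉ [o, o + 1, o + 2, o + 3, o + 4]) (huse : BlockSpec W o F n T use Hit s)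
    (hW : 2 * n + 2 < W) (h : RangeInv o F n use Hit G s ℓ l r s') (hlr : l < r) :
    Runs W (rangeLeft o use) s' ((rangeLeft o .skip).bound + T)
      (RangeInv o F n use Hit G s ℓ (l + l % 2) r) := by
  have hrn : r ≤ n := (Nat.le_mul_of_pos_right r (by positivity)).trans h.le
  have htest : (Test.natEq (var o % 2) 1).holds W s' ↔ l % 2 = 1 := by
    simp (disch := omega) [Test.holds, h.left, Nat.mod_eq_of_lt]
  refine (Runs.ite (T := (o + 4 ←ₙ var o).bound + (T + (o ←ₙ var o + 1).bound) + 1) (fun hb => ?_)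
    fun hb => ?_).mono ?_ fun _ h => h
  · rw [htest] at hb
    have hle : (l + 1) * 2 ^ ℓ ≤ n := (Nat.mul_le_mul_right _ hlr).trans h.le
    have hA1 : Agree [o + 4] s' ((o + 4 ←ₙ var o).run W s') :=
      Program.run_agree (by simp) (by simp) (by rfl) s'
    refine (Runs.straight_seq (by simp) (Runs.seq_of (((huse ((o + 4 ←ₙ var o).run W s') ℓ l ?_ ?_ ?_
      hle)).agree hr) fun s2 ⟨h2, hA2⟩ => Runs.straight (by simp) ?_)).mono (Nat.le_succ _)
        fun _ h => h
    · exact h.agree.trans hA1 (fun _ h => h) (by simp)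
    · simp [State.nat_setNat, h.lev]
    · simp [State.nat_setNat, h.left]
    · have hA3 : Agree [o] s2 ((o ←ₙ var o + 1).run W s2) :=
        Program.run_agree (by simp) (by simp) (by rfl) s2
      have hA : ∀ x ∈ [o, o + 1, o + 2, o + 3], s2.nat x = s'.nat x := fun x hx => by
        rw [hA2.1 x fun h => hm x h (by simp at hx ⊢; omega), hA1.1 x (by simp at hx ⊢; omega)]
      have e0 := hA o (by simp)
      refine ⟨?_, ?_, ?_, ?_, ?_, h.le, ?_⟩
      · refine Agree.trans (L := [o, o + 1, o + 2, o + 3, o + 4] ++ use.mods) ?_ hA3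
          (fun _ h => h) (by simp)
        refine Agree.trans ?_ hA2 (fun _ h => h) fun A h => List.mem_append_right _ h
        exact h.agree.trans hA1 (fun _ h => h) (by simp)
      · simp (disch := omega) [State.nat_setNat, e0, h.left, hb, Nat.mod_eq_of_lt]
      · rw [hA3.1 _ (by simp), hA _ (by simp), h.right]
      · rw [hA3.1 _ (by simp), hA _ (by simp), h.lev]
      · rw [hA3.1 _ (by simp), hA _ (by simp), h.blk]
      · rw [← h.hits, hA3.1 F (by simp at hF ⊢; omega), h2, hA1.1 F (by simp at hF ⊢; omega), hb,
          hits_split (l := l * 2 ^ ℓ) (Nat.mul_le_mul_right _ (Nat.le_succ l))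
            (Nat.mul_le_mul_right _ hlr), or_assoc]
  · rw [htest] at hb
    refine (Runs.straight (c := .skip) trivial ?_).mono (by simp [Program.bound]) fun _ h => h
    rw [show l % 2 = 0 by omega]
    exact h
  · simp only [rangeLeft, Program.bound]; omega

theorem rangeRight_spec (hr : use.RealFree)
    (hm : ∀ A ∈ use.mods, A ∉ [o, o + 1, o + 2, o + 3, o + 4])
    (hF : F ∉ [o, o + 1, o + 2, o + 3, o + 4]) (huse : BlockSpec W o F n T use Hit s)
    (hW : 2 * n + 2 < W) (h : RangeInv o F n use Hit G s ℓ l r s') (hlr : l ≤ r) (hl : l % 2 = 0) :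
    Runs W (rangeRight o use) s' ((rangeRight o .skip).bound + T)
      (RangeInv o F n use Hit G s ℓ l (r - r % 2)) := by
  have hrn : r ≤ n := (Nat.le_mul_of_pos_right r (by positivity)).trans h.le
  have htest : (Test.natEq (var (o + 1) % 2) 1).holds W s' ↔ r % 2 = 1 := by
    simp (disch := omega) [Test.holds, h.right, Nat.mod_eq_of_lt]
  set pre := o + 1 ←ₙ var (o + 1) - 1 ;; o + 4 ←ₙ var (o + 1) with hpre
  refine (Runs.ite (T := pre.bound + T + 1) (fun hb => ?_) fun hb => ?_).mono ?_ fun _ h => h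
  · rw [htest] at hb
    obtain ⟨q, rfl⟩ : ∃ q, r = q + 1 := ⟨r - 1, by omega⟩
    have hA1 : Agree [o + 1, o + 4] s' (pre.run W s') :=
      Program.run_agree (by simp [hpre, Program.LoopFree]) (by simp [hpre, Program.RealFree])
        (by rfl) s'
    have hq : (pre.run W s').nat (o + 1) 0 = q := by
      simp (disch := omega) [hpre, Program.run, State.nat_setNat, h.right, Nat.mod_eq_of_lt]
    refine (Runs.straight_seq (by simp [hpre, Program.LoopFree]) (((huse (pre.run W s') ℓ q ?_ ?_ ?_
      h.le).agree hr).mono le_rfl fun s2 ⟨h2, hA2⟩ => ?_)).mono (Nat.le_succ _) fun _ h => h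
    · exact h.agree.trans hA1 (fun _ h => h) (by simp)
    · rw [hA1.1 _ (by simp), h.lev]
    · simp (disch := omega) [hpre, Program.run, State.nat_setNat, h.right, Nat.mod_eq_of_lt]
    · have hA : ∀ x ∈ [o, o + 2, o + 3], s2.nat x = s'.nat x := fun x hx => by
        rw [hA2.1 x fun h => hm x h (by simp at hx ⊢; omega), hA1.1 x (by simp at hx ⊢; omega)]
      rw [hb, Nat.add_sub_cancel]
      refine ⟨?_, ?_, ?_, ?_, ?_, ?_, ?_⟩
      · refine Agree.trans ?_ hA2 (fun _ h => h) fun A h => List.mem_append_right _ h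
        exact h.agree.trans hA1 (fun _ h => h) (by simp)
      · rw [hA _ (by simp), h.left]
      · rw [hA2.1 _ fun h => hm _ h (by simp), hq]
      · rw [hA _ (by simp), h.lev]
      · rw [hA _ (by simp), h.blk]
      · exact (Nat.mul_le_mul_right _ (Nat.le_succ q)).trans h.le
      · rw [← h.hits, h2, hA1.1 F (by simp at hF ⊢; omega),
          hits_split (l := l * 2 ^ ℓ) (Nat.mul_le_mul_right _ (show l ≤ q by omega))
            (Nat.mul_le_mul_right _ (Nat.le_succ q)), or_assoc, or_comm (a := Hits _ _ _)]
  · rw [htest] at hb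
    refine (Runs.straight (c := .skip) trivial ?_).mono (by simp [Program.bound]) fun _ h => h
    rw [show r % 2 = 0 by omega]
    exact h
  · simp only [rangeRight, Program.bound, hpre]; omega

theorem rangeUp_spec (hF : F ∉ [o, o + 1, o + 2, o + 3, o + 4]) (hW : 2 * n + 2 < W)
    (h : RangeInv o F n use Hit G s ℓ l r s') (hlr : l ≤ r) (hl : l % 2 = 0) (hr : r % 2 = 0)
    (hℓ : 2 ^ ℓ ≤ n) :
    RangeInv o F n use Hit G s (ℓ + 1) (l / 2) (r / 2) ((rangeUp o).run W s') := by
  have hrn : r ≤ n := (Nat.le_mul_of_pos_right r (by positivity)).trans h.le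
  have hℓn := lt_of_lt_of_le Nat.lt_two_pow_self hℓ
  have hA : Agree [o, o + 1, o + 2, o + 3] s' ((rangeUp o).run W s') :=
    Program.run_agree (by simp [rangeUp, Program.LoopFree]) (by simp [rangeUp, Program.RealFree])
      (by rfl) s'
  have e1 : ∀ x, x % 2 = 0 → x / 2 * 2 ^ (ℓ + 1) = x * 2 ^ ℓ := by
    intro x hx
    rw [pow_succ', ← mul_assoc, Nat.div_mul_cancel (Nat.dvd_of_mod_eq_zero hx)]
  refine ⟨h.agree.trans hA (fun _ h => h) (by simp), ?_, ?_, ?_, ?_, ?_, ?_⟩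
  · simp (disch := omega) [rangeUp, Program.run, State.nat_setNat, h.left, Nat.mod_eq_of_lt]
  · simp (disch := omega) [rangeUp, Program.run, State.nat_setNat, h.right, Nat.mod_eq_of_lt]
  · simp (disch := omega) [rangeUp, Program.run, State.nat_setNat, h.lev, Nat.mod_eq_of_lt]
  · simp (disch := omega) [rangeUp, Program.run, State.nat_setNat, h.blk, Nat.mod_eq_of_lt, pow_succ']
  · rw [e1 r hr]; exact h.le
  · rw [e1 r hr, e1 l hl, ← h.hits, hA.1 F (by simp at hF ⊢; omega)]

def rangeTime (o T : ℕ) : ℕ :=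
  (o + 2 ←ₙ 0 ;; o + 3 ←ₙ 1).bound + (Test.natLt (var o) (var (o + 1))).cost + 1 +
    ((rangeLeft o .skip).bound + T) + ((rangeRight o .skip).bound + T) + (rangeUp o).bound

/-- At most two blocks are used per level. As long as the interval is nonempty, `2 ^ ℓ ≤ r * 2 ^ ℓ ≤
n`, which limits the number of levels. -/
theorem rangeLoop_spec (hr : use.RealFree)
    (hm : ∀ A ∈ use.mods, A ∉ [o, o + 1, o + 2, o + 3, o + 4])
    (hF : F ∉ [o, o + 1, o + 2, o + 3, o + 4]) (huse : BlockSpec W o F n T use Hit s)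
    (hW : 2 * n + 2 < W) (hl : s.nat o 0 = l) (hr' : s.nat (o + 1) 0 = r) (hrn : r ≤ n) :
    Runs W (rangeLoop o use) s (rangeTime o T * (Nat.log 2 n + 2)) fun s' =>
      s'.nat F 0 ≠ 0 ↔ (s.nat F 0 ≠ 0 ∨ Hits Hit l r) := by
  set b := Test.natLt (var o) (var (o + 1)) with hb
  set L := (rangeLeft o .skip).bound + T with hL
  set R := (rangeRight o .skip).bound + T with hR
  set G := s.nat F 0 ≠ 0 ∨ Hits Hit l r with hG
  refine (Runs.straight_seq (by simp [Program.LoopFree]) (Runs.loop (ι := ℕ × ℕ × ℕ)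
    (i := (0, l, r)) (Q := fun s' => s'.nat F 0 ≠ 0 ↔ G)
    (fun q s' => RangeInv o F n use Hit G s q.1 q.2.1 q.2.2 s')
    (fun q => (b.cost + 1 + (L + (R + (rangeUp o).bound))) * (Nat.log 2 n + 1 - q.1))
    ?_ ?_ ?_)).mono ?_ fun _ h => h
  · rintro ⟨ℓ, l, r⟩ s1 h1 hb1
    replace h1 : RangeInv o F n use Hit G s ℓ l r s1 := h1
    have hlr : l < r := by simpa [hb, Test.holds, h1.left, h1.right] using hb1
    have hℓn : 2 ^ ℓ ≤ n := (Nat.le_mul_of_pos_left _ (by omega)).trans h1.le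
    have hℓl : ℓ ≤ Nat.log 2 n := Nat.le_log_of_pow_le (by norm_num) hℓn
    refine ⟨_, Runs.seq_of (rangeLeft_spec hr hm hF huse hW h1 hlr) fun s2 h2 => Runs.seq_of
      (rangeRight_spec hr hm hF huse hW h2 (by omega) (by omega)) fun s3 h3 => Runs.straight
      (by simp [rangeUp, Program.LoopFree]) ⟨(ℓ + 1, _, _),
        rangeUp_spec hF hW h3 (by omega) (by omega) (by omega) hℓn, ?_⟩⟩
    simp only
    rw [show Nat.log 2 n + 1 - ℓ = (Nat.log 2 n + 1 - (ℓ + 1)) + 1 by omega,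
      mul_add (b.cost + 1 + (L + (R + (rangeUp o).bound))) _ 1]
    change b.cost + 1 + (L + (R + (rangeUp o).bound)) + _ ≤ _
    omega
  · rintro ⟨ℓ, l, r⟩ s1 h1 hb1
    have hlr : r ≤ l := by simpa [hb, Test.holds, h1.left, h1.right] using hb1
    have := h1.hits
    simpa [not_hits (Nat.mul_le_mul_right _ hlr)] using this
  · have hA : Agree [o + 2, o + 3] s ((o + 2 ←ₙ 0 ;; o + 3 ←ₙ 1).run W s) :=
      Program.run_agree (by simp [Program.LoopFree]) (by simp [Program.RealFree]) (by rfl) s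
    refine ⟨⟨fun A hA' => hA.1 A (by simp at hA' ⊢; omega), hA.2⟩, ?_, ?_, ?_, ?_, ?_, ?_⟩
    · rw [hA.1 _ (by simp), hl]
    · rw [hA.1 _ (by simp), hr']
    · simp [Program.run, State.nat_setNat]
    · simp (disch := omega) [Program.run, State.nat_setNat, Nat.mod_eq_of_lt]
    · simpa using hrn
    · rw [hA.1 F (by simp at hF ⊢; omega), hG]; simp
  · rw [Nat.sub_zero, rangeTime, ← hb, ← hL, ← hR]
    ring_nf
    nlinarith [Nat.zero_le ((o + 2 ←ₙ 0 ;; o + 3 ←ₙ 1).bound * Nat.log 2 n)]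

end range

end RealRAM

namespace SegmentQuery

open RealRAM RealRAM.Reg

/-! ## The data structure -/

/-- The points of the `k`-th block on level `ℓ` of the first hierarchy. -/
def block (n : ℕ) (s : State) (ℓ k : ℕ) : Finset ℕ :=
  (Finset.range n).filter fun b => posS s b / 2 ^ ℓ = k

/-- The points of the `m`-th subblock on level `j` of a block. -/
def subblock (n : ℕ) (s : State) (ℓ k j m : ℕ) : Finset ℕ :=
  (Finset.range n).filter fun b => posS s b / 2 ^ ℓ = k ∧ posT n s ℓ b / 2 ^ j = m

/-- What the queries need to know about the memory. -/
structure Data (n : ℕ) (s : State) : Prop where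
  size : s.nat 0 0 = n
  pos : ∀ b < n, 0 < s.real 1 b
  top : listInv (ordS s.real) (Finset.range n) (s.nat 103) (s.nat 102 0) (s.nat 104)
  top_le : s.nat 102 0 ≤ n
  mid : ∀ ℓ k κ, κ = ℓ * (n + 1) + k → 2 ^ ℓ ≤ n → k ≤ n →
    listInv (ordT s.real) (block n s ℓ k) (fun x => s.nat 113 (κ * (n + 1) + x)) (s.nat 112 κ)
      (posT n s ℓ)
  mid_le : ∀ κ, s.nat 112 κ ≤ n
  env : ∀ ℓ k j m κ, κ = ((ℓ * (n + 1) + j) * (n + 1) + k) * (n + 1) + m → 2 ^ ℓ ≤ n → 2 ^ j ≤ n →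
    k ≤ n → m ≤ n → envInv s.real (subblock n s ℓ k j m) (fun x => s.nat 123 (κ * (n + 1) + x))
      (s.nat 122 κ) id
  env_le : ∀ κ, s.nat 122 κ ≤ n

/-- Because keys determine level and block number, the points stored under a key are those of
exactly one block or subblock. -/
theorem Ready.data {n : ℕ} {s : State} (h : Ready n s.real s) (hpos : ∀ b < n, 0 < s.real 1 b) :
    Data n s := by
  obtain ⟨hB, L, hL, hT, hY⟩ := h
  have hlev : ∀ ℓ, 2 ^ ℓ ≤ n → ℓ < L := fun ℓ h =>
    (Nat.pow_lt_pow_iff_right (by norm_num)).mp (h.trans_lt hL)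
  refine ⟨hB.size, hpos, hB.topList.1, hB.topList.2, ?_, hT.count_le, ?_, hY.count_le⟩
  · rintro ℓ k κ rfl hℓ hk
    have hset : setT n s L (ℓ * (n + 1) + k) = block n s ℓ k := by
      ext b
      simp only [setT, block, Finset.mem_filter, Finset.mem_range]
      refine and_congr_right fun hb => ⟨?_, fun h => ⟨ℓ, hlev ℓ hℓ, by rw [kfT, h]⟩⟩
      rintro ⟨ℓ', -, h⟩
      obtain ⟨rfl, h'⟩ := addr_inj h (div_two_pow_le (hB.posS_le hb) _) hk
      exact h'
    have h := (hT (ℓ * (n + 1) + k)).1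
    rw [hset] at h
    refine listInv_local _ _ _ _ _ _ _ (fun _ _ => rfl) (fun b hb => ?_) h
    rw [posT, kfT, (Finset.mem_filter.mp hb).2]
  · rintro ℓ k j m κ rfl hℓ hj hk hm
    have hset : setY n s L 0 (((ℓ * (n + 1) + j) * (n + 1) + k) * (n + 1) + m) =
        subblock n s ℓ k j m := by
      ext b
      simp only [setY, subblock, Finset.mem_filter, Finset.mem_range]
      refine and_congr_right fun hb => ⟨?_, fun h => ⟨ℓ, j, hj, .inl (hlev ℓ hℓ), by
        rw [kfY, h.1, h.2]⟩⟩
      rintro ⟨ℓ', j', hj', hℓ', h⟩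
      obtain ⟨rfl, rfl, h1, h2⟩ := kfY_inj (lt_of_two_pow_le hj').le (lt_of_two_pow_le hj).le
        (div_two_pow_le (hB.posS_le hb) _) hk
        (div_two_pow_le (posT_le hT (by omega) hb) _) hm h
      exact ⟨h1, h2⟩
    have h := (hY (((ℓ * (n + 1) + j) * (n + 1) + k) * (n + 1) + m)).1
    rw [hset] at h
    exact envInv_local _ _ _ _ _ _ _ (fun _ _ => rfl) (fun _ _ => rfl) h

/-- Queries write only to registers, and presenting a query point changes only real array `3`.
Neither enters `Data`, so any number of queries may follow each other. -/
theorem Data.congr {n : ℕ} {s s' : State} (h : Data n s)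
    (hf : ∀ A, A = 0 ∨ 100 ≤ A → s'.nat A = s.nat A) (h0 : s'.real 0 0 = s.real 0 0)
    (h1 : s'.real 1 = s.real 1) (h2 : s'.real 2 = s.real 2) : Data n s' := by
  have hS : ordS s'.real = ordS s.real := by
    funext a b; simp only [ordS, slopeS, h1, h2]
  have hT : ordT s'.real = ordT s.real := by
    funext a b; simp only [ordT, slopeT, h0, h1, h2]
  have hE : envInv s'.real = envInv s.real := by
    funext P f c r; simp only [envInv, frontOf, h1, h2]
  have hpT : posT n s' = posT n s := by
    funext ℓ b; simp only [posT, kfT, posS, hf 104 (by simp), hf 114 (by simp)]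
  have hb : block n s' = block n s := by
    funext ℓ k; ext b
    rw [block, block, Finset.mem_filter, Finset.mem_filter, posS, posS, hf 104 (by simp)]
  have hsb : subblock n s' = subblock n s := by
    funext ℓ k j m; ext b
    rw [subblock, subblock, Finset.mem_filter, Finset.mem_filter, posS, posS, hf 104 (by simp), hpT]
  obtain ⟨a1, a2, a3, a4, a5, a6, a7, a8⟩ := h
  refine ⟨?_, ?_, ?_, ?_, ?_, ?_, ?_, ?_⟩
  · rwa [hf 0 (by simp)]
  · rwa [h1]
  · rwa [hS, hf 102 (by simp), hf 103 (by simp), hf 104 (by simp)]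
  · rwa [hf 102 (by simp)]
  · rwa [hT, hb, hpT, hf 112 (by simp), hf 113 (by simp)]
  · rwa [hf 112 (by simp)]
  · rwa [hE, hsb, hf 122 (by simp), hf 123 (by simp)]
  · rwa [hf 122 (by simp)]

theorem Data.of_agree {n : ℕ} {L : List ℕ} {s s' : State} (h : Data n s) (hA : Agree L s s')
    (hL : ∀ A ∈ L, A ≠ 0 ∧ A < 100) : Data n s' :=
  h.congr (fun A hA' => hA.1 A fun h => by have := hL A h; omega) (by rw [hA.2]) (by rw [hA.2])
    (by rw [hA.2])

theorem posS_of_agree {L : List ℕ} {s s' : State} (hA : Agree L s s')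
    (hL : ∀ A ∈ L, A ≠ 0 ∧ A < 100) : posS s' = posS s := by
  funext b
  rw [posS, posS, hA.1 104 fun h => by have := hL _ h; omega]

theorem posT_of_agree {n : ℕ} {L : List ℕ} {s s' : State} (hA : Agree L s s')
    (hL : ∀ A ∈ L, A ≠ 0 ∧ A < 100) : posT n s' = posT n s := by
  funext ℓ b
  simp only [posT, kfT, posS_of_agree hA hL, hA.1 114 fun h => by have := hL _ h; omega]

/-! ## Queries -/

/-- The coordinates of the query point. -/
def axE : RExpr := .get 3 0
def ayE : RExpr := .get 3 1

theorem eval_axE (W : ℕ) (s : State) : axE.eval W s = s.real 3 0 := by simp [axE]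
theorem eval_ayE {W : ℕ} (hW : 1 < W) (s : State) : ayE.eval W s = s.real 3 1 := by
  simp [ayE, Nat.mod_eq_of_lt hW]

/-- The point with index `b` is at distance at most one from the query point. -/
def Near (ρ : ℕ → ℕ → ℝ) (b : ℕ) : Prop := frontOf ρ b (ρ 3 1) ≤ ρ 3 0

theorem near_iff {ρ : ℕ → ℕ → ℝ} {b : ℕ} (hb : 0 < ρ 1 b) (ha : ρ 3 0 < 0) :
    Near ρ b ↔ power (ρ 1 b) (ρ 2 b) (ρ 3 0) (ρ 3 1) ≤ 0 :=
  front_le_iff_power hb ha.le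

namespace Reg

/-- Set to a nonzero value when a point has been found. -/
@[simp] def found : ℕ := 60

end Reg

open Reg

def envKey : NExpr :=
  ((var 42 * (size + 1) + var 52) * (size + 1) + var 44) * (size + 1) + var 54

/-- The entry of the current envelope with index `e`. -/
def envCell (e : NExpr) : NExpr := .get 123 (var K * (size + 1) + e)

/-- The search compares neighbours on the envelope, hence the upper end `c - 1`; for an empty
envelope it is `0` by truncation. -/
def envInit : Program := K ←ₙ envKey ;; c ←ₙ .get 122 (var K) ;; lo ←ₙ 0 ;; hi ←ₙ var c - 1

/-- The next front on the envelope is in front of the middle one. -/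
def envTest : Test :=
  .neg (rayTestE (xE (envCell (var mid))) (yE (envCell (var mid))) (xE (envCell (var mid + 1)))
    (yE (envCell (var mid + 1))) 0 ayE)

def farTest (e : NExpr) : Test :=
  .realLt 1 ((axE - xE e) * (axE - xE e) + (ayE - yE e) * (ayE - yE e))

def envFinish : Program :=
  .ite (.conj (.natLt 0 (var c)) (.neg (farTest (envCell (var lo))))) (found ←ₙ 1) .skip

/-- Searches a point in the current subblock that is close to the query point. -/
def envQuery : Program := envInit ;; bsearch envTest ;; envFinish

theorem holds_farTest {W : ℕ} (hW : 1 < W) {s : State} {e : NExpr} (hb : 0 < s.real 1 (e.eval W s))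
    (ha : s.real 3 0 < 0) : (farTest e).holds W s ↔ ¬ Near s.real (e.eval W s) := by
  rw [near_iff hb ha, power]
  simp only [farTest, Test.holds, RExpr.eval_one, RExpr.eval_add, RExpr.eval_mul, RExpr.eval_sub,
    eval_axE, eval_ayE hW, eval_xE, eval_yE, not_le]
  rw [← sub_pos]
  ring_nf

/-- Unimodality: once the fronts along the envelope stop decreasing, they never decrease again. This
makes the predicate of the binary search monotone. -/
theorem envInv.chain {ρ : ℕ → ℕ → ℝ} {P : Finset ℕ} {f r : ℕ → ℕ} {c : ℕ} (h : envInv ρ P f c r)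
    {y : ℝ} {x z : ℕ} (hxz : x ≤ z) (hz : z + 1 < c)
    (hx : frontOf ρ (f x) y ≤ frontOf ρ (f (x + 1)) y) :
    frontOf ρ (f z) y ≤ frontOf ρ (f (z + 1)) y := by
  induction z, hxz using Nat.le_induction with
  | base => exact hx
  | succ z hxz ih => exact h.2.2.1 z hz y (ih (by omega))

/-- The index `k` is the valley of a unimodal sequence, and the envelope dominates the whole set, so
a single front answers for all points. -/
theorem envInv.exists_le_iff {ρ : ℕ → ℕ → ℝ} {P : Finset ℕ} {f r : ℕ → ℕ} {c k : ℕ}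
    (h : envInv ρ P f c r) {y t : ℝ} (hk : k < c)
    (h1 : ∀ x < k, ¬ frontOf ρ (f x) y ≤ frontOf ρ (f (x + 1)) y)
    (h2 : ∀ x, k ≤ x → x < c - 1 → frontOf ρ (f x) y ≤ frontOf ρ (f (x + 1)) y) :
    (∃ b ∈ P, frontOf ρ b y ≤ t) ↔ frontOf ρ (f k) y ≤ t := by
  have hup : ∀ d, k + d < c → frontOf ρ (f k) y ≤ frontOf ρ (f (k + d)) y := by
    intro d
    induction d with
    | zero => exact fun _ => le_rfl
    | succ d ih => exact fun hd => (ih (by omega)).trans (h2 (k + d) (by omega) (by omega))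
  have hdown : ∀ d ≤ k, frontOf ρ (f k) y ≤ frontOf ρ (f (k - d)) y := by
    intro d
    induction d with
    | zero => exact fun _ => le_rfl
    | succ d ih =>
      intro hd
      have := h1 (k - (d + 1)) (by omega)
      rw [show k - (d + 1) + 1 = k - d by omega, not_le] at this
      exact (ih (by omega)).trans this.le
  constructor
  · rintro ⟨b, hb, hbt⟩
    obtain ⟨x, hx, hxb⟩ := h.2.2.2 b hb y
    refine le_trans ?_ (hxb.trans hbt)
    rcases le_total k x with hkx | hkx
    · have := hup (x - k) (by omega)
      rwa [Nat.add_sub_cancel' hkx] at this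
    · have := hdown (k - x) (by omega)
      rwa [Nat.sub_sub_self hkx] at this
  · exact fun hkt => ⟨f k, h.1 k hk, hkt⟩

section envQuery

variable {W n ℓ k j m : ℕ} {s : State}

theorem eval_envKey (hW : (n + 2) ^ 6 ≤ W) (hn : s.nat 0 0 = n) (hℓ : s.nat 42 0 = ℓ)
    (hj : s.nat 52 0 = j) (hk : s.nat 44 0 = k) (hm : s.nat 54 0 = m) (hℓn : ℓ ≤ n) (hjn : j ≤ n)
    (hkn : k ≤ n) (hmn : m ≤ n) :
    envKey.eval W s = ((ℓ * (n + 1) + j) * (n + 1) + k) * (n + 1) + m := by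
  have hbd := keyY_bound hW hℓn hjn hkn hmn
  have hn2 : n + 1 < W := by have := keyT_bound hW (Nat.zero_le n) (Nat.zero_le n); omega
  obtain ⟨a, ha⟩ : ∃ a, a = ℓ * (n + 1) := ⟨_, rfl⟩
  obtain ⟨a2, ha2⟩ : ∃ x, x = (a + j) * (n + 1) := ⟨_, rfl⟩
  obtain ⟨a3, ha3⟩ : ∃ x, x = (a2 + k) * (n + 1) := ⟨_, rfl⟩
  rw [← ha, ← ha2, ← ha3] at hbd ⊢
  have l3 : a3 + m + 1 ≤ (a3 + m + 1) * (n + 1) := Nat.le_mul_of_pos_right _ n.succ_pos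
  have l2 : a2 + k ≤ a3 := ha3 ▸ Nat.le_mul_of_pos_right _ n.succ_pos
  have l1 : a + j ≤ a2 := ha2 ▸ Nat.le_mul_of_pos_right _ n.succ_pos
  simp (disch := omega) [envKey, hn, hℓ, hj, hk, hm, Nat.mod_eq_of_lt, ← ha, ← ha2, ← ha3]

def envTime : ℕ := envInit.bound + bsearchTime envTest + envFinish.bound

theorem envQuery_spec (hW : (n + 2) ^ 6 ≤ W) (h : Data n s) (ha : s.real 3 0 < 0)
    (hℓ : s.nat 42 0 = ℓ) (hj : s.nat 52 0 = j) (hk : s.nat 44 0 = k) (hm : s.nat 54 0 = m)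
    (hℓn : 2 ^ ℓ ≤ n) (hjn : 2 ^ j ≤ n) (hkn : k ≤ n) (hmn : m ≤ n) :
    Runs W envQuery s (envTime * (Nat.log 2 n + 2)) fun s' =>
      s'.nat found 0 ≠ 0 ↔
        (s.nat found 0 ≠ 0 ∨ ∃ b ∈ subblock n s ℓ k j m, Near s.real b) := by
  have hK := eval_envKey hW h.size hℓ hj hk hm (lt_of_two_pow_le hℓn).le (lt_of_two_pow_le hjn).le
    hkn hmn
  have hbd := keyY_bound hW (lt_of_two_pow_le hℓn).le (lt_of_two_pow_le hjn).le hkn hmn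
  obtain ⟨κ, hκ⟩ : ∃ κ, κ = ((ℓ * (n + 1) + j) * (n + 1) + k) * (n + 1) + m := ⟨_, rfl⟩
  have hE := h.env ℓ k j m κ hκ hℓn hjn hkn hmn
  rw [← hκ] at hK hbd
  obtain ⟨cnt, hcnt⟩ : ∃ cnt, cnt = s.nat 122 κ := ⟨_, rfl⟩
  have hcn : cnt ≤ n := hcnt ▸ h.env_le κ
  rw [← hcnt] at hE
  obtain ⟨f, hf⟩ : ∃ f : ℕ → ℕ, f = fun x => s.nat 123 (κ * (n + 1) + x) := ⟨_, rfl⟩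
  rw [← hf] at hE
  have hW2 := lt_of_pow_six hW le_rfl
  have hbd' : κ * (n + 1) + n + 2 < W := by linarith
  have hκW : κ ≤ κ * (n + 1) := Nat.le_mul_of_pos_right _ n.succ_pos
  have hfn : ∀ x < cnt, 0 < s.real 1 (f x) := fun x hx =>
    h.pos _ (Finset.mem_range.mp (Finset.mem_filter.mp (hE.1 x hx)).1)
  obtain ⟨s1, hs1⟩ : ∃ s1, s1 = envInit.run W s := ⟨_, rfl⟩
  have hA1 : Agree [21, 22, 13, 15] s s1 :=
    hs1 ▸ Program.run_agree (by simp [envInit, Program.LoopFree])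
      (by simp [envInit, Program.RealFree]) (by rfl) s
  have hcell : ∀ (s' : State) (e : NExpr) (x : ℕ), s'.nat 21 0 = κ → s'.nat 0 = s.nat 0 →
      s'.nat 123 = s.nat 123 → x < n + 2 → e.eval W s' = x → (envCell e).eval W s' = f x := by
    intro s' e x h1 h2 h3 hx he
    have := h.size
    rw [hf]
    simp (disch := omega) [envCell, h1, h2, h3, he, this, Nat.mod_eq_of_lt]
  have e21 : s1.nat 21 0 = κ := by
    simp [hs1, envInit, Program.run, State.nat_setNat, hK]
  have e22 : s1.nat 22 0 = cnt := by
    simp [hs1, envInit, Program.run, State.nat_setNat, hK, hcnt]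
  have e13 : s1.nat 13 0 = 0 := by
    simp [hs1, envInit, Program.run, State.nat_setNat]
  have e15 : s1.nat 15 0 = cnt - 1 := by
    have hcn' := hcn
    rw [hcnt] at hcn' ⊢
    simp (disch := omega) [hs1, envInit, Program.run, State.nat_setNat, hK, Nat.mod_eq_of_lt]
  have hsearch := bsearch_spec (W := W) (test := envTest)
    (n := n) (p := fun x => ¬ frontOf s.real (f x) (s.real 3 1) ≤ frontOf s.real (f (x + 1))
      (s.real 3 1)) e13 e15 (by omega) hW2 ?_ ?_
  · refine (Runs.straight_seq (T := bsearchTime envTest * (Nat.log 2 n + 2) + envFinish.bound)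
      (by simp [envInit, Program.LoopFree]) ?_).mono ?_ fun _ h => h
    · rw [← hs1]
      refine Runs.seq_of hsearch ?_
      rintro s2 ⟨⟨q, hq, hlo, hq1, hq2⟩, hA2⟩
      refine Runs.straight (by simp [envFinish, Program.LoopFree]) ?_
      have g := hcell s2 (var lo) q (by rw [hA2.1 _ (by simp), e21])
        (by rw [hA2.1 _ (by simp), hA1.1 _ (by simp)]) (by rw [hA2.1 _ (by simp), hA1.1 _ (by simp)])
        (by omega) (by simpa using hlo)
      have hr2 : s2.real = s.real := hA2.2.trans hA1.2
      have hc2 : s2.nat 22 0 = cnt := by rw [hA2.1 _ (by simp), e22]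
      have hf2 : s2.nat 60 0 = s.nat 60 0 := by rw [hA2.1 _ (by simp), hA1.1 _ (by simp)]
      have htest : (Test.conj (.natLt 0 (var c)) (.neg (farTest (envCell (var lo))))).holds W s2 ↔
          ∃ b ∈ subblock n s ℓ k j m, Near s.real b := by
        rw [Test.holds, Test.holds, Test.holds]
        simp only [NExpr.eval_zero, eval_var, c, hc2]
        rcases Nat.eq_zero_or_pos cnt with h0 | h0
        · simp only [h0, lt_irrefl, false_and, false_iff, not_exists, not_and]
          intro b hb
          -- An empty envelope can dominate nothing, so its subblock is empty; the height `0` is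
          -- arbitrary.
          obtain ⟨x, hx, -⟩ := hE.2.2.2 b hb 0
          omega
        · rw [holds_farTest (by omega) (by rw [g, hr2]; exact hfn q (by omega)) (by rwa [hr2]), g, hr2,
            not_not]
          refine (and_iff_right h0).trans (Iff.symm (hE.exists_le_iff (by omega) hq1 fun x h1 h2 => ?_))
          exact not_not.mp (hq2 x h1 h2)
      rw [envFinish, Program.run]
      by_cases hb : ∃ b ∈ subblock n s ℓ k j m, Near s.real b
      · rw [Program.select_pos (htest.mpr hb)]
        simp (disch := omega) [State.nat_setNat, hb, Nat.mod_eq_of_lt]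
      · rw [Program.select_neg (mt htest.mp hb)]
        simp [Program.run, hb, hf2]
    · rw [envTime, add_mul, add_mul]
      have := Nat.le_mul_of_pos_right envInit.bound (show 0 < Nat.log 2 n + 2 by omega)
      have := Nat.le_mul_of_pos_right envFinish.bound (show 0 < Nat.log 2 n + 2 by omega)
      omega
  · intro s' hf' hr' hmid
    simp only [mid] at hmid
    have g1 := hcell s' (var mid) (s'.nat 14 0) (by rw [hf' _ (by simp), e21])
      (by rw [hf' _ (by simp), hA1.1 _ (by simp)]) (by rw [hf' _ (by simp), hA1.1 _ (by simp)])
      (by omega) (by simp)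
    have g2 := hcell s' (var mid + 1) (s'.nat 14 0 + 1) (by rw [hf' _ (by simp), e21])
      (by rw [hf' _ (by simp), hA1.1 _ (by simp)]) (by rw [hf' _ (by simp), hA1.1 _ (by simp)])
      (by omega) (by simp (disch := omega) [Nat.mod_eq_of_lt])
    rw [envTest, Test.holds, holds_rayTestE]
    simp only [eval_xE, eval_yE, g1, g2, RExpr.eval_zero, eval_ayE (show 1 < W by omega),
      hr', hA1.2]
    rw [rayTest_horizontal (hfn (s'.nat 14 0) (by omega)) (hfn (s'.nat 14 0 + 1) (by omega))]
    rfl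
  · intro x z hxz hz hpz hpx
    exact hpz (hE.chain hxz (by omega) hpx)
end envQuery

end SegmentQuery

namespace SegmentQuery

open RealRAM RealRAM.Reg Reg

/-! ## Searching a block of the first hierarchy -/

/-- The slopes of the lines through the query point and the endpoints of `σ`. -/
def querySlopeSE : RExpr := ayE / axE
def querySlopeTE : RExpr := (ayE - tauE) / axE

/-- The points with `slopeT` at most that of the query point (`false`), or the other ones (`true`). -/
def Side (upper : Bool) (ρ : ℕ → ℕ → ℝ) (b : ℕ) : Prop :=
  bif upper then ¬ slopeT ρ b ≤ (ρ 3 1 - ρ 0 0) / ρ 3 0 else slopeT ρ b ≤ (ρ 3 1 - ρ 0 0) / ρ 3 0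

def midInit : Program :=
  K ←ₙ var 42 * (size + 1) + var 44 ;; c ←ₙ .get 112 (var K) ;; lo ←ₙ 0 ;; hi ←ₙ var c

def midTest : Test :=
  .neg (.realLt querySlopeTE (slopeTE (.get 113 (var K * (size + 1) + var mid))))

def midRange (upper : Bool) : Program :=
  bif upper then 50 ←ₙ var lo ;; 51 ←ₙ var c else 50 ←ₙ 0 ;; 51 ←ₙ var lo

/-- Searches the current block for a point on the given side that is close to the query point. -/
def midQuery (upper : Bool) : Program :=
  midInit ;; bsearch midTest ;; midRange upper ;; rangeLoop 50 envQuery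

theorem mods_envQuery : envQuery.mods = [21, 22, 13, 15, 14, 13, 15, 60] := rfl

theorem realFree_envQuery : envQuery.RealFree := by
  simp [envQuery, envInit, bsearch, envFinish, Program.RealFree]

theorem mods_midQuery (upper : Bool) : ∀ A ∈ (midQuery upper).mods,
    A ∈ [13, 14, 15, 21, 22, 50, 51, 52, 53, 54, 60] := by
  cases upper <;> simp [midQuery, midInit, bsearch, midRange, rangeLoop, rangeLeft, rangeRight,
    rangeUp, mods_envQuery, Program.mods]

theorem realFree_midQuery (upper : Bool) : (midQuery upper).RealFree := by
  cases upper <;> simp [midQuery, midInit, bsearch, midRange, rangeLoop, rangeLeft, rangeRight,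
    rangeUp, realFree_envQuery, Program.RealFree]

theorem rangeTime_eq (o T : ℕ) : rangeTime o T = rangeTime o 0 + 2 * T := by
  simp only [rangeTime]; omega

theorem div_eq_iff_mem {p m h : ℕ} (hh : 0 < h) : p / h = m ↔ m * h ≤ p ∧ p < (m + 1) * h := by
  rw [← Nat.le_div_iff_mul_le hh, ← Nat.div_lt_iff_lt_mul hh]; omega

/-! ### One block: cut by `slopeT`, then search subblocks -/

section midQuery

variable {W n ℓ k : ℕ} {s : State}

/-- A hit is a position in the order by `slopeT` whose point is near. The positions in a dyadic
interval are exactly those of one subblock, so one envelope search serves the interval. -/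
theorem envQuery_blockSpec (hW : (n + 2) ^ 6 ≤ W) (h : Data n s) (ha : s.real 3 0 < 0)
    (hℓ : s.nat 42 0 = ℓ) (hk : s.nat 44 0 = k) (hℓn : 2 ^ ℓ ≤ n) (hkn : k ≤ n) :
    BlockSpec W 50 60 n (envTime * (Nat.log 2 n + 2)) envQuery
      (fun p => ∃ b ∈ block n s ℓ k, posT n s ℓ b = p ∧ Near s.real b) s := by
  intro s' j m hA hj hm hmn
  rw [mods_envQuery] at hA
  have hL : ∀ A ∈ [50, 50 + 1, 50 + 2, 50 + 3, 50 + 4] ++ [21, 22, 13, 15, 14, 13, 15, 60],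
      A ≠ 0 ∧ A < 100 := by simp
  have hjn : 2 ^ j ≤ n := (Nat.le_mul_of_pos_left _ (Nat.succ_pos m)).trans hmn
  have hmn' : m ≤ n := by
    have := Nat.le_mul_of_pos_right (m + 1) (show 0 < 2 ^ j by positivity)
    omega
  refine (envQuery_spec hW (h.of_agree hA hL) (by rwa [hA.2]) (by rw [hA.1 _ (by simp), hℓ]) hj
    (by rw [hA.1 _ (by simp), hk]) hm hℓn hjn hkn hmn').mono le_rfl fun s'' h'' => ?_
  refine h''.trans (or_congr_right ?_)
  rw [hA.2]
  have hmem : ∀ b, b ∈ subblock n s' ℓ k j m ↔ b ∈ block n s ℓ k ∧ posT n s ℓ b / 2 ^ j = m := by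
    intro b
    rw [subblock, block, Finset.mem_filter, Finset.mem_filter, posS_of_agree hA hL,
      posT_of_agree hA hL, and_assoc]
  constructor
  · rintro ⟨b, hb, hn⟩
    obtain ⟨hb, hp⟩ := (hmem b).mp hb
    rw [div_eq_iff_mem (by positivity)] at hp
    exact ⟨_, hp.1, hp.2, b, hb, rfl, hn⟩
  · rintro ⟨p, h1, h2, b, hb, rfl, hn⟩
    exact ⟨b, (hmem b).mpr ⟨hb, (div_eq_iff_mem (by positivity)).mpr ⟨h1, h2⟩⟩, hn⟩

def midTime : ℕ :=
  midInit.bound + bsearchTime midTest + (midRange false).bound + (midRange true).bound +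
    rangeTime 50 0 + 2 * envTime

/-- A block is sorted by `slopeT`, so each side is a prefix or a suffix whose end is found by binary
search. The inner range loop then makes O(log n) envelope searches of O(log n) time each. -/
theorem midQuery_spec (upper : Bool) (hW : (n + 2) ^ 6 ≤ W) (h : Data n s) (ha : s.real 3 0 < 0)
    (hℓ : s.nat 42 0 = ℓ) (hk : s.nat 44 0 = k) (hℓn : 2 ^ ℓ ≤ n) (hkn : k ≤ n) :
    Runs W (midQuery upper) s (midTime * (Nat.log 2 n + 2) ^ 2) fun s' =>
      s'.nat found 0 ≠ 0 ↔
        (s.nat found 0 ≠ 0 ∨ ∃ b ∈ block n s ℓ k, Side upper s.real b ∧ Near s.real b) := by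
  have hbd := keyT_bound hW (lt_of_two_pow_le hℓn).le hkn
  have hW2 := lt_of_pow_six hW le_rfl
  obtain ⟨κ, hκ⟩ : ∃ κ, κ = ℓ * (n + 1) + k := ⟨_, rfl⟩
  have hI := h.mid ℓ k κ hκ hℓn hkn
  obtain ⟨cnt, hcnt⟩ : ∃ cnt, cnt = s.nat 112 κ := ⟨_, rfl⟩
  have hcn : cnt ≤ n := hcnt ▸ h.mid_le κ
  rw [← hcnt] at hI
  rw [← hκ] at hbd
  have hbd' : κ * (n + 1) + n + 2 < W := by linarith
  have hκW : κ ≤ κ * (n + 1) := Nat.le_mul_of_pos_right _ n.succ_pos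
  obtain ⟨f, hf⟩ : ∃ f : ℕ → ℕ, f = fun x => s.nat 113 (κ * (n + 1) + x) := ⟨_, rfl⟩
  rw [← hf] at hI
  obtain ⟨hI1, hI2, hI3⟩ := hI
  have hn := h.size
  have hK : (var 42 * (size + 1) + var 44).eval W s = κ := by
    have : ℓ * (n + 1) ≤ κ := by omega
    simp (disch := omega) [hn, hℓ, hk, Nat.mod_eq_of_lt, ← hκ]
  obtain ⟨s1, hs1⟩ : ∃ s1, s1 = midInit.run W s := ⟨_, rfl⟩
  have hA1 : Agree [21, 22, 13, 15] s s1 :=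
    hs1 ▸ Program.run_agree (by simp [midInit, Program.LoopFree])
      (by simp [midInit, Program.RealFree]) (by rfl) s
  have e21 : s1.nat 21 0 = κ := by
    simp [-NExpr.eval_add, hs1, midInit, Program.run, State.nat_setNat, hK]
  have e22 : s1.nat 22 0 = cnt := by
    simp [-NExpr.eval_add, hs1, midInit, Program.run, State.nat_setNat, hK, hcnt]
  have e13 : s1.nat 13 0 = 0 := by
    simp [hs1, midInit, Program.run, State.nat_setNat]
  have e15 : s1.nat 15 0 = cnt := by
    simp [-NExpr.eval_add, hs1, midInit, Program.run, State.nat_setNat, hK, hcnt]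
  obtain ⟨β, hβ⟩ : ∃ β, β = (s.real 3 1 - s.real 0 0) / s.real 3 0 := ⟨_, rfl⟩
  have hsearch := bsearch_spec (W := W) (test := midTest) (n := n)
    (p := fun x => slopeT s.real (f x) ≤ β) e13 e15 hcn hW2 ?_ ?_
  · refine (Runs.straight_seq (T := bsearchTime midTest * (Nat.log 2 n + 2) +
      (((midRange false).bound + (midRange true).bound) +
        rangeTime 50 (envTime * (Nat.log 2 n + 2)) * (Nat.log 2 n + 2)))
      (by simp [midInit, Program.LoopFree]) ?_).mono ?_ fun _ h => h
    · rw [← hs1]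
      refine Runs.seq_of hsearch ?_
      rintro s2 ⟨⟨q, hq, hlo, hq1, hq2⟩, hA2⟩
      simp only [lo] at hlo
      have hc2 : s2.nat 22 0 = cnt := by rw [hA2.1 _ (by simp), e22]
      obtain ⟨l, r, ⟨hl, hr⟩, hrn, hside⟩ : ∃ l r, (((midRange upper).run W s2).nat 50 0 = l ∧
          ((midRange upper).run W s2).nat 51 0 = r) ∧ r ≤ n ∧
          ∀ x < cnt, (l ≤ x ∧ x < r) ↔ Side upper s.real (f x) := by
        have hmem : ∀ x < cnt, slopeT s.real (f x) ≤ β ↔ x < q := fun x hx =>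
          ⟨fun h => by by_contra h'; exact hq2 x (by omega) hx h, hq1 x⟩
        cases upper
        · refine ⟨0, q, ?_, by omega, fun x hx => ?_⟩
          · simp [midRange, Program.run, State.nat_setNat, hlo]
          · simp only [Side, cond_false, ← hβ, hmem x hx, Nat.zero_le, true_and]
        · refine ⟨q, cnt, ?_, hcn, fun x hx => ?_⟩
          · simp [midRange, Program.run, State.nat_setNat, hlo, hc2]
          · simp only [Side, cond_true, ← hβ, hmem x hx, hx, and_true, not_lt]
      have hA3 : Agree [50, 51] s2 ((midRange upper).run W s2) := by
        cases upper
        · exact Program.run_agree (by simp [midRange, Program.LoopFree])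
            (by simp [midRange, Program.RealFree]) (by rfl) s2
        · exact Program.run_agree (by simp [midRange, Program.LoopFree])
            (by simp [midRange, Program.RealFree]) (by rfl) s2
      have hL : ∀ A ∈ [13, 14, 15, 21, 22, 50, 51], A ≠ 0 ∧ A < 100 := by simp
      have hA : Agree [13, 14, 15, 21, 22, 50, 51] s ((midRange upper).run W s2) :=
        (hA1.trans hA2 (M := [13, 14, 15, 21, 22, 50, 51]) (by simp) (by simp)).trans hA3 (by simp)
          (by simp)
      refine (Runs.straight_seq (T := rangeTime 50 (envTime * (Nat.log 2 n + 2)) *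
        (Nat.log 2 n + 2)) (by cases upper <;> simp [midRange, Program.LoopFree])
        ?_).mono ?_ fun _ h => h
      · refine (rangeLoop_spec (n := n) (F := 60) realFree_envQuery (by simp [mods_envQuery])
          (by simp) (envQuery_blockSpec hW (h.of_agree hA hL) (by rwa [hA.2])
          (by rw [hA.1 _ (by simp), hℓ]) (by rw [hA.1 _ (by simp), hk]) hℓn hkn) hW2 hl hr
          hrn).mono le_rfl fun s' h' => h'.trans ?_
        rw [hA.1 60 (by simp), hA.2, posT_of_agree hA hL]
        have hb : block n ((midRange upper).run W s2) ℓ k = block n s ℓ k := by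
          ext b
          rw [block, block, Finset.mem_filter, Finset.mem_filter, posS_of_agree hA hL]
        rw [hb]
        refine or_congr_right ⟨?_, ?_⟩
        · rintro ⟨p, h1, h2, b, hb, rfl, hn⟩
          obtain ⟨h3, h4⟩ := hI3 b hb
          have := (hside _ h3).mp ⟨h1, h2⟩
          rw [h4] at this
          exact ⟨b, hb, this, hn⟩
        · rintro ⟨b, hb, hs, hn⟩
          obtain ⟨h3, h4⟩ := hI3 b hb
          rw [← h4] at hs
          obtain ⟨h1, h2⟩ := (hside _ h3).mpr hs
          exact ⟨_, h1, h2, b, hb, rfl, hn⟩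
      · cases upper <;> omega
    · rw [rangeTime_eq, midTime]
      obtain ⟨x, hx⟩ : ∃ x, x = Nat.log 2 n + 2 := ⟨_, rfl⟩
      have h1 : x ≤ x ^ 2 := Nat.le_self_pow (by norm_num) x
      have h2 : 1 ≤ x ^ 2 := Nat.one_le_pow _ _ (by omega)
      rw [← hx]
      calc _ = midInit.bound * 1 + bsearchTime midTest * x + (midRange false).bound * 1 +
            (midRange true).bound * 1 + rangeTime 50 0 * x + 2 * envTime * x ^ 2 := by ring
        _ ≤ midInit.bound * x ^ 2 + bsearchTime midTest * x ^ 2 + (midRange false).bound * x ^ 2 +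
            (midRange true).bound * x ^ 2 + rangeTime 50 0 * x ^ 2 + 2 * envTime * x ^ 2 := by gcongr
        _ = _ := by ring
  · intro s' hf' hr' hmid
    simp only [mid] at hmid
    have hcell : (NExpr.get 113 (var K * (size + 1) + var mid)).eval W s' = f (s'.nat 14 0) := by
      have g1 : s'.nat 21 0 = κ := by rw [hf' _ (by simp), e21]
      have g2 : s'.nat 0 0 = n := by rw [hf' _ (by simp), hA1.1 _ (by simp), hn]
      have g3 : s'.nat 113 = s.nat 113 := by rw [hf' _ (by simp), hA1.1 _ (by simp)]
      rw [hf]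
      simp (disch := omega) [g1, g2, g3, Nat.mod_eq_of_lt]
    rw [midTest, Test.holds, Test.holds, eval_slopeTE, hcell, not_lt]
    simp only [querySlopeTE, RExpr.eval_div, RExpr.eval_sub, eval_axE, eval_tauE,
      eval_ayE (show 1 < W by omega), hr', hA1.2, hβ, mid]
  · intro x z hxz hz hpz
    rcases hxz.eq_or_lt with rfl | hxz
    · exact hpz
    · exact (not_lt.mp (hI2 x z hxz hz)).trans hpz

end midQuery

end SegmentQuery

namespace SegmentQuery

open RealRAM RealRAM.Reg Reg

/-! ## The query programs -/

def topInit : Program := found ←ₙ 0 ;; lo ←ₙ 0 ;; hi ←ₙ .get 102 0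

def topTest : Test := .realLt (slopeSE (.get 103 (var mid))) querySlopeSE

/-- The three intervals of positions that are searched. -/
def rangeAbove : Program := 40 ←ₙ var lo ;; 41 ←ₙ .get 102 0
def rangeBelow : Program := 40 ←ₙ 0 ;; 41 ←ₙ var lo
def rangeAll : Program := 40 ←ₙ 0 ;; 41 ←ₙ .get 102 0

/-- Truncated subtraction maps every nonzero flag to `0`. -/
def report : Program := 1 ←ₙ 1 - var found

/-- Avoiding points either fail the condition at `s` but satisfy the one at `t`, or fail the one at
`t`. Each case is an interval of positions by `slopeS` combined with one side by `slopeT`. -/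
def query : Kind → Program
  | .crossing => topInit ;; bsearch topTest ;;
      (rangeAbove ;; rangeLoop 40 (midQuery false)) ;; report
  | .avoiding => topInit ;; bsearch topTest ;; (rangeBelow ;; rangeLoop 40 (midQuery false)) ;;
      (rangeAll ;; rangeLoop 40 (midQuery true)) ;; report

/-- The registers used by the queries. -/
def queryRegs : List ℕ :=
  [1, 13, 14, 15, 21, 22, 40, 41, 42, 43, 44, 50, 51, 52, 53, 54, 60]

theorem queryRegs_lt : ∀ A ∈ queryRegs, A ≠ 0 ∧ A < 100 := by simp [queryRegs]

theorem mods_rangeLoop {o : ℕ} {use : Program} :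
    ∀ A ∈ (rangeLoop o use).mods, A ∈ [o, o + 1, o + 2, o + 3, o + 4] ∨ A ∈ use.mods := by
  intro A hA
  simp [rangeLoop, rangeLeft, rangeRight, rangeUp, Program.mods] at hA ⊢
  tauto

theorem mods_topRange {init : Program} (hm : init.mods = [40, 41]) (upper : Bool) :
    ∀ A ∈ (init ;; rangeLoop 40 (midQuery upper)).mods, A ∈ queryRegs := by
  intro A hA
  rw [Program.mods, hm, List.mem_append] at hA
  have h1 : A ∈ [40, 41, 42, 43, 44] ∨ A ∈ [13, 14, 15, 21, 22, 50, 51, 52, 53, 54, 60] := by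
    rcases hA with hA | hA
    · exact .inl (by simp at hA ⊢; omega)
    · exact (mods_rangeLoop A hA).imp id (mods_midQuery upper A)
  simp [queryRegs] at h1 ⊢
  omega

section query

variable {W n : ℕ} {s : State}

theorem midQuery_blockSpec (upper : Bool) (hW : (n + 2) ^ 6 ≤ W) (h : Data n s)
    (ha : s.real 3 0 < 0) :
    BlockSpec W 40 60 n (midTime * (Nat.log 2 n + 2) ^ 2) (midQuery upper)
      (fun p => ∃ b < n, posS s b = p ∧ Side upper s.real b ∧ Near s.real b) s := by
  intro s' ℓ k hA hℓ hk hkn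
  have hL : ∀ A ∈ [40, 40 + 1, 40 + 2, 40 + 3, 40 + 4] ++ (midQuery upper).mods,
      A ≠ 0 ∧ A < 100 := by
    intro A hA
    rcases List.mem_append.mp hA with hA | hA
    · simp at hA; omega
    · have := mods_midQuery upper A hA
      simp at this; omega
  have hℓn : 2 ^ ℓ ≤ n := (Nat.le_mul_of_pos_left _ (Nat.succ_pos k)).trans hkn
  have hkn' : k ≤ n := by
    have := Nat.le_mul_of_pos_right (k + 1) (show 0 < 2 ^ ℓ by positivity)
    omega
  refine (midQuery_spec upper hW (h.of_agree hA hL) (by rwa [hA.2]) hℓ hk hℓn hkn').mono le_rfl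
    fun s'' h'' => h''.trans (or_congr_right ?_)
  rw [hA.2]
  have hmem : ∀ b, b ∈ block n s' ℓ k ↔ b < n ∧ posS s b / 2 ^ ℓ = k := by
    intro b
    rw [block, Finset.mem_filter, posS_of_agree hA hL, Finset.mem_range]
  constructor
  · rintro ⟨b, hb, hn⟩
    obtain ⟨hb, hp⟩ := (hmem b).mp hb
    rw [div_eq_iff_mem (by positivity)] at hp
    exact ⟨_, hp.1, hp.2, b, hb, rfl, hn⟩
  · rintro ⟨p, h1, h2, b, hb, rfl, hn⟩
    exact ⟨b, (hmem b).mpr ⟨hb, (div_eq_iff_mem (by positivity)).mpr ⟨h1, h2⟩⟩, hn⟩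

def topTime : ℕ :=
  rangeAbove.bound + rangeBelow.bound + rangeAll.bound + rangeTime 40 0 + 2 * midTime

theorem topRange_spec {init : Program} (upper : Bool) (hW : (n + 2) ^ 6 ≤ W) (h : Data n s)
    (ha : s.real 3 0 < 0) (hi : init ∈ [rangeAbove, rangeBelow, rangeAll]) {l r : ℕ}
    (hl : (init.run W s).nat 40 0 = l) (hr : (init.run W s).nat 41 0 = r) (hrn : r ≤ n) :
    Runs W (init ;; rangeLoop 40 (midQuery upper)) s (topTime * (Nat.log 2 n + 2) ^ 3) fun s' =>
      (s'.nat found 0 ≠ 0 ↔ (s.nat found 0 ≠ 0 ∨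
        ∃ b < n, (l ≤ posS s b ∧ posS s b < r) ∧ Side upper s.real b ∧ Near s.real b)) ∧
      Agree (init ;; rangeLoop 40 (midQuery upper)).mods s s' := by
  have hi' : init.LoopFree ∧ init.RealFree ∧ init.mods = [40, 41] ∧
      init.bound ≤ rangeAbove.bound + rangeBelow.bound + rangeAll.bound := by
    simp only [List.mem_cons, List.not_mem_nil, or_false] at hi
    rcases hi with rfl | rfl | rfl
    · exact ⟨by simp [rangeAbove, Program.LoopFree], by simp [rangeAbove, Program.RealFree], rfl,
        by omega⟩
    · exact ⟨by simp [rangeBelow, Program.LoopFree], by simp [rangeBelow, Program.RealFree], rfl,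
        by omega⟩
    · exact ⟨by simp [rangeAll, Program.LoopFree], by simp [rangeAll, Program.RealFree], rfl,
        by omega⟩
  obtain ⟨hi1, hi2, hi3, hi4⟩ := hi'
  have hA := Program.run_agree (W := W) hi1 hi2 hi3 s
  have hL : ∀ A ∈ [40, 41], A ≠ 0 ∧ A < 100 := by simp
  have hrf : (init ;; rangeLoop 40 (midQuery upper)).RealFree := by
    simp [Program.RealFree, rangeLoop, rangeLeft, rangeRight, rangeUp, hi2, realFree_midQuery]
  refine Runs.agree ((Runs.straight_seq hi1 ((rangeLoop_spec (n := n) (F := 60)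
    (realFree_midQuery upper) (fun A hA => ?_) (by simp) (midQuery_blockSpec upper hW
    (h.of_agree hA hL) (by rwa [hA.2])) (lt_of_pow_six hW le_rfl) hl hr hrn).mono le_rfl
      fun s' h' => ?_)).mono ?_ fun _ h => h) hrf
  · have := mods_midQuery upper A hA
    simp at this ⊢; omega
  · refine h'.trans ?_
    rw [hA.1 60 (by simp), hA.2, posS_of_agree hA hL]
    refine or_congr_right ⟨?_, ?_⟩
    · rintro ⟨p, h1, h2, b, hb, rfl, hn⟩
      exact ⟨b, hb, ⟨h1, h2⟩, hn⟩
    · rintro ⟨b, hb, ⟨h1, h2⟩, hn⟩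
      exact ⟨_, h1, h2, b, hb, rfl, hn⟩
  · rw [rangeTime_eq, topTime]
    obtain ⟨x, hx⟩ : ∃ x, x = Nat.log 2 n + 2 := ⟨_, rfl⟩
    have h1 : x ≤ x ^ 3 := Nat.le_self_pow (by norm_num) x
    have h2 : 1 ≤ x ^ 3 := Nat.one_le_pow _ _ (by omega)
    rw [← hx]
    calc _ ≤ (rangeAbove.bound + rangeBelow.bound + rangeAll.bound) * 1 + rangeTime 40 0 * x +
          2 * midTime * x ^ 3 := by linarith [hi4]
      _ ≤ (rangeAbove.bound + rangeBelow.bound + rangeAll.bound) * x ^ 3 + rangeTime 40 0 * x ^ 3 +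
          2 * midTime * x ^ 3 := by gcongr
      _ = _ := by ring

def queryTime : ℕ :=
  topInit.bound + bsearchTime topTest + 2 * topTime + report.bound

/-- The point with index `b` is on the side of the queries of the given kind. -/
def OnSide (ρ : ℕ → ℕ → ℝ) (b : ℕ) : Kind → Prop
  | .crossing => ¬ slopeS ρ b < ρ 3 1 / ρ 3 0 ∧ Side false ρ b
  | .avoiding => (slopeS ρ b < ρ 3 1 / ρ 3 0 ∧ Side false ρ b) ∨ Side true ρ b

theorem realFree_query (κ : Kind) : (query κ).RealFree := by
  cases κ <;> simp [query, topInit, bsearch, rangeAbove, rangeBelow, rangeAll, report, rangeLoop,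
    rangeLeft, rangeRight, rangeUp, realFree_midQuery, Program.RealFree]

theorem mods_query (κ : Kind) : ∀ A ∈ (query κ).mods, A ∈ queryRegs := by
  have h0 : ∀ A ∈ topInit.mods ++ (bsearch topTest).mods ++ report.mods, A ∈ queryRegs := by
    simp [topInit, bsearch, report, Program.mods, queryRegs]
  have h1 := mods_topRange (init := rangeAbove) rfl false
  have h2 := mods_topRange (init := rangeBelow) rfl false
  have h3 := mods_topRange (init := rangeAll) rfl true
  intro A hA
  simp only [List.mem_append] at h0
  cases κ
  · rcases List.mem_append.mp hA with hA | hA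
    · exact h0 A (.inl (.inl hA))
    rcases List.mem_append.mp hA with hA | hA
    · exact h0 A (.inl (.inr hA))
    rcases List.mem_append.mp hA with hA | hA
    · exact h1 A hA
    · exact h0 A (.inr hA)
  · rcases List.mem_append.mp hA with hA | hA
    · exact h0 A (.inl (.inl hA))
    rcases List.mem_append.mp hA with hA | hA
    · exact h0 A (.inl (.inr hA))
    rcases List.mem_append.mp hA with hA | hA
    · exact h2 A hA
    rcases List.mem_append.mp hA with hA | hA
    · exact h3 A hA
    · exact h0 A (.inr hA)

/-- Besides the answer, the data structure and the real memory are returned intact, as the next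
query needs them. -/
theorem query_spec (κ : Kind) (hW : (n + 2) ^ 6 ≤ W) (h : Data n s) (ha : s.real 3 0 < 0) :
    Runs W (query κ) s (queryTime * (Nat.log 2 n + 2) ^ 3) fun s' =>
      (((∃ b < n, OnSide s.real b κ ∧ Near s.real b) ∧ output s' = 0) ∨
        ((¬ ∃ b < n, OnSide s.real b κ ∧ Near s.real b) ∧ output s' = 1)) ∧ Data n s' ∧
      s'.real = s.real := by
  have hW2 := lt_of_pow_six hW le_rfl
  have hn := h.size
  have hcn := h.top_le
  obtain ⟨hI1, hI2, hI3⟩ := h.top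
  obtain ⟨cnt, hcnt⟩ : ∃ cnt, cnt = s.nat 102 0 := ⟨_, rfl⟩
  rw [← hcnt] at hI1 hI2 hI3 hcn
  obtain ⟨x, hx⟩ : ∃ x, x = Nat.log 2 n + 2 := ⟨_, rfl⟩
  obtain ⟨α, hα⟩ : ∃ α, α = s.real 3 1 / s.real 3 0 := ⟨_, rfl⟩
  obtain ⟨s1, hs1⟩ : ∃ s1, s1 = topInit.run W s := ⟨_, rfl⟩
  have hA1 : Agree [60, 13, 15] s s1 :=
    hs1 ▸ Program.run_agree (by simp [topInit, Program.LoopFree])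
      (by simp [topInit, Program.RealFree]) (by rfl) s
  have e60 : s1.nat 60 0 = 0 := by simp [hs1, topInit, Program.run, State.nat_setNat]
  have e13 : s1.nat 13 0 = 0 := by simp [hs1, topInit, Program.run, State.nat_setNat]
  have e15 : s1.nat 15 0 = cnt := by simp [hs1, topInit, Program.run, State.nat_setNat, hcnt]
  have hsearch := bsearch_spec (W := W) (test := topTest) (n := n)
    (p := fun x => slopeS s.real (s.nat 103 x) < α) e13 e15 hcn hW2 ?_ ?_
  · have hrep : ∀ s' : State, (s'.nat found 0 ≠ 0 ↔ ∃ b < n, OnSide s.real b κ ∧ Near s.real b) →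
        Runs W report s' report.bound fun s' =>
          ((∃ b < n, OnSide s.real b κ ∧ Near s.real b) ∧ output s' = 0) ∨
          ((¬ ∃ b < n, OnSide s.real b κ ∧ Near s.real b) ∧ output s' = 1) := by
      intro s' h'
      refine Runs.straight (by simp [report]) ?_
      by_cases hb : ∃ b < n, OnSide s.real b κ ∧ Near s.real b
      · have hf := h'.mpr hb
        simp only [found] at hf
        refine .inl ⟨hb, ?_⟩
        have : 1 - s'.nat 60 0 = 0 := by omega
        simp (disch := omega) [report, output, State.nat_setNat, Nat.mod_eq_of_lt, this]
      · have hf := not_not.mp (mt h'.mp hb)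
        simp only [found] at hf
        refine .inr ⟨hb, ?_⟩
        simp (disch := omega) [report, output, State.nat_setNat, Nat.mod_eq_of_lt, hf]
    refine (Runs.agree (Q := fun s' =>
        ((∃ b < n, OnSide s.real b κ ∧ Near s.real b) ∧ output s' = 0) ∨
        ((¬ ∃ b < n, OnSide s.real b κ ∧ Near s.real b) ∧ output s' = 1)) ?_
          (realFree_query κ)).mono le_rfl fun s' h' => ⟨h'.1, h.of_agree h'.2 fun A hA =>
            queryRegs_lt A (mods_query κ A hA), h'.2.2⟩
    have htop : ∀ s2 : State, Agree queryRegs s s2 → Data n s2 ∧ s2.real 3 0 < 0 ∧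
        posS s2 = posS s ∧ s2.nat 102 0 = cnt := fun s2 hA =>
      ⟨h.of_agree hA queryRegs_lt, by rwa [hA.2], posS_of_agree hA queryRegs_lt,
        by rw [hA.1 102 (by simp [queryRegs]), hcnt]⟩
    have hpos : ∀ q ≤ cnt, (∀ x < q, slopeS s.real (s.nat 103 x) < α) →
        (∀ x, q ≤ x → x < cnt → ¬ slopeS s.real (s.nat 103 x) < α) → ∀ b < n, posS s b < cnt ∧
        (posS s b < q ↔ slopeS s.real b < α) := by
      intro q hq h1 h2 b hb
      obtain ⟨h3, h4⟩ := hI3 b (Finset.mem_range.mpr hb)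
      refine ⟨h3, fun hlt => ?_, fun hlt => ?_⟩
      · have := h1 _ hlt
        rwa [posS, h4] at this
      · by_contra hge
        have := h2 _ (not_lt.mp hge) h3
        rw [posS, h4] at this
        exact this hlt
    have hbs : ∀ s2 : State, Agree [13, 14, 15] s1 s2 → Agree queryRegs s s2 ∧ s2.nat 60 0 = 0 :=
      fun s2 hA2 => ⟨hA1.trans hA2 (by simp [queryRegs]) (by simp [queryRegs]),
        by rw [hA2.1 _ (by simp), e60]⟩
    have hx3 : x ≤ x ^ 3 := Nat.le_self_pow (by norm_num) x
    have hx3' : 1 ≤ x ^ 3 := Nat.one_le_pow _ _ (by omega)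
    rw [← hx] at hsearch ⊢
    cases κ
    · refine (Runs.straight_seq (T := bsearchTime topTest * x + (topTime * x ^ 3 + report.bound))
        (by simp [topInit, Program.LoopFree]) ?_).mono ?_ fun _ h => h
      · rw [← hs1]
        refine Runs.seq_of hsearch ?_
        rintro s2 ⟨⟨q, hq, hlo, hq1, hq2⟩, hA2⟩
        obtain ⟨hA, h60⟩ := hbs s2 hA2
        obtain ⟨hD, ha2, hp2, h102⟩ := htop s2 hA
        simp only [lo] at hlo
        refine Runs.seq_of (hx ▸ topRange_spec (init := rangeAbove) (l := q) (r := cnt) false hW hD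
          ha2 (by simp) (by simp [rangeAbove, Program.run, State.nat_setNat, hlo])
          (by simp [rangeAbove, Program.run, State.nat_setNat, h102]) hcn) ?_
        rintro s3 ⟨h3, -⟩
        refine hrep s3 (h3.trans ?_)
        simp only [found, h60, hA.2, hp2, ne_eq, not_true_eq_false, false_or]
        refine exists_congr fun b => and_congr_right fun hb => ?_
        obtain ⟨h1, h2⟩ := hpos q hq hq1 hq2 b hb
        simp only [OnSide, ← hα, ← h2, not_lt, h1, and_true, and_assoc]
      · rw [queryTime]
        nlinarith [Nat.mul_le_mul_left (bsearchTime topTest) hx3,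
          Nat.mul_le_mul_left topInit.bound hx3',
          Nat.mul_le_mul_left report.bound hx3', Nat.zero_le (topTime * x ^ 3)]
    · refine (Runs.straight_seq (T := bsearchTime topTest * x + (topTime * x ^ 3 +
        (topTime * x ^ 3 + report.bound))) (by simp [topInit, Program.LoopFree]) ?_).mono ?_
        fun _ h => h
      · rw [← hs1]
        refine Runs.seq_of hsearch ?_
        rintro s2 ⟨⟨q, hq, hlo, hq1, hq2⟩, hA2⟩
        obtain ⟨hA, h60⟩ := hbs s2 hA2
        obtain ⟨hD, ha2, hp2, h102⟩ := htop s2 hA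
        simp only [lo] at hlo
        refine Runs.seq_of (hx ▸ topRange_spec (init := rangeBelow) (l := 0) (r := q) false hW hD
          ha2 (by simp) (by simp [rangeBelow, Program.run, State.nat_setNat])
          (by simp [rangeBelow, Program.run, State.nat_setNat, hlo]) (hq.trans hcn)) ?_
        rintro s3 ⟨h3, hA3⟩
        have hA' : Agree queryRegs s s3 :=
          hA.trans hA3 (fun _ h => h) (mods_topRange rfl false)
        obtain ⟨hD, ha2, hp3, h102⟩ := htop s3 hA'
        refine Runs.seq_of (hx ▸ topRange_spec (init := rangeAll) (l := 0) (r := cnt) true hW hD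
          ha2 (by simp) (by simp [rangeAll, Program.run, State.nat_setNat])
          (by simp [rangeAll, Program.run, State.nat_setNat, h102]) hcn) ?_
        rintro s4 ⟨h4, -⟩
        refine hrep s4 (h4.trans ?_)
        rw [h3]
        simp only [found, h60, hA.2, hA'.2, hp2, hp3, ne_eq, not_true_eq_false, false_or]
        rw [← exists_or]
        refine exists_congr fun b => ?_
        rw [← and_or_left]
        refine and_congr_right fun hb => ?_
        obtain ⟨h1, h2⟩ := hpos q hq hq1 hq2 b hb
        simp only [OnSide, ← hα, ← h2, h1, and_true, Nat.zero_le, true_and]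
        tauto
      · rw [queryTime]
        nlinarith [Nat.mul_le_mul_left (bsearchTime topTest) hx3,
          Nat.mul_le_mul_left topInit.bound hx3',
          Nat.mul_le_mul_left report.bound hx3']
  · intro s' hf' hr' hmid
    have hr1 : s'.real = s.real := hr'.trans hA1.2
    have h103 : s'.nat 103 = s.nat 103 := by rw [hf' _ (by simp), hA1.1 _ (by simp)]
    rw [topTest, Test.holds, eval_slopeSE]
    simp only [querySlopeSE, RExpr.eval_div, eval_axE, eval_ayE (show 1 < W by omega), hr1, hα,
      NExpr.eval_get, eval_var, h103]
  · intro x z hxz hz hpz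
    rcases hxz.eq_or_lt with rfl | hxz
    · exact hpz
    · exact (not_lt.mp (hI2 x z hxz hz)).trans_lt hpz

end query

end SegmentQuery

namespace SegmentQuery

open RealRAM

/-! ## Correctness on the input -/

theorem withQuery_real_of_ne (s : State) (a : Plane) {A : ℕ} (hA : A ≠ 3) :
    (withQuery s a).real A = s.real A := by
  simp [withQuery, State.setReal, hA]

theorem withQuery_real_zero (s : State) (a : Plane) : (withQuery s a).real 3 0 = a 0 := by
  simp [withQuery, State.setReal]

theorem withQuery_real_one (s : State) (a : Plane) : (withQuery s a).real 3 1 = a 1 := by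
  simp [withQuery, State.setReal]

theorem Data.withQuery {n : ℕ} {s : State} (h : Data n s) (a : Plane) :
    Data n (withQuery s a) :=
  h.congr (fun _ _ => rfl) (by rw [withQuery_real_of_ne _ _ (by norm_num)])
    (withQuery_real_of_ne _ _ (by norm_num)) (withQuery_real_of_ne _ _ (by norm_num))

theorem mem_answerSet_iff {n : ℕ} {τ : ℝ} (hτ : 0 ≤ τ) {p : Fin n → Plane} (hp : ∀ i, 0 < p i 0)
    {a : Plane} (ha : a 0 < 0) {ρ : ℕ → ℕ → ℝ} (h0 : ρ 0 0 = τ)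
    (h1 : ∀ i : Fin n, ρ 1 i = p i 0) (h2 : ∀ i : Fin n, ρ 2 i = p i 1) (h30 : ρ 3 0 = a 0)
    (h31 : ρ 3 1 = a 1) (κ : Kind) (i : Fin n) :
    p i ∈ answerSet τ (Set.range p) a κ ↔ OnSide ρ i κ ∧ Near ρ i := by
  have hnear : Near ρ i ↔ dist a (p i) ≤ 1 := by
    rw [near_iff (by rw [h1]; exact hp i) (by rwa [h30]), dist_le_one_iff, h1, h2, h30, h31]
  have hS : slopeS ρ i = p i 1 / p i 0 := by rw [slopeS, h1, h2]
  have hT : slopeT ρ i = (p i 1 - τ) / p i 0 := by rw [slopeT, h1, h2, h0]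
  have hseg := segment_inter_sigma hτ ha (hp i)
  cases κ
  · simp only [answerSet, Set.mem_ofPred_eq, Set.mem_range_self, true_and, hseg, hnear, OnSide, Side,
      cond_false, hS, hT, h0, h30, h31, not_lt, and_assoc]
  · simp only [answerSet, Set.mem_ofPred_eq, Set.mem_range_self, true_and, hseg, hnear, OnSide, Side,
      cond_false, cond_true, hS, hT, h0, h30, h31]
    refine and_congr_left fun _ => ?_
    -- The negation of `A ∧ B` is split as `(¬ A ∧ B) ∨ ¬ B`, matching the two searches of the
    -- program.
    rw [not_and_or, ← not_le]
    tauto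

theorem answerSet_nonempty_iff {n : ℕ} {τ : ℝ} (hτ : 0 ≤ τ) {p : Fin n → Plane}
    (hp : ∀ i, 0 < p i 0) {a : Plane} (ha : a 0 < 0) {ρ : ℕ → ℕ → ℝ} (h0 : ρ 0 0 = τ)
    (h1 : ∀ i : Fin n, ρ 1 i = p i 0) (h2 : ∀ i : Fin n, ρ 2 i = p i 1) (h30 : ρ 3 0 = a 0)
    (h31 : ρ 3 1 = a 1) (κ : Kind) :
    (answerSet τ (Set.range p) a κ).Nonempty ↔ ∃ b < n, OnSide ρ b κ ∧ Near ρ b := by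
  have hmem := mem_answerSet_iff hτ hp ha h0 h1 h2 h30 h31 κ
  constructor
  · rintro ⟨x, hx⟩
    obtain ⟨i, rfl⟩ : x ∈ Set.range p := by cases κ <;> exact hx.1
    exact ⟨i, i.2, (hmem i).mp hx⟩
  · rintro ⟨b, hb, h⟩
    exact ⟨p ⟨b, hb⟩, (hmem ⟨b, hb⟩).mpr h⟩

theorem serves {W n : ℕ} (hW : (n + 2) ^ 6 ≤ W) {τ : ℝ} (hτ : 0 ≤ τ) {p : Fin n → Plane}
    (hp : ∀ i, 0 < p i 0) (qs : List (Kind × Plane)) (hqs : ∀ q ∈ qs, q.2 0 < 0) {s : State}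
    (h : Data n s) (h0 : s.real 0 0 = τ) (h1 : ∀ i : Fin n, s.real 1 i = p i 0)
    (h2 : ∀ i : Fin n, s.real 2 i = p i 1) :
    Serves W (queryTime * (Nat.log 2 n + 2) ^ 3) query τ (Set.range p) qs s := by
  induction qs generalizing s with
  | nil => trivial
  | cons q qs ih =>
    obtain ⟨κ, a⟩ := q
    have ha : a 0 < 0 := hqs (κ, a) (by simp)
    obtain ⟨k, s', he, hk, hout, hD, hr⟩ := query_spec κ hW (h.withQuery a)
      (by rwa [withQuery_real_zero])
    have g0 : (withQuery s a).real 0 0 = τ := by rw [withQuery_real_of_ne _ _ (by norm_num), h0]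
    have g1 : ∀ i : Fin n, (withQuery s a).real 1 i = p i 0 := fun i => by
      rw [withQuery_real_of_ne _ _ (by norm_num), h1]
    have g2 : ∀ i : Fin n, (withQuery s a).real 2 i = p i 1 := fun i => by
      rw [withQuery_real_of_ne _ _ (by norm_num), h2]
    rw [← answerSet_nonempty_iff hτ hp ha g0 g1 g2 (withQuery_real_zero s a)
      (withQuery_real_one s a) κ, Set.not_nonempty_iff_eq_empty] at hout
    exact ⟨k, s', he, hk, hout.symm, ih (fun q hq => hqs q (List.mem_cons_of_mem _ hq)) hD
      (by rw [hr, g0]) (by rw [hr]; exact g1) (by rw [hr]; exact g2)⟩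

/-! ## Asymptotics -/

theorem log_two_add_isBigO (k : ℕ) :
    (fun n : ℕ => ((Nat.log 2 n + k : ℕ) : ℝ)) =O[atTop] fun n : ℕ => Real.log n := by
  have h1 : (fun n : ℕ => ((Nat.log 2 n : ℕ) : ℝ)) =O[atTop] fun n : ℕ => Real.log n := by
    refine IsBigO.of_bound (1 / Real.log 2) (Eventually.of_forall fun n => ?_)
    have hl2 : 0 < Real.log 2 := Real.log_pos (by norm_num)
    have := Real.natLog_le_logb n 2
    rw [Real.logb] at this
    rw [Real.norm_of_nonneg (Nat.cast_nonneg _), Real.norm_of_nonneg (Real.log_natCast_nonneg n)]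
    push_cast at this
    rw [div_mul_eq_mul_div, one_mul]
    exact this
  have h2 : (fun _ : ℕ => (k : ℝ)) =O[atTop] fun n : ℕ => Real.log n :=
    (isLittleO_const_left.mpr (.inr (tendsto_norm_atTop_atTop.comp
      (Real.tendsto_log_atTop.comp tendsto_natCast_atTop_atTop)))).isBigO
  simpa using h1.add h2

theorem queryTime_isBigO (C : ℕ) :
    (fun n : ℕ => ((C * (Nat.log 2 n + 2) ^ 3 : ℕ) : ℝ)) =O[atTop]
      fun n : ℕ => Real.log n ^ 3 := by
  simpa using ((log_two_add_isBigO 2).pow 3).const_mul_left (C : ℝ)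

/-- One logarithm is to spare: the square is bounded by the cube because `Nat.log 2 n + 3` is at
least `1`. -/
theorem preprocessTime_isBigO (C : ℕ) :
    (fun n : ℕ => ((C * ((n + 1) * (Nat.log 2 n + 3) ^ 2) : ℕ) : ℝ)) =O[atTop]
      fun n : ℕ => (n : ℝ) * Real.log n ^ 3 := by
  have h1 : (fun n : ℕ => ((n : ℝ) + 1)) =O[atTop] fun n : ℕ => (n : ℝ) :=
    (isBigO_refl _ _).add ((isLittleO_const_left.mpr (.inr (tendsto_norm_atTop_atTop.comp
      tendsto_natCast_atTop_atTop))).isBigO)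
  have h2 : (fun n : ℕ => ((Nat.log 2 n + 3 : ℕ) : ℝ) ^ 2) =O[atTop]
      fun n : ℕ => Real.log n ^ 3 := by
    refine IsBigO.trans (IsBigO.of_bound 1 (Eventually.of_forall fun n => ?_))
      ((log_two_add_isBigO 3).pow 3)
    rw [one_mul, Real.norm_of_nonneg (by positivity), Real.norm_of_nonneg (by positivity)]
    exact pow_le_pow_right₀ (by norm_cast; omega) (by norm_num)
  simpa using (h1.mul h2).const_mul_left (C : ℝ)

end SegmentQuery

/-! ### The main theorem -/

theorem mainTheorem2 :
    ∃ (w : ℕ) (preprocess : RealRAM.Program) (query : SegmentQuery.Kind → RealRAM.Program)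
      (Tp Tq : ℕ → ℕ),
      0 < w ∧
      (fun n : ℕ => (Tp n : ℝ)) =O[atTop] (fun n : ℕ => (n : ℝ) * Real.log n ^ 3) ∧
      (fun n : ℕ => (Tq n : ℝ)) =O[atTop] (fun n : ℕ => Real.log n ^ 3) ∧
      ∀ (n : ℕ) (τ : ℝ) (p : Fin n → SegmentQuery.Plane),
        0 ≤ τ → Function.Injective p → (∀ i, 0 < p i 0) →
        ∃ (k : ℕ) (s : RealRAM.State),
          RealRAM.Exec (RealRAM.wordBound w n) preprocess (SegmentQuery.inputState τ p) k s ∧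
          k ≤ Tp n ∧
          ∀ qs : List (SegmentQuery.Kind × SegmentQuery.Plane),
            (∀ q ∈ qs, q.2 0 < 0) →
            SegmentQuery.Serves (RealRAM.wordBound w n) (Tq n) query τ (Set.range p) qs s := by
  -- The word size `6` is the exponent required by `keyY_bound`.
  refine ⟨6, SegmentQuery.preprocess, SegmentQuery.query,
    fun n => SegmentQuery.preprocessTime * ((n + 1) * (Nat.log 2 n + 3) ^ 2),
    fun n => SegmentQuery.queryTime * (Nat.log 2 n + 2) ^ 3, by norm_num,
    SegmentQuery.preprocessTime_isBigO _,
    SegmentQuery.queryTime_isBigO _, fun n τ p hτ _ hp => ?_⟩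
  have h1 : ∀ i : Fin n, (SegmentQuery.inputState τ p).real 1 i = p i 0 := fun i => by
    simp [SegmentQuery.inputState]
  have h2 : ∀ i : Fin n, (SegmentQuery.inputState τ p).real 2 i = p i 1 := fun i => by
    simp [SegmentQuery.inputState]
  have hpos : ∀ b < n, 0 < (SegmentQuery.inputState τ p).real 1 b := fun b hb => by
    rw [h1 ⟨b, hb⟩]; exact hp _
  obtain ⟨k, s, he, hk, hready⟩ := SegmentQuery.preprocess_spec (W := RealRAM.wordBound 6 n)
    (s := SegmentQuery.inputState τ p) le_rfl hpos (by simp [SegmentQuery.inputState])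
    fun A hA x => by simp [SegmentQuery.inputState, hA]
  have hr : s.real = (SegmentQuery.inputState τ p).real := hready.1.real
  rw [← hr] at hready hpos h1 h2
  exact ⟨k, s, he, hk, fun qs hqs => SegmentQuery.serves le_rfl hτ hp qs hqs (hready.data hpos)
    (by rw [hr]; simp [SegmentQuery.inputState]) h1 h2⟩
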